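/- Let $d\ge 2$, let $\sigma$ be the surface (induced Lebesgue) measure on the unit sphere $\mathbb S^{d-1}\subset\mathbb R^d$, and for $f\in L^2(\mathbb R^d\times\mathbb S^{d-1})$ (with respect to $\mathrm dx\,\mathrm d\sigma(v)$) let $$\rho f(x,t)=\int_{\mathbb S^{d-1}}f(x-tv,v)\,\mathrm d\sigma(v),\qquad (x,t)\in\mathbb R^d\times\mathbb R .$$ Write $\widehat g(\xi,\tau)=\int g(x,t)e^{-i(x\cdot\xi+t\tau)}\,\mathrm dx\,\mathrm dt$ for the space-time Fourier transform, extended to tempered distributions, and $\|G\|_{L^q_tL^r_x}=\big(\int_{\mathbb R}\big(\int_{\mathbb R^d}|G(x,t)|^r\,\mathrm dx\big)^{q/r}\mathrm dt\big)^{1/q}$. Let $D_+^{\beta_+}D_-^{\beta_-}$ be the Fourier multiplier operator with multiplier $(|\xi|+|\tau|)^{\beta_+}\,\big||\xi|-|\tau|\big|^{\beta_-}$. Let $\phi\in C_c^\infty(\mathbb R)$ be supported in $[\frac12,2]$ and not identically zero, and let the cone multiplier operator $\mathcal C^\alpha$ of order $\alpha\in\mathbb R$ be given by $$\widehat{\mathcal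 C^\alpha g}(\xi,\tau)=\Big(1-\frac{\tau^2}{|\xi|^2}\Big)_+^{\alpha}\phi(|\xi|)\,\widehat g(\xi,\tau),$$ where $(\cdot)_+^\alpha$ vanishes for $|\tau|\ge|\xi|$. (A Fourier multiplier operator with multiplier $m$ is defined at $u$, with image $\mathcal F^{-1}(m\widehat u)$, when $\widehat u$ is a function and $m\widehat u$ is integrable against every Schwartz function; an estimate for a class of functions includes the claim that the operator is defined on that class.) Let $q,r\in[2,\infty)$ and let $\beta_+,\beta_-\in\mathbb R$ satisfy $$\beta_++\beta_-=\frac dr+\frac1q-\frac d2 .$$ Then there is a constant $C<\infty$ such that $$\|D_+^{\beta_+}D_-^{\beta_-}\rho f\|_{L^q_tL^r_x}\le C\|f\|_{L^2_{x,v}}\qquad\text{for all } f\in L^2(\mathbb R^d\times\mathbb S^{d-1})$$ if and only if $\mathcal C^{\beta_-+\frac{d-3}{4}}$ is bounded from $L^2_{t,x}$ to $L^q_tL^r_x$, that is, there is a constant $C'<\infty$ such that $$\|\mathcal C^{\beta_-+\frac{d-3}{4}}g\|_{L^q_tL^r_x}\le C'\|g\|_{L^2_{t,x}}\qquad\text{for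 all } g\in L^2(\mathbb R^d\times\mathbb R).$$ -/

import Mathlib

open MeasureTheory
open scoped ENNReal NNReal ContDiff SchwartzMap

noncomputable section

namespace VelocityAverage

/-- The spatial (and frequency) domain `ℝ^d` with its Euclidean norm. -/
abbrev Space (d : ℕ) : Type := EuclideanSpace ℝ (Fin d)

/-- The velocity domain: the unit sphere `𝕊^{d-1}` of `ℝ^d`. -/
abbrev Velocity (d : ℕ) : Type := Metric.sphere (0 : Space d) 1

/-- Space-time `ℝ^d × ℝ`, as a Euclidean space; `z.fst` is `x` (or `ξ`), `z.snd` is `t` (or `τ`). -/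
abbrev SpaceTime (d : ℕ) : Type := WithLp 2 (Space d × ℝ)

/-- The induced Lebesgue (surface) measure on the unit sphere. -/
def sphereMeasure (d : ℕ) : Measure (Velocity d) := (volume : Measure (Space d)).toSphere

/-- The measure `dx dσ(v)` on `ℝ^d × 𝕊^{d-1}`. -/
def phaseMeasure (d : ℕ) : Measure (Space d × Velocity d) := volume.prod (sphereMeasure d)

/-- The velocity average `ρ f(x,t) = ∫ f(x - t v, v) dσ(v)`. -/
def velocityAverage {d : ℕ} (f : Space d × Velocity d → ℂ) (z : SpaceTime d) : ℂ :=
  ∫ v : Velocity d, f (z.fst - z.snd • (v : Space d), v) ∂(sphereMeasure d)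

/-- The mixed norm `L^q_t L^r_x`, namely `(∫ (∫ |G(x,t)|^r dx)^{q/r} dt)^{1/q}`, in `[0,∞]`. -/
def mixedNorm {d : ℕ} (q r : ℝ) (G : SpaceTime d → ℂ) : ℝ≥0∞ :=
  (∫⁻ t : ℝ, (∫⁻ x : Space d, ‖G (WithLp.toLp 2 (x, t))‖ₑ ^ r) ^ (q / r)) ^ (1 / q)

/-- The Fourier transform `∫ ψ(z) e^{-i z·ζ} dz` of an integrable function on space-time. -/
def fourierInt {d : ℕ} (ψ : SpaceTime d → ℂ) (ζ : SpaceTime d) : ℂ :=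
  ∫ z, Complex.exp (-Complex.I * (inner ℝ z ζ : ℝ)) * ψ z

/-- A function which is integrable against every Schwartz function; such a function defines a
tempered distribution. -/
def IsTempered {d : ℕ} (u : SpaceTime d → ℂ) : Prop :=
  ∀ ψ : 𝓢(SpaceTime d, ℂ), Integrable (fun z => u z * ψ z)

/-- `U` is a function representing the Fourier transform, in the sense of tempered
distributions, of the function `u`. -/
def HasFourier {d : ℕ} (u U : SpaceTime d → ℂ) : Prop :=
  IsTempered u ∧ IsTempered U ∧
    ∀ ψ : 𝓢(SpaceTime d, ℂ), ∫ ζ, U ζ * ψ ζ = ∫ z, u z * fourierInt ψ z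

/-- `G` is the image of `u` under the Fourier multiplier operator with multiplier `m`: the Fourier
transform of `u` is a function `U`, the product `m U` is a tempered function, and its inverse
Fourier transform is `G`. This determines `G` up to a null set. -/
def IsMultiplierImage {d : ℕ} (m : SpaceTime d → ℂ) (u G : SpaceTime d → ℂ) : Prop :=
  ∃ U : SpaceTime d → ℂ, HasFourier u U ∧ HasFourier G (fun ζ => m ζ * U ζ)

/-- The multiplier `(|ξ| + |τ|)^{β₊} ||ξ| - |τ||^{β₋}` of `D₊^{β₊} D₋^{β₋}`. -/
def hyperbolicMultiplier {d : ℕ} (βp βm : ℝ) (ζ : SpaceTime d) : ℂ :=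
  (((‖ζ.fst‖ + abs ζ.snd) ^ βp * (abs (‖ζ.fst‖ - abs ζ.snd)) ^ βm : ℝ) : ℂ)

/-- The multiplier `(1 - τ²/|ξ|²)₊^α φ(|ξ|)` of the cone multiplier operator of order `α`;
it vanishes off the open cone `|τ| < |ξ|`, also when `α = 0`. -/
def coneMultiplier {d : ℕ} (φ : ℝ → ℂ) (α : ℝ) (ζ : SpaceTime d) : ℂ :=
  if abs ζ.snd < ‖ζ.fst‖ then
    (((1 - ζ.snd ^ 2 / ‖ζ.fst‖ ^ 2) ^ α : ℝ) : ℂ) * φ ‖ζ.fst‖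
  else 0

/-- The smoothing estimate `‖D₊^{β₊} D₋^{β₋} ρ f‖_{L^q_t L^r_x} ≤ C ‖f‖_{L²_{x,v}}` for all
`f ∈ L²(ℝ^d × 𝕊^{d-1})`, with a constant `C` independent of `f`. -/
def SmoothingEstimate (d : ℕ) (q r βp βm : ℝ) : Prop :=
  ∃ C : ℝ≥0, ∀ f : Space d × Velocity d → ℂ, MemLp f 2 (phaseMeasure d) →
    ∃ G : SpaceTime d → ℂ,
      IsMultiplierImage (hyperbolicMultiplier βp βm) (velocityAverage f) G ∧
        mixedNorm q r G ≤ C * eLpNorm f 2 (phaseMeasure d)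

/-- The cone multiplier operator of order `α`, with cutoff `φ`, is bounded from `L²_{t,x}` to
`L^q_t L^r_x`. -/
def ConeMultiplierBounded (d : ℕ) (q r : ℝ) (φ : ℝ → ℂ) (α : ℝ) : Prop :=
  ∃ C : ℝ≥0, ∀ g : SpaceTime d → ℂ, MemLp g 2 volume →
    ∃ G : SpaceTime d → ℂ,
      IsMultiplierImage (coneMultiplier φ α) g G ∧ mixedNorm q r G ≤ C * eLpNorm g 2 volume

end VelocityAverage

end

/-! Everything is moved to the frequency side. Pairing `velocityAverage f` with the Fourier
transform of a Schwartz function ψ gives, after integration along the lines t ↦ x + tv, a pairing of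
f with the spatial transform of the restriction of ψ to the hyperplane τ = -v·ξ. By Plancherel in x,
for each v, the L² norm of this transpose is a constant times the L² norm of ψ for the image of dξ
dσ(v) under (ξ, v) ↦ (ξ, -v·ξ). Slicing the sphere by hyperplanes orthogonal to ξ shows that this
image has a density κ, equal to a constant times |ξ|⁻¹ (1 - τ²/|ξ|²)^((d-3)/2) on |τ| < |ξ| and zero
elsewhere (`lintegral_sliceMap`).

Transposing this scaled isometry (`exists_transpose`), the transforms of velocity averages are
exactly the functions κ g with g in L²(κ dζ), and the norms of f and g can be taken comparable in
both directions. Writing H = √κ g, the smoothing estimate becomes boundedness from L² to the mixed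
norm space of the multiplier D₊, D₋ symbol times √κ (`smoothingEstimate_iff`). On the frequency side
only the size of a multiplier matters (`FourierBounded.mono`), and on the cone this one is
comparable to |ξ|^γ (1 - τ²/|ξ|²)^α with α = β₋ + (d-3)/4 and γ = β₊ + β₋ - 1/2. The factors 1 +
|τ|/|ξ| are harmless, lying between 1 and 2.

It remains to compare this homogeneous multiplier with its localisation by φ(|ξ|). Localising is a
pointwise domination, since |ξ|^γ is bounded above and below on the support of φ. Conversely, φ is
bounded away from zero on some shell a ≤ |ξ| < b, so the homogeneous multiplier is bounded on that
shell. The condition on β₊ + β₋ makes γ the scale invariant degree, so the same constant serves on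
every dilated shell. The shells are summed by the inequality ‖∑ hᵢ‖² ≤ K ∑ ‖hᵢ‖² for pieces with |ξ|
in successive annuli; this needs q, r ≥ 2. A limiting argument then removes the truncation to
finitely many shells (`FourierBounded.of_shell`).

The summation inequality is proved from scratch (`exists_eLpNorm_sum_sq_le`). Adding a piece h to
the lower frequency sum F changes ‖F‖_r^r by a linear term, the integral of the duality map of F
against h, and a quadratic remainder. Since h is reproduced by a kernel of mean zero, a translation
difference can be placed on F; F varies slowly at the scale of h, so the linear term gains a
geometric factor. The resulting recursion closes in ℓ² (`sq_le_of_rpow_recursion`). -/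

noncomputable section

namespace VelocityAverage

open scoped FourierTransform

/-! ### The Fourier transform with phase e^{-i z·ζ} on a Euclidean space -/

section ExpFourier

variable {V : Type*} [NormedAddCommGroup V] [InnerProductSpace ℝ V]

/-- Dilation by a nonzero scalar on Schwartz functions. -/
def schwartzDilate (c : ℝ) (hc : c ≠ 0) : 𝓢(V, ℂ) →L[ℂ] 𝓢(V, ℂ) :=
  SchwartzMap.compCLMOfContinuousLinearEquiv ℂ
    (ContinuousLinearEquiv.smulLeft (Units.mk0 c hc) : V ≃L[ℝ] V)

theorem schwartzDilate_apply (c : ℝ) (hc : c ≠ 0) (ψ : 𝓢(V, ℂ)) (x : V) :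
    schwartzDilate c hc ψ x = ψ (c • x) := rfl

variable [FiniteDimensional ℝ V] [MeasurableSpace V] [BorelSpace V]

/-- The Fourier transform with phase `e^{-i z·ζ}`. -/
def expFourier (ψ : V → ℂ) (ζ : V) : ℂ :=
  ∫ z, Complex.exp (-Complex.I * (inner ℝ z ζ : ℝ)) * ψ z

/-- The unnormalized inverse Fourier transform with phase `e^{i x·ξ}`. -/
def expFourierInv (a : V → ℂ) (x : V) : ℂ :=
  ∫ ξ, Complex.exp (Complex.I * (inner ℝ x ξ : ℝ)) * a ξ

theorem expFourier_eq (ψ : V → ℂ) (ζ : V) : expFourier ψ ζ = 𝓕 ψ ((2 * Real.pi)⁻¹ • ζ) := by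
  rw [Real.fourier_eq', expFourier]
  congr 1
  ext z
  rw [inner_smul_right, smul_eq_mul]
  congr 2
  have : Real.pi ≠ 0 := Real.pi_ne_zero
  push_cast
  have h : (Real.pi : ℂ) ≠ 0 := by exact_mod_cast this
  field_simp

theorem expFourierInv_eq (a : V → ℂ) (x : V) :
    expFourierInv a x = 𝓕⁻ a ((2 * Real.pi)⁻¹ • x) := by
  rw [Real.fourierInv_eq', expFourierInv]
  congr 1
  ext z
  rw [inner_smul_right, smul_eq_mul, real_inner_comm]
  congr 2
  have : Real.pi ≠ 0 := Real.pi_ne_zero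
  push_cast
  have h : (Real.pi : ℂ) ≠ 0 := by exact_mod_cast this
  field_simp

theorem two_pi_inv_ne_zero : (2 * Real.pi)⁻¹ ≠ 0 := by positivity

/-- `expFourier` as an operator on Schwartz functions. -/
def schwartzFourier : 𝓢(V, ℂ) →ₗ[ℂ] 𝓢(V, ℂ) where
  toFun ψ := schwartzDilate (2 * Real.pi)⁻¹ two_pi_inv_ne_zero (𝓕 ψ)
  map_add' a b := by simp
  map_smul' a b := by simp

theorem schwartzFourier_apply (ψ : 𝓢(V, ℂ)) (ζ : V) :
    schwartzFourier ψ ζ = expFourier ψ ζ := by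
  rw [expFourier_eq]; rfl

/-- Gives Schwartz functions with prescribed transform: used as test functions for uniqueness, and
to build reproducing kernels. -/
theorem schwartzFourier_surjective :
    Function.Surjective (schwartzFourier : 𝓢(V, ℂ) →ₗ[ℂ] 𝓢(V, ℂ)) := by
  intro ψ
  refine ⟨𝓕⁻ (schwartzDilate (2 * Real.pi) (by positivity) ψ), ?_⟩
  ext x
  change (𝓕 (𝓕⁻ (schwartzDilate (2 * Real.pi) (by positivity) ψ))) ((2 * Real.pi)⁻¹ • x) = _
  rw [FourierTransform.fourier_fourierInv_eq, schwartzDilate_apply, smul_inv_smul₀ (by positivity)]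

theorem lintegral_enorm_sq_eq (ψ : 𝓢(V, ℂ)) :
    ∫⁻ x, ‖ψ x‖ₑ ^ 2 = ENNReal.ofReal (∫ x, ‖ψ x‖ ^ 2) := by
  rw [ofReal_integral_eq_lintegral_ofReal]
  · congr 1; ext x
    rw [← ofReal_norm, ENNReal.ofReal_pow (norm_nonneg _)]
  · exact (ψ.memLp 2).integrable_norm_pow (by norm_num)
  · exact Filter.Eventually.of_forall fun x => by positivity

/-- Plancherel's identity for `expFourier`. -/
theorem lintegral_enorm_sq_schwartzFourier (ψ : 𝓢(V, ℂ)) :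
    ∫⁻ x, ‖schwartzFourier ψ x‖ₑ ^ 2 =
      ENNReal.ofReal ((2 * Real.pi) ^ Module.finrank ℝ V) * ∫⁻ x, ‖ψ x‖ₑ ^ 2 := by
  rw [lintegral_enorm_sq_eq, lintegral_enorm_sq_eq, ← ENNReal.ofReal_mul (by positivity)]
  congr 1
  have := Measure.integral_comp_inv_smul (volume : Measure V)
    (fun x => ‖(𝓕 ψ : 𝓢(V, ℂ)) x‖ ^ 2) (2 * Real.pi)
  rw [SchwartzMap.integral_norm_sq_fourier] at this
  rw [abs_of_pos (by positivity), smul_eq_mul] at this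
  exact this

theorem integral_fourierInv_mul_eq_flip {a b : V → ℂ} (ha : Integrable a) (hb : Integrable b) :
    ∫ x, 𝓕⁻ a x * b x = ∫ ξ, a ξ * 𝓕⁻ b ξ := by
  have := VectorFourier.integral_fourierIntegral_smul_eq_flip (μ := (volume : Measure V))
    (ν := (volume : Measure V)) (L := -innerₗ V) (f := a) (g := b) Real.continuous_fourierChar
    (by simp only [LinearMap.neg_apply, innerₗ_apply_apply]; fun_prop) ha hb
  have h2 : (-innerₗ V).flip = -innerₗ V := by
    ext x y; simp [real_inner_comm]
  rw [h2] at this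
  exact this

/-- Fubini moves the inverse transform from `a` onto the transform of `ψ`, where Fourier inversion
cancels it; the power of 2π is the Jacobian between the two normalisations of the phase. -/
theorem integral_expFourierInv_mul {a : V → ℂ} (ha : Integrable a) (ψ : 𝓢(V, ℂ)) :
    ∫ x, expFourierInv a x * expFourier ψ x =
      ((2 * Real.pi) ^ Module.finrank ℝ V : ℝ) * ∫ ξ, a ξ * ψ ξ := by
  simp_rw [expFourierInv_eq, expFourier_eq]
  rw [Measure.integral_comp_inv_smul (volume : Measure V) (fun x => 𝓕⁻ a x * 𝓕 (ψ : V → ℂ) x),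
    abs_of_pos (by positivity), Complex.real_smul]
  congr 1
  rw [← SchwartzMap.fourier_coe, integral_fourierInv_mul_eq_flip ha (𝓕 ψ).integrable,
    ← SchwartzMap.fourierInv_coe, FourierTransform.fourierInv_fourier_eq]

theorem continuous_expFourierInv {a : V → ℂ} (ha : Integrable a) :
    Continuous (expFourierInv a) := by
  have h : expFourierInv a = fun x => 𝓕⁻ a ((2 * Real.pi)⁻¹ • x) := by
    ext x; exact expFourierInv_eq a x
  rw [h]
  have : Continuous (𝓕⁻ a) :=
    VectorFourier.fourierIntegral_continuous Real.continuous_fourierChar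
      (by simp only [LinearMap.neg_apply, innerₗ_apply_apply]; fun_prop) ha
  exact this.comp (continuous_const_smul _)

theorem norm_expFourierInv_le (a : V → ℂ) (x : V) : ‖expFourierInv a x‖ ≤ ∫ ξ, ‖a ξ‖ := by
  refine (norm_integral_le_integral_norm _).trans (le_of_eq ?_)
  congr 1; ext ξ
  rw [norm_mul, mul_comm Complex.I, Complex.norm_exp_ofReal_mul_I, one_mul]

theorem integrable_expFourierInv_integrand {a : V → ℂ} (ha : Integrable a) (x : V) :
    Integrable (fun ξ => Complex.exp (Complex.I * (inner ℝ x ξ : ℝ)) * a ξ) := by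
  refine ha.bdd_mul (c := 1) (by fun_prop) (Filter.Eventually.of_forall fun ξ => ?_)
  rw [mul_comm Complex.I, Complex.norm_exp_ofReal_mul_I]

end ExpFourier

/-! ### Fourier transforms of tempered functions: uniqueness, inversion and dilation -/

section HasFourier

variable {d : ℕ}

theorem fourierInt_schwartz (ψ : 𝓢(SpaceTime d, ℂ)) :
    fourierInt (ψ : SpaceTime d → ℂ) = schwartzFourier ψ := by
  ext ζ; rw [schwartzFourier_apply]; rfl

theorem finrank_spaceTime (d : ℕ) : Module.finrank ℝ (SpaceTime d) = d + 1 := by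
  rw [(WithLp.linearEquiv 2 ℝ (Space d × ℝ)).finrank_eq]
  simp

theorem IsTempered.congr {u v : SpaceTime d → ℂ} (hu : IsTempered u) (h : u =ᵐ[volume] v) :
    IsTempered v := fun ψ => (hu ψ).congr (h.mono fun x hx => by simp [hx])

theorem IsTempered.sub {u v : SpaceTime d → ℂ} (hu : IsTempered u) (hv : IsTempered v) :
    IsTempered (u - v) := fun ψ => by
  simp only [Pi.sub_apply, sub_mul]
  exact (hu ψ).sub (hv ψ)

theorem IsTempered.const_mul {u : SpaceTime d → ℂ} (hu : IsTempered u) (c : ℂ) :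
    IsTempered (fun z => c * u z) := fun ψ => by
  simpa [mul_assoc] using (hu ψ).const_mul c

/-- There is a Schwartz function equal to one on a given ball. -/
theorem exists_schwartz_eq_one_on_closedBall {V : Type*} [NormedAddCommGroup V]
    [InnerProductSpace ℝ V] [FiniteDimensional ℝ V] {R : ℝ} (hR : 0 < R) :
    ∃ ψ : 𝓢(V, ℂ), ∀ x, ‖x‖ ≤ R → ψ x = 1 := by
  let b : ContDiffBump (0 : V) := ⟨R, R + 1, hR, by linarith⟩
  have h1 : HasCompactSupport (fun x => ((b x : ℝ) : ℂ)) :=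
    b.hasCompactSupport.comp_left (g := fun r : ℝ => (r : ℂ)) (by simp)
  refine ⟨h1.toSchwartzMap (Complex.ofRealCLM.contDiff.comp b.contDiff), fun x hx => ?_⟩
  change ((b x : ℝ) : ℂ) = 1
  rw [b.one_of_mem_closedBall (by simpa using hx)]; simp

/-- Testing against a Schwartz function that equals one on a ball containing the compact set
recovers `u` itself there. Measurability of `u` comes out of this as well. -/
theorem IsTempered.locallyIntegrable {u : SpaceTime d → ℂ} (hu : IsTempered u) :
    LocallyIntegrable u := by
  rw [locallyIntegrable_iff]
  intro K hK
  obtain ⟨R, hR⟩ := hK.isBounded.exists_norm_le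
  obtain ⟨ψ, hψ⟩ := exists_schwartz_eq_one_on_closedBall (V := SpaceTime d)
    (show (0 : ℝ) < max R 1 by positivity)
  refine ((hu ψ).integrableOn (s := K)).congr_fun_ae ?_
  filter_upwards [ae_restrict_mem hK.measurableSet] with x hx
  rw [hψ x ((hR x hx).trans (le_max_left _ _)), mul_one]

theorem IsTempered.aestronglyMeasurable {u : SpaceTime d → ℂ} (hu : IsTempered u) :
    AEStronglyMeasurable u :=
  hu.locallyIntegrable.aestronglyMeasurable

theorem ae_eq_of_forall_schwartz {u v : SpaceTime d → ℂ} (hu : IsTempered u) (hv : IsTempered v)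
    (h : ∀ ψ : 𝓢(SpaceTime d, ℂ), ∫ z, u z * ψ z = ∫ z, v z * ψ z) : u =ᵐ[volume] v := by
  refine ae_eq_of_integral_contDiff_smul_eq hu.locallyIntegrable hv.locallyIntegrable ?_
  intro g hg hgc
  have h1 : HasCompactSupport (fun x => ((g x : ℝ) : ℂ)) :=
    hgc.comp_left (g := fun r : ℝ => (r : ℂ)) (by simp)
  have := h (h1.toSchwartzMap (Complex.ofRealCLM.contDiff.comp hg))
  have e : ∀ w : SpaceTime d → ℂ, ∫ x, g x • w x =
      ∫ z, w z * (h1.toSchwartzMap (Complex.ofRealCLM.contDiff.comp hg)) z := by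
    intro w; congr 1; ext x; rw [Complex.real_smul, mul_comm]; rfl
  rw [e, e, this]

theorem HasFourier.unique_right {u U U' : SpaceTime d → ℂ} (h : HasFourier u U)
    (h' : HasFourier u U') : U =ᵐ[volume] U' :=
  ae_eq_of_forall_schwartz h.2.1 h'.2.1 fun ψ => (h.2.2 ψ).trans (h'.2.2 ψ).symm

/-- The definition tests `u` only against Fourier transforms of Schwartz functions; by surjectivity
these are all Schwartz functions. -/
theorem HasFourier.unique_left {u u' U : SpaceTime d → ℂ} (h : HasFourier u U)
    (h' : HasFourier u' U) : u =ᵐ[volume] u' := by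
  refine ae_eq_of_forall_schwartz h.1 h'.1 fun ψ => ?_
  obtain ⟨χ, rfl⟩ := schwartzFourier_surjective ψ
  have := (h.2.2 χ).symm.trans (h'.2.2 χ)
  rwa [fourierInt_schwartz] at this

theorem HasFourier.congr {u u' U U' : SpaceTime d → ℂ} (h : HasFourier u U)
    (hu : u =ᵐ[volume] u') (hU : U =ᵐ[volume] U') : HasFourier u' U' := by
  refine ⟨h.1.congr hu, h.2.1.congr hU, fun ψ => ?_⟩
  have e1 : ∫ z, U' z * ψ z = ∫ z, U z * ψ z :=
    integral_congr_ae (hU.mono fun x hx => by simp [hx])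
  have e2 : ∫ z, u' z * fourierInt ψ z = ∫ z, u z * fourierInt ψ z :=
    integral_congr_ae (hu.mono fun x hx => by simp [hx])
  rw [e1, e2, h.2.2 ψ]

theorem HasFourier.const_mul {u U : SpaceTime d → ℂ} (h : HasFourier u U) (c : ℂ) :
    HasFourier (fun z => c * u z) (fun z => c * U z) := by
  refine ⟨h.1.const_mul c, h.2.1.const_mul c, fun ψ => ?_⟩
  simp_rw [mul_assoc]
  rw [integral_const_mul, integral_const_mul, h.2.2 ψ]

theorem isTempered_of_integrable {u : SpaceTime d → ℂ} (hu : Integrable u) : IsTempered u := by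
  intro ψ
  obtain ⟨C, hC⟩ := ψ.decay 0 0
  refine hu.mul_bdd (c := C) ψ.continuous.aestronglyMeasurable
    (Filter.Eventually.of_forall fun x => ?_)
  simpa using hC.2 x

theorem isTempered_of_bounded {u : SpaceTime d → ℂ} (hu : AEStronglyMeasurable u) {C : ℝ}
    (hC : ∀ z, ‖u z‖ ≤ C) : IsTempered u := fun ψ =>
  ψ.integrable.bdd_mul hu (Filter.Eventually.of_forall hC)

/-- The inverse Fourier transform of an integrable function on space-time. -/
def inverseFourier (a : SpaceTime d → ℂ) (z : SpaceTime d) : ℂ :=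
  (((2 * Real.pi) ^ (d + 1))⁻¹ : ℝ) * expFourierInv a z

theorem hasFourier_inverseFourier {a : SpaceTime d → ℂ} (ha : Integrable a) :
    HasFourier (inverseFourier a) a := by
  refine ⟨(isTempered_of_bounded (continuous_expFourierInv ha).aestronglyMeasurable
    (norm_expFourierInv_le a)).const_mul _, isTempered_of_integrable ha, fun ψ => ?_⟩
  have := integral_expFourierInv_mul ha ψ
  rw [finrank_spaceTime] at this
  simp only [inverseFourier, mul_assoc]
  rw [integral_const_mul]
  change _ = _ * ∫ z, expFourierInv a z * expFourier ψ z
  rw [this, ← mul_assoc, ← Complex.ofReal_mul, inv_mul_cancel₀ (by positivity)]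
  simp

theorem continuous_inverseFourier {a : SpaceTime d → ℂ} (ha : Integrable a) :
    Continuous (inverseFourier a) :=
  continuous_const.mul (continuous_expFourierInv ha)

theorem inverseFourier_sum {ι : Type*} (s : Finset ι) {a : ι → SpaceTime d → ℂ}
    (ha : ∀ i ∈ s, Integrable (a i)) :
    inverseFourier (fun ζ => ∑ i ∈ s, a i ζ) = fun z => ∑ i ∈ s, inverseFourier (a i) z := by
  ext z
  simp only [inverseFourier, expFourierInv, Finset.mul_sum]
  rw [integral_finsetSum _ fun i hi => integrable_expFourierInv_integrand (ha i hi) z,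
    Finset.mul_sum]

/-- Behaviour of the Fourier transform under dilations. -/
theorem HasFourier.dilate {u U : SpaceTime d → ℂ} (h : HasFourier u U) {c : ℝ} (hc : 0 < c) :
    HasFourier (fun z => u (c • z)) (fun ζ => ((c ^ (d + 1))⁻¹ : ℝ) * U (c⁻¹ • ζ)) := by
  have key : ∀ {w : SpaceTime d → ℂ} {a : ℝ} (_ : 0 < a), IsTempered w →
      IsTempered (fun z => w (a • z)) := by
    intro w a ha hw ψ
    have := (hw (schwartzDilate a⁻¹ (inv_ne_zero ha.ne') ψ)).comp_smul ha.ne'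
    simpa [schwartzDilate_apply, smul_smul, inv_mul_cancel₀ ha.ne'] using this
  refine ⟨key hc h.1, (key (inv_pos.2 hc) h.2.1).const_mul _, fun ψ => ?_⟩
  have h1 := h.2.2 (schwartzDilate c hc.ne' ψ)
  have e1 := Measure.integral_comp_smul (volume : Measure (SpaceTime d))
    (fun ζ => U (c⁻¹ • ζ) * ψ ζ) c
  have e2 := Measure.integral_comp_smul (volume : Measure (SpaceTime d))
    (fun z => u z * fourierInt ψ (c⁻¹ • z)) c
  have e3 : ∀ z, fourierInt (schwartzDilate c hc.ne' ψ) z =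
      ((c ^ (d + 1))⁻¹ : ℝ) * fourierInt ψ (c⁻¹ • z) := by
    intro z
    have := Measure.integral_comp_smul (volume : Measure (SpaceTime d))
      (fun y => Complex.exp (-Complex.I * (inner ℝ y (c⁻¹ • z) : ℝ)) * ψ y) c
    rw [finrank_spaceTime, abs_of_pos (by positivity), Complex.real_smul] at this
    rw [fourierInt, fourierInt, ← this]
    congr 1; ext y
    rw [schwartzDilate_apply, inner_smul_left, inner_smul_right]
    simp [hc.ne']
  simp only [smul_smul, inv_mul_cancel₀ hc.ne', one_smul,
    finrank_spaceTime, abs_of_pos (show 0 < (c ^ (d + 1))⁻¹ by positivity),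
    Complex.real_smul] at e1 e2
  simp only [schwartzDilate_apply] at h1
  simp_rw [mul_assoc]
  rw [integral_const_mul, ← e1, e2, h1, ← integral_const_mul]
  congr 1; ext z
  rw [e3]; ring

end HasFourier

/-! ### Transposition of L² estimates and the Fourier transform on L² -/

theorem eLpNorm_two_eq {X : Type*} [MeasurableSpace X] (μ : Measure X) (f : X → ℂ) :
    eLpNorm f 2 μ = (∫⁻ x, ‖f x‖ₑ ^ 2 ∂μ) ^ (1 / 2 : ℝ) := by
  rw [eLpNorm_eq_lintegral_rpow_enorm_toReal (by norm_num) (by norm_num)]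
  simp

theorem memLp_two_conj {X : Type*} [MeasurableSpace X] {μ : Measure X} {f : X → ℂ}
    (hf : MemLp f 2 μ) : MemLp (fun x => starRingEnd ℂ (f x)) 2 μ :=
  hf.star

theorem eLpNorm_conj {X : Type*} [MeasurableSpace X] (μ : Measure X) (f : X → ℂ) (p : ℝ≥0∞) :
    eLpNorm (fun x => starRingEnd ℂ (f x)) p μ = eLpNorm f p μ :=
  eLpNorm_congr_norm_ae (Filter.Eventually.of_forall fun x => by simp)

/-- Transposition of an `L²` estimate: if `‖B e‖₂ ≤ c ‖A e‖₂` for two linear maps `A`, `B` into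
`L²` spaces, then every functional `e ↦ ∫ f B e` with `f ∈ L²` has the form `e ↦ ∫ g A e` with
`‖g‖₂ ≤ c ‖f‖₂`. -/
theorem exists_transpose {E X Y : Type*} [AddCommGroup E] [Module ℂ E] [MeasurableSpace X]
    [MeasurableSpace Y] {μ : Measure X} {ν : Measure Y} (A : E →ₗ[ℂ] (X → ℂ))
    (B : E →ₗ[ℂ] (Y → ℂ)) (hA : ∀ e, MemLp (A e) 2 μ) (hB : ∀ e, MemLp (B e) 2 ν) (c : ℝ≥0)
    (h : ∀ e, eLpNorm (B e) 2 ν ≤ c * eLpNorm (A e) 2 μ) {f : Y → ℂ} (hf : MemLp f 2 ν) :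
    ∃ g : X → ℂ, MemLp g 2 μ ∧ eLpNorm g 2 μ ≤ c * eLpNorm f 2 ν ∧
      ∀ e, ∫ x, g x * A e x ∂μ = ∫ y, f y * B e y ∂ν := by
  let A' : E →ₗ[ℂ] Lp ℂ 2 μ :=
    { toFun := fun e => (hA e).toLp _
      map_add' := fun a b => by
        rw [← MemLp.toLp_add]; congr 1; simp
      map_smul' := fun a b => by
        rw [RingHom.id_apply, ← MemLp.toLp_const_smul]; congr 1; simp }
  let B' : E →ₗ[ℂ] Lp ℂ 2 ν :=
    { toFun := fun e => (hB e).toLp _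
      map_add' := fun a b => by
        rw [← MemLp.toLp_add]; congr 1; simp
      map_smul' := fun a b => by
        rw [RingHom.id_apply, ← MemLp.toLp_const_smul]; congr 1; simp }
  have hAB : ∀ e, ‖B' e‖ ≤ c * ‖A' e‖ := by
    intro e
    change ‖(hB e).toLp _‖ ≤ c * ‖(hA e).toLp _‖
    rw [Lp.norm_toLp, Lp.norm_toLp]
    have := ENNReal.toReal_mono (ENNReal.mul_ne_top ENNReal.coe_ne_top (hA e).2.ne) (h e)
    simpa using this
  -- The conjugate turns the bilinear pairing with `f` into an inner product, antilinear in its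
  -- first slot; the conjugate is undone on the representing vector `g0` at the end.
  let f' : Lp ℂ 2 ν := (memLp_two_conj hf).toLp _
  let φ : E →ₗ[ℂ] ℂ := (innerSL ℂ f' : Lp ℂ 2 ν →L[ℂ] ℂ).toLinearMap ∘ₗ B'
  have hφ : ∀ e, ‖φ e‖ ≤ (‖f'‖ * c) * ‖A' e‖ := by
    intro e
    calc ‖φ e‖ ≤ ‖f'‖ * ‖B' e‖ := norm_inner_le_norm f' (B' e)
      _ ≤ ‖f'‖ * (c * ‖A' e‖) := by gcongr; exact hAB e
      _ = _ := by ring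
  -- The functional should descend to the range of `A'`. A linear section `s` defines it there; `hφ`
  -- bounds it, and also shows that it does not depend on the choice of preimage, since φ vanishes
  -- on the kernel of `A'`. Hahn–Banach and Riesz then represent it by a vector.
  obtain ⟨s, hs⟩ := A'.rangeRestrict.exists_rightInverse_of_surjective A'.range_rangeRestrict
  have hs' : ∀ x : LinearMap.range A', A' (s x) = x := fun x =>
    congrArg Subtype.val (LinearMap.congr_fun hs x)
  let ℓ : StrongDual ℂ (LinearMap.range A') := (φ ∘ₗ s).mkContinuous (‖f'‖ * c) fun x => by
    have := hφ (s x)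
    rw [hs'] at this
    exact this
  obtain ⟨L, hL, hLn⟩ := exists_extension_norm_eq (LinearMap.range A') ℓ
  let g0 : Lp ℂ 2 μ := (InnerProductSpace.toDual ℂ (Lp ℂ 2 μ)).symm L
  have hg0 : ‖g0‖ ≤ ‖f'‖ * c := by
    rw [LinearIsometryEquiv.norm_map, hLn]
    exact LinearMap.mkContinuous_norm_le _ (by positivity) _
  have hkey : ∀ e, inner ℂ g0 (A' e) = φ e := by
    intro e
    rw [InnerProductSpace.toDual_symm_apply]
    have h1 : L (A' e) = φ (s ⟨A' e, e, rfl⟩) := hL ⟨A' e, e, rfl⟩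
    rw [h1]
    have h2 := hφ (s ⟨A' e, e, rfl⟩ - e)
    rw [map_sub, map_sub, hs', sub_self, norm_zero, mul_zero] at h2
    exact sub_eq_zero.1 (norm_le_zero_iff.1 h2)
  refine ⟨fun x => starRingEnd ℂ (g0 x), memLp_two_conj (Lp.memLp g0), ?_, fun e => ?_⟩
  · rw [eLpNorm_conj, ← eLpNorm_conj ν f]
    have e1 : eLpNorm g0 2 μ = ENNReal.ofReal ‖g0‖ := by
      rw [Lp.norm_def, ENNReal.ofReal_toReal (Lp.memLp g0).2.ne]
    have e2 : eLpNorm (fun x => starRingEnd ℂ (f x)) 2 ν = ENNReal.ofReal ‖f'‖ := by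
      rw [Lp.norm_toLp, ENNReal.ofReal_toReal (memLp_two_conj hf).2.ne]
    rw [e1, e2, mul_comm, ← ENNReal.ofReal_coe_nnreal, ← ENNReal.ofReal_mul (norm_nonneg _)]
    exact ENNReal.ofReal_le_ofReal hg0
  · have h1 : inner ℂ g0 (A' e) = ∫ x, starRingEnd ℂ (g0 x) * A e x ∂μ := by
      rw [L2.inner_def]
      refine integral_congr_ae ?_
      filter_upwards [(hA e).coeFn_toLp] with x hx
      change inner ℂ (g0 x) (((hA e).toLp _ : Lp ℂ 2 μ) x) = _
      rw [hx, RCLike.inner_apply, mul_comm]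
    have h2 : φ e = ∫ y, f y * B e y ∂ν := by
      change inner ℂ f' (B' e) = _
      rw [L2.inner_def]
      refine integral_congr_ae ?_
      filter_upwards [(hB e).coeFn_toLp, (memLp_two_conj hf).coeFn_toLp] with x hx hx'
      change inner ℂ (f' x) (((hB e).toLp _ : Lp ℂ 2 ν) x) = _
      rw [hx, hx', RCLike.inner_apply, mul_comm]
      simp
    rw [← h1, hkey, h2]

variable {d : ℕ}

theorem isTempered_of_memLp_two {u : SpaceTime d → ℂ} (hu : MemLp u 2 volume) : IsTempered u :=
  fun ψ => MemLp.integrable_mul (q := 2) hu (ψ.memLp 2)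

/-- The coercion of Schwartz functions to functions, as a linear map. -/
def schwartzCoe (V : Type*) [NormedAddCommGroup V] [NormedSpace ℝ V] :
    𝓢(V, ℂ) →ₗ[ℂ] (V → ℂ) where
  toFun ψ := ψ
  map_add' _ _ := rfl
  map_smul' _ _ := rfl

/-- The constant in Plancherel's identity on space-time. -/
def plancherelConst (d : ℕ) : ℝ≥0 := Real.toNNReal ((2 * Real.pi) ^ (d + 1)) ^ (1 / 2 : ℝ)

theorem plancherelConst_ne_zero (d : ℕ) : plancherelConst d ≠ 0 := by
  have : 0 < Real.toNNReal ((2 * Real.pi) ^ (d + 1)) := by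
    rw [Real.toNNReal_pos]; positivity
  exact (NNReal.rpow_pos this).ne'

theorem eLpNorm_schwartzFourier (ψ : 𝓢(SpaceTime d, ℂ)) :
    eLpNorm (schwartzFourier ψ) 2 volume = plancherelConst d * eLpNorm ψ 2 volume := by
  rw [eLpNorm_two_eq, lintegral_enorm_sq_schwartzFourier,
    ENNReal.mul_rpow_of_nonneg _ _ (by norm_num), eLpNorm_two_eq, finrank_spaceTime,
    plancherelConst, ENNReal.coe_rpow_of_nonneg _ (by norm_num)]
  rfl

/-- The transform of `g` is obtained by transposing Plancherel's identity on Schwartz functions, so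
no extension by density is needed and the pairing identity of `HasFourier` is immediate. -/
theorem exists_hasFourier_of_memLp_two {g : SpaceTime d → ℂ} (hg : MemLp g 2 volume) :
    ∃ U, MemLp U 2 volume ∧ eLpNorm U 2 volume ≤ plancherelConst d * eLpNorm g 2 volume ∧
      HasFourier g U := by
  obtain ⟨U, hU, hn, he⟩ := exists_transpose (μ := volume) (ν := volume)
    (schwartzCoe (SpaceTime d)) (schwartzCoe (SpaceTime d) ∘ₗ schwartzFourier)
    (fun ψ => ψ.memLp 2 volume) (fun ψ => (schwartzFourier ψ).memLp 2 volume) (plancherelConst d)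
    (fun ψ => (eLpNorm_schwartzFourier ψ).le) hg
  refine ⟨U, hU, hn, isTempered_of_memLp_two hg, isTempered_of_memLp_two hU, fun ψ => ?_⟩
  rw [fourierInt_schwartz]
  exact he ψ

/-- Plancherel is an equality, so the transposition also works with the two maps exchanged. -/
theorem exists_hasFourier_inverse_of_memLp_two {U : SpaceTime d → ℂ} (hU : MemLp U 2 volume) :
    ∃ g, MemLp g 2 volume ∧ eLpNorm g 2 volume ≤ ((plancherelConst d)⁻¹ : ℝ≥0) * eLpNorm U 2 volume ∧
      HasFourier g U := by
  obtain ⟨g, hg, hn, he⟩ := exists_transpose (μ := volume) (ν := volume)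
    (schwartzCoe (SpaceTime d) ∘ₗ schwartzFourier) (schwartzCoe (SpaceTime d))
    (fun ψ => (schwartzFourier ψ).memLp 2 volume) (fun ψ => ψ.memLp 2 volume) (plancherelConst d)⁻¹
    (fun ψ => by
      change eLpNorm ψ 2 volume ≤ _ * eLpNorm (schwartzFourier ψ) 2 volume
      rw [eLpNorm_schwartzFourier, ← mul_assoc, ← ENNReal.coe_mul,
        inv_mul_cancel₀ (plancherelConst_ne_zero d)]
      simp) hU
  refine ⟨g, hg, hn, isTempered_of_memLp_two hg, isTempered_of_memLp_two hU, fun ψ => ?_⟩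
  rw [fourierInt_schwartz]
  exact (he ψ).symm

/-! ### Multiplier bounds stated on the Fourier side -/

/-- The multiplier `m`, acting on Fourier transforms in `L²`, maps into `L^q_t L^r_x` with norm at
most `C`. -/
def FourierBoundedWith (d : ℕ) (q r : ℝ) (C : ℝ≥0) (m : SpaceTime d → ℂ) : Prop :=
  ∀ H : SpaceTime d → ℂ, MemLp H 2 volume →
    ∃ G : SpaceTime d → ℂ,
      HasFourier G (fun ζ => m ζ * H ζ) ∧ mixedNorm q r G ≤ C * eLpNorm H 2 volume

/-- The multiplier `m`, acting on Fourier transforms in `L²`, maps into `L^q_t L^r_x`. -/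
def FourierBounded (d : ℕ) (q r : ℝ) (m : SpaceTime d → ℂ) : Prop :=
  ∃ C : ℝ≥0, FourierBoundedWith d q r C m

/-- By Plancherel, g and its transform range over the same L² space with proportional norms;
uniqueness of the transform identifies the function hidden in `IsMultiplierImage` with the
constructed one. -/
theorem coneMultiplierBounded_iff {q r : ℝ} {φ : ℝ → ℂ} {α : ℝ} :
    ConeMultiplierBounded d q r φ α ↔ FourierBounded d q r (coneMultiplier φ α) := by
  constructor
  · rintro ⟨C, hC⟩
    refine ⟨C * (plancherelConst d)⁻¹, fun H hH => ?_⟩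
    obtain ⟨g, hg, hn, hF⟩ := exists_hasFourier_inverse_of_memLp_two hH
    obtain ⟨G, ⟨U, hU, hG⟩, hb⟩ := hC g hg
    refine ⟨G, hG.congr (Filter.EventuallyEq.refl _ _) ?_, hb.trans ?_⟩
    · filter_upwards [hU.unique_right hF] with ζ hζ
      rw [hζ]
    · rw [ENNReal.coe_mul, mul_assoc]
      gcongr
  · rintro ⟨C, hC⟩
    refine ⟨C * plancherelConst d, fun g hg => ?_⟩
    obtain ⟨U, hU, hn, hF⟩ := exists_hasFourier_of_memLp_two hg
    obtain ⟨G, hG, hb⟩ := hC U hU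
    refine ⟨G, ⟨U, hF, hG⟩, hb.trans ?_⟩
    rw [ENNReal.coe_mul, mul_assoc]
    gcongr

/-- The bounded quotient m'/m is absorbed into the L² input, so no smoothness of the quotient is
required. Where `m` vanishes the domination forces `m'` to vanish too, so division by zero does no
harm. -/
theorem FourierBounded.mono {q r : ℝ} {m m' : SpaceTime d → ℂ} (h : FourierBounded d q r m)
    (hm : Measurable m) (hm' : Measurable m') {K : ℝ≥0}
    (hK : ∀ᵐ ζ, ‖m' ζ‖ ≤ K * ‖m ζ‖) : FourierBounded d q r m' := by
  obtain ⟨C, hC⟩ := h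
  refine ⟨C * K, fun H hH => ?_⟩
  have hb : ∀ᵐ ζ, ‖m' ζ / m ζ * H ζ‖ ≤ K * ‖H ζ‖ := by
    filter_upwards [hK] with ζ h
    rw [norm_mul, norm_div]
    gcongr
    exact div_le_of_le_mul₀ (norm_nonneg _) K.2 h
  have hH' : MemLp (fun ζ => m' ζ / m ζ * H ζ) 2 volume :=
    hH.of_le_mul ((hm'.div hm).aestronglyMeasurable.mul hH.1) hb
  obtain ⟨G, hG, hn⟩ := hC _ hH'
  refine ⟨G, hG.congr (Filter.EventuallyEq.refl _ _) ?_, hn.trans ?_⟩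
  · filter_upwards [hK] with ζ h
    by_cases h0 : m ζ = 0
    · rw [h0, norm_zero, mul_zero] at h
      rw [h0, norm_le_zero_iff.1 h]; simp
    · rw [← mul_assoc, mul_div_cancel₀ _ h0]
  · rw [ENNReal.coe_mul, mul_assoc]
    gcongr
    have := eLpNorm_le_nnreal_smul_eLpNorm_of_ae_le_mul (c := K) (f := fun ζ => m' ζ / m ζ * H ζ)
      (g := H) (μ := volume) (hb.mono fun ζ h => by exact_mod_cast h) 2
    rwa [ENNReal.smul_def, smul_eq_mul] at this

/-! ### The mixed norm: scaling, duality with Schwartz functions, Fatou -/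

section MixedNorm

variable {d : ℕ}

theorem measurePreserving_toLp_swap (d : ℕ) :
    MeasurePreserving (fun p : ℝ × Space d => (WithLp.toLp 2 (p.2, p.1) : SpaceTime d)) :=
  (WithLp.volume_preserving_toLp (Space d) ℝ).comp Measure.measurePreserving_swap

theorem lintegral_spaceTime {f : SpaceTime d → ℝ≥0∞} (hf : AEMeasurable f) :
    ∫⁻ z, f z = ∫⁻ t : ℝ, ∫⁻ x : Space d, f (WithLp.toLp 2 (x, t)) := by
  have h := measurePreserving_toLp_swap d
  rw [← h.map_eq, lintegral_map' (by rwa [h.map_eq]) h.measurable.aemeasurable]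
  exact lintegral_prod _ (hf.comp_quasiMeasurePreserving h.quasiMeasurePreserving)

theorem ae_ae_of_ae_spaceTime {p : SpaceTime d → Prop} (h : ∀ᵐ z, p z) :
    ∀ᵐ t : ℝ, ∀ᵐ x : Space d, p (WithLp.toLp 2 (x, t)) :=
  Measure.ae_ae_of_ae_prod
    ((measurePreserving_toLp_swap d).quasiMeasurePreserving.ae h)

theorem mixedNorm_congr {q r : ℝ} {G G' : SpaceTime d → ℂ} (h : G =ᵐ[volume] G') :
    mixedNorm q r G = mixedNorm q r G' := by
  unfold mixedNorm
  congr 1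
  refine lintegral_congr_ae ?_
  filter_upwards [ae_ae_of_ae_spaceTime h] with t ht
  congr 1
  refine lintegral_congr_ae ?_
  filter_upwards [ht] with x hx
  rw [hx]

theorem mixedNorm_mono {q r : ℝ} (hq : 0 < q) (hr : 0 < r) {G G' : SpaceTime d → ℂ}
    (h : ∀ z, ‖G z‖ₑ ≤ ‖G' z‖ₑ) : mixedNorm q r G ≤ mixedNorm q r G' := by
  unfold mixedNorm
  gcongr with t x
  exact h _

theorem mixedNorm_const_mul {q r : ℝ} (hq : 0 < q) (hr : 0 < r) (c : ℂ) (G : SpaceTime d → ℂ) :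
    mixedNorm q r (fun z => c * G z) = ‖c‖ₑ * mixedNorm q r G := by
  unfold mixedNorm
  have h1 : ∀ t : ℝ, (∫⁻ x : Space d, ‖c * G (WithLp.toLp 2 (x, t))‖ₑ ^ r) ^ (q / r) =
      ‖c‖ₑ ^ q * (∫⁻ x : Space d, ‖G (WithLp.toLp 2 (x, t))‖ₑ ^ r) ^ (q / r) := by
    intro t
    simp_rw [enorm_mul, ENNReal.mul_rpow_of_nonneg _ _ hr.le]
    rw [lintegral_const_mul' _ _ (ENNReal.rpow_ne_top_of_nonneg hr.le enorm_ne_top),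
      ENNReal.mul_rpow_of_nonneg _ _ (by positivity), ← ENNReal.rpow_mul,
      mul_div_cancel₀ _ hr.ne']
  simp_rw [h1]
  rw [lintegral_const_mul' _ _ (ENNReal.rpow_ne_top_of_nonneg hq.le enorm_ne_top),
    ENNReal.mul_rpow_of_nonneg _ _ (by positivity), ← ENNReal.rpow_mul,
    mul_one_div_cancel hq.ne', ENNReal.rpow_one]

theorem lintegral_comp_smul {V : Type*} [NormedAddCommGroup V] [NormedSpace ℝ V]
    [FiniteDimensional ℝ V] [MeasurableSpace V] [BorelSpace V] (μ : Measure V)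
    [μ.IsAddHaarMeasure] (f : V → ℝ≥0∞) {c : ℝ} (hc : 0 < c) :
    ∫⁻ x, f (c • x) ∂μ = ENNReal.ofReal ((c ^ Module.finrank ℝ V)⁻¹) * ∫⁻ x, f x ∂μ := by
  have h := Measure.map_addHaar_smul μ hc.ne'
  have e : MeasurableEmbedding (fun x : V => c • x) :=
    (Homeomorph.smulOfNeZero c hc.ne').measurableEmbedding
  rw [← e.lintegral_map, h, lintegral_smul_measure, abs_of_pos (by positivity), smul_eq_mul]

theorem mixedNorm_dilate {q r : ℝ} (hq : 0 < q) (hr : 0 < r) (G : SpaceTime d → ℂ) {c : ℝ}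
    (hc : 0 < c) : mixedNorm q r (fun z => G (c • z)) =
      ENNReal.ofReal (c ^ (-((d : ℝ) / r + 1 / q))) * mixedNorm q r G := by
  unfold mixedNorm
  have h1 : ∀ t : ℝ, (∫⁻ x : Space d, ‖G (c • WithLp.toLp 2 (x, t))‖ₑ ^ r) ^ (q / r) =
      ENNReal.ofReal (c ^ (-(d * (q / r)))) *
        (∫⁻ x : Space d, ‖G (WithLp.toLp 2 (x, c • t))‖ₑ ^ r) ^ (q / r) := by
    intro t
    have := lintegral_comp_smul (volume : Measure (Space d))
      (fun x => ‖G (WithLp.toLp 2 (x, c • t))‖ₑ ^ r) hc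
    change (∫⁻ x : Space d, ‖G (WithLp.toLp 2 (c • x, c • t))‖ₑ ^ r) ^ (q / r) = _
    rw [this, ENNReal.mul_rpow_of_nonneg _ _ (by positivity)]
    congr 1
    rw [ENNReal.ofReal_rpow_of_pos (by positivity), finrank_euclideanSpace_fin,
      ← Real.rpow_natCast, ← Real.rpow_neg hc.le, ← Real.rpow_mul hc.le]
    congr 2; ring
  simp_rw [h1]
  rw [lintegral_const_mul' _ _ ENNReal.ofReal_ne_top]
  have := lintegral_comp_smul (volume : Measure ℝ)
      (fun t => (∫⁻ x : Space d, ‖G (WithLp.toLp 2 (x, t))‖ₑ ^ r) ^ (q / r)) hc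
  rw [this, ENNReal.mul_rpow_of_nonneg _ _ (by positivity),
    ENNReal.mul_rpow_of_nonneg _ _ (by positivity), ← mul_assoc]
  congr 1
  rw [ENNReal.ofReal_rpow_of_pos (by positivity), ENNReal.ofReal_rpow_of_pos (by positivity),
    ← ENNReal.ofReal_mul (by positivity), Module.finrank_self, pow_one,
    ← Real.rpow_neg_one, ← Real.rpow_mul hc.le, ← Real.rpow_mul hc.le, ← Real.rpow_add hc]
  congr 2
  field_simp
  ring

/-- Hölder's inequality: a weight that is at most one and integrable lies in every L^p' with p' ≥ 1,
because then w^p' ≤ w. -/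
theorem lintegral_mul_le_of_weight {X : Type*} [MeasurableSpace X] {μ : Measure X} {p : ℝ}
    (hp : 1 < p) {w : X → ℝ≥0∞} (hw : AEMeasurable w μ) (hw1 : ∀ x, w x ≤ 1)
    (hwi : ∫⁻ x, w x ∂μ ≠ ⊤) : ∃ K : ℝ≥0, ∀ g : X → ℝ≥0∞, AEMeasurable g μ →
      ∫⁻ x, g x * w x ∂μ ≤ K * (∫⁻ x, g x ^ p ∂μ) ^ (1 / p) := by
  have hc := Real.HolderConjugate.conjExponent hp
  have hfin : (∫⁻ x, w x ^ p.conjExponent ∂μ) ^ (1 / p.conjExponent) ≠ ⊤ := by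
    refine ENNReal.rpow_ne_top_of_nonneg (by have := hc.symm.pos; positivity) ?_
    refine ne_top_of_le_ne_top hwi (lintegral_mono fun x => ?_)
    exact ENNReal.rpow_le_self_of_le_one (hw1 x) hc.symm.lt.le
  refine ⟨((∫⁻ x, w x ^ p.conjExponent ∂μ) ^ (1 / p.conjExponent)).toNNReal, fun g hg => ?_⟩
  rw [ENNReal.coe_toNNReal hfin, mul_comm]
  exact ENNReal.lintegral_mul_le_Lp_mul_Lq μ hc hg hw

/-- A polynomially decaying weight, integrable on space-time. -/
def decayWeight (z : SpaceTime d) : ℝ := (1 + ‖z.fst‖) ^ (-(d + 1 : ℝ)) * (1 + ‖z.snd‖) ^ (-(2 : ℝ))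

theorem measurable_fst_spaceTime : Measurable (fun z : SpaceTime d => z.fst) :=
  measurable_fst.comp (WithLp.measurable_ofLp 2 (Space d × ℝ))

theorem measurable_snd_spaceTime : Measurable (fun z : SpaceTime d => z.snd) :=
  measurable_snd.comp (WithLp.measurable_ofLp 2 (Space d × ℝ))

theorem decayWeight_pos (z : SpaceTime d) : 0 < decayWeight z := by
  unfold decayWeight; positivity

theorem measurable_decayWeight : Measurable (decayWeight (d := d)) := by
  unfold decayWeight
  have := measurable_fst_spaceTime (d := d)
  have := measurable_snd_spaceTime (d := d)
  fun_prop

theorem aemeasurable_section {G : SpaceTime d → ℂ} (hG : AEStronglyMeasurable G) :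
    ∀ᵐ t : ℝ, AEStronglyMeasurable (fun x : Space d => G (WithLp.toLp 2 (x, t))) :=
  (hG.comp_measurePreserving (measurePreserving_toLp_swap d)).prodMk_left

theorem aemeasurable_lintegral_section {G : SpaceTime d → ℂ} (hG : AEStronglyMeasurable G)
    (r : ℝ) : AEMeasurable (fun t : ℝ => ∫⁻ x : Space d, ‖G (WithLp.toLp 2 (x, t))‖ₑ ^ r) :=
  ((hG.comp_measurePreserving (measurePreserving_toLp_swap d)).enorm.pow_const
    r).lintegral_prod_right'

/-- The weight is a product of a function of x and one of t, so Hölder applies first in x and then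
in t. This embeds the mixed norm space into a weighted L¹ space, which supplies both temperedness
and almost everywhere convergence of subsequences. -/
theorem exists_lintegral_decayWeight_le {q r : ℝ} (hq : 1 < q) (hr : 1 < r) :
    ∃ K : ℝ≥0, ∀ G : SpaceTime d → ℂ, AEStronglyMeasurable G →
      ∫⁻ z, ‖G z‖ₑ * ENNReal.ofReal (decayWeight z) ≤ K * mixedNorm q r G := by
  have hle : ∀ {a b : ℝ}, 0 ≤ a → 0 ≤ b → ENNReal.ofReal ((1 + a) ^ (-b)) ≤ 1 := by
    intro a b ha hb
    rw [ENNReal.ofReal_le_one]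
    exact Real.rpow_le_one_of_one_le_of_nonpos (by linarith) (by linarith)
  obtain ⟨K₁, hK₁⟩ := lintegral_mul_le_of_weight (μ := (volume : Measure (Space d))) hr
    (w := fun x => ENNReal.ofReal ((1 + ‖x‖) ^ (-(d + 1 : ℝ)))) (by fun_prop)
    (fun x => hle (norm_nonneg _) (by positivity))
    ((integrable_one_add_norm (by simp)).lintegral_lt_top.ne)
  obtain ⟨K₂, hK₂⟩ := lintegral_mul_le_of_weight (μ := (volume : Measure ℝ)) hq
    (w := fun x => ENNReal.ofReal ((1 + ‖x‖) ^ (-(2 : ℝ)))) (by fun_prop)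
    (fun x => hle (norm_nonneg _) (by positivity))
    ((integrable_one_add_norm (by rw [Module.finrank_self]; norm_num)).lintegral_lt_top.ne)
  refine ⟨K₁ * K₂, fun G hG => ?_⟩
  have hm : AEMeasurable fun z => ‖G z‖ₑ * ENNReal.ofReal (decayWeight z) :=
    hG.enorm.mul measurable_decayWeight.ennreal_ofReal.aemeasurable
  rw [lintegral_spaceTime hm]
  have h1 : ∀ᵐ t : ℝ, ∫⁻ x : Space d, ‖G (WithLp.toLp 2 (x, t))‖ₑ *
      ENNReal.ofReal (decayWeight (WithLp.toLp 2 (x, t))) ≤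
      K₁ * ((∫⁻ x : Space d, ‖G (WithLp.toLp 2 (x, t))‖ₑ ^ r) ^ (1 / r) *
        ENNReal.ofReal ((1 + ‖t‖) ^ (-(2 : ℝ)))) := by
    filter_upwards [aemeasurable_section hG] with t ht
    rw [← mul_assoc]
    refine le_trans (le_of_eq ?_) (mul_le_mul_left (hK₁ _ ht.enorm) _)
    rw [← lintegral_mul_const' _ _ ENNReal.ofReal_ne_top]
    congr 1; ext x
    rw [decayWeight, ENNReal.ofReal_mul (by positivity), mul_assoc]
    rfl
  refine (lintegral_mono_ae h1).trans ?_
  rw [lintegral_const_mul' _ _ ENNReal.coe_ne_top, ENNReal.coe_mul, mul_assoc]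
  gcongr
  refine (hK₂ _ ((aemeasurable_lintegral_section hG r).pow_const _)).trans (le_of_eq ?_)
  unfold mixedNorm
  congr 3
  ext t
  rw [← ENNReal.rpow_mul]
  congr 1; ring

theorem exists_norm_schwartz_le_decayWeight (ψ : 𝓢(SpaceTime d, ℂ)) :
    ∃ C : ℝ≥0, ∀ z, ‖ψ z‖ ≤ C * decayWeight z := by
  have h := SchwartzMap.one_add_le_sup_seminorm_apply (𝕜 := ℂ) (m := (d + 3, 0)) (k := d + 3)
    (n := 0) le_rfl le_rfl ψ
  set C := 2 ^ (d + 3, 0).1 * ((Finset.Iic (d + 3, 0)).sup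
    fun m : ℕ × ℕ => SchwartzMap.seminorm ℂ m.1 m.2) ψ
  have hC : 0 ≤ C := le_trans (by positivity) (h 0)
  refine ⟨⟨C, hC⟩, fun z => ?_⟩
  have hz := h z
  rw [norm_iteratedFDeriv_zero] at hz
  have h1 : ‖z.fst‖ ≤ ‖z‖ := WithLp.norm_fst_le _ z
  have h2 : ‖z.snd‖ ≤ ‖z‖ := WithLp.norm_snd_le _ z
  have h3 : (1 + ‖z.fst‖) ^ (d + 1) * (1 + ‖z.snd‖) ^ 2 ≤ (1 + ‖z‖) ^ (d + 3) := by
    rw [pow_add (1 + ‖z‖) (d + 1) 2]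
    gcongr
  have e : decayWeight z = ((1 + ‖z.fst‖) ^ (d + 1) * (1 + ‖z.snd‖) ^ 2)⁻¹ := by
    rw [decayWeight, Real.rpow_neg (by positivity), Real.rpow_neg (by positivity), mul_inv]
    norm_cast
  rw [e]
  change _ ≤ C * _
  rw [← div_eq_mul_inv, le_div_iff₀ (by positivity), mul_comm]
  exact (mul_le_mul_of_nonneg_right h3 (norm_nonneg _)).trans hz

theorem exists_lintegral_mul_schwartz_le {q r : ℝ} (hq : 1 < q) (hr : 1 < r)
    (ψ : 𝓢(SpaceTime d, ℂ)) : ∃ K : ℝ≥0, ∀ G : SpaceTime d → ℂ, AEStronglyMeasurable G →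
      ∫⁻ z, ‖G z * ψ z‖ₑ ≤ K * mixedNorm q r G := by
  obtain ⟨K, hK⟩ := exists_lintegral_decayWeight_le (d := d) hq hr
  obtain ⟨C, hC⟩ := exists_norm_schwartz_le_decayWeight ψ
  refine ⟨C * K, fun G hG => ?_⟩
  rw [ENNReal.coe_mul, mul_assoc]
  refine le_trans ?_ (mul_le_mul_right (hK G hG) _)
  rw [← lintegral_const_mul' _ _ ENNReal.coe_ne_top]
  refine lintegral_mono fun z => ?_
  rw [enorm_mul, mul_left_comm]
  gcongr
  rw [← ENNReal.ofReal_coe_nnreal, ← ENNReal.ofReal_mul C.coe_nonneg, ← ofReal_norm]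
  exact ENNReal.ofReal_le_ofReal (hC z)

theorem isTempered_of_mixedNorm_ne_top {q r : ℝ} (hq : 1 < q) (hr : 1 < r)
    {G : SpaceTime d → ℂ} (hG : AEStronglyMeasurable G) (h : mixedNorm q r G ≠ ⊤) :
    IsTempered G := by
  intro ψ
  obtain ⟨K, hK⟩ := exists_lintegral_mul_schwartz_le hq hr ψ
  exact ⟨hG.mul ψ.continuous.aestronglyMeasurable,
    (hK G hG).trans_lt (ENNReal.mul_lt_top ENNReal.coe_lt_top h.lt_top)⟩

/-- Fatou's lemma applied in x and then in t; the powers in between are monotone and continuous and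
so commute with the lower limit. -/
theorem mixedNorm_le_of_tendsto {q r : ℝ} (hq : 0 < q) (hr : 0 < r) {G : ℕ → SpaceTime d → ℂ}
    {G' : SpaceTime d → ℂ} (hG : ∀ n, AEStronglyMeasurable (G n))
    (h : ∀ᵐ z, Filter.Tendsto (fun n => G n z) Filter.atTop (nhds (G' z))) {K : ℝ≥0∞}
    (hK : ∀ n, mixedNorm q r (G n) ≤ K) : mixedNorm q r G' ≤ K := by
  have hpow : ∀ {s : ℝ}, 0 ≤ s → ∀ u : ℕ → ℝ≥0∞,
      (Filter.liminf u Filter.atTop) ^ s = Filter.liminf (fun n => u n ^ s) Filter.atTop :=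
    fun hs u => (ENNReal.monotone_rpow_of_nonneg hs).map_liminf_of_continuousAt u
      ENNReal.continuous_rpow_const.continuousAt
  have h1 : ∀ᵐ t : ℝ, (∫⁻ x : Space d, ‖G' (WithLp.toLp 2 (x, t))‖ₑ ^ r) ^ (q / r) ≤
      Filter.liminf (fun n => (∫⁻ x : Space d, ‖G n (WithLp.toLp 2 (x, t))‖ₑ ^ r) ^ (q / r))
        Filter.atTop := by
    filter_upwards [ae_ae_of_ae_spaceTime h, ae_all_iff.2 fun n => aemeasurable_section (hG n)]
      with t ht hm
    rw [← hpow (by positivity)]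
    gcongr
    refine le_trans (lintegral_mono_ae ?_) (lintegral_liminf_le' fun n => (hm n).enorm.pow_const r)
    filter_upwards [ht] with x hx
    have := (ENNReal.continuous_rpow_const (y := r)).continuousAt.tendsto.comp
      (continuous_enorm.continuousAt.tendsto.comp hx)
    exact this.liminf_eq.ge
  unfold mixedNorm
  calc _ ≤ (Filter.liminf (fun n => ∫⁻ t : ℝ,
        (∫⁻ x : Space d, ‖G n (WithLp.toLp 2 (x, t))‖ₑ ^ r) ^ (q / r)) Filter.atTop) ^ (1 / q) := by
        gcongr
        exact (lintegral_mono_ae h1).trans (lintegral_liminf_le' fun n =>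
          (aemeasurable_lintegral_section (hG n) r).pow_const _)
    _ = Filter.liminf (fun n => mixedNorm q r (G n)) Filter.atTop := hpow (by positivity) _
    _ ≤ K := Filter.liminf_le_of_le (by isBoundedDefault) fun b hb => by
        obtain ⟨n, hn⟩ := hb.exists
        exact hn.trans (hK n)

end MixedNorm

/-! ### Local square integrability of bounded multipliers -/

/-- A multiplier bounded from `L²` to a mixed norm space is locally square integrable. -/
theorem exists_lintegral_mul_schwartz_sq_le {d : ℕ} {q r : ℝ} (hq : 1 < q) (hr : 1 < r)
    (ψ : 𝓢(SpaceTime d, ℂ)) : ∃ K : ℝ≥0, ∀ (C : ℝ≥0) (m : SpaceTime d → ℂ), Measurable m →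
      FourierBoundedWith d q r C m →
        ∫⁻ ζ, ‖m ζ * ψ ζ‖ₑ ^ 2 ≤ ((K * C : ℝ≥0) : ℝ≥0∞) ^ 2 := by
  obtain ⟨K, hK⟩ := exists_lintegral_mul_schwartz_le hq hr (schwartzFourier ψ)
  refine ⟨K, fun C m hm hC => ?_⟩
  have hmψ : Measurable (fun ζ => m ζ * ψ ζ) := hm.mul ψ.continuous.measurable
  let s : ℕ → Set (SpaceTime d) := fun N => {ζ | ‖m ζ‖ ≤ N}
  have hs : ∀ N, MeasurableSet (s N) := fun N => measurableSet_le hm.norm measurable_const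
  have key : ∀ N, ∫⁻ ζ in s N, ‖m ζ * ψ ζ‖ₑ ^ 2 ≤ ((K * C : ℝ≥0) : ℝ≥0∞) ^ 2 := by
    intro N
    -- With this input, pairing the output with the transform of ψ returns I = ∫ |H|². Boundedness
    -- of m gives I ≤ K C I^(1/2), hence I ≤ (K C)². Truncating to |m| ≤ N makes I finite, so that
    -- the division is allowed; the bound does not depend on N.
    set H : SpaceTime d → ℂ := (s N).indicator fun ζ => starRingEnd ℂ (m ζ * ψ ζ) with hH
    have hHm : MemLp H 2 volume := by
      refine (ψ.memLp 2 volume).of_le_mul (c := N)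
        ((Complex.continuous_conj.measurable.comp hmψ).indicator (hs N)).aestronglyMeasurable
        (Filter.Eventually.of_forall fun ζ => ?_)
      by_cases hζ : ζ ∈ s N
      · rw [hH, Set.indicator_of_mem hζ, RCLike.norm_conj, norm_mul]
        exact mul_le_mul_of_nonneg_right hζ (norm_nonneg _)
      · rw [hH, Set.indicator_of_notMem hζ, norm_zero]; positivity
    have hI : ∫⁻ ζ, ‖H ζ‖ₑ ^ 2 = ∫⁻ ζ in s N, ‖m ζ * ψ ζ‖ₑ ^ 2 := by
      rw [← lintegral_indicator (hs N)]
      congr 1; ext ζ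
      by_cases hζ : ζ ∈ s N
      · rw [hH, Set.indicator_of_mem hζ, Set.indicator_of_mem hζ, ← ofReal_norm,
          RCLike.norm_conj, ofReal_norm]
      · rw [hH, Set.indicator_of_notMem hζ, Set.indicator_of_notMem hζ]; simp
    have hfin : ∫⁻ ζ, ‖H ζ‖ₑ ^ 2 ≠ ⊤ := by
      intro htop
      have := hHm.2
      rw [eLpNorm_two_eq, htop] at this
      simp at this
    obtain ⟨G, hG, hb⟩ := hC H hHm
    have h1 : ∫⁻ ζ, ‖H ζ‖ₑ ^ 2 ≤ (K * C : ℝ≥0) * (∫⁻ ζ, ‖H ζ‖ₑ ^ 2) ^ (1 / 2 : ℝ) := by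
      have e1 : ∫ ζ, m ζ * H ζ * ψ ζ = ((∫ ζ, ‖H ζ‖ ^ 2 : ℝ) : ℂ) := by
        rw [← integral_complex_ofReal]
        congr 1; ext ζ
        by_cases hζ : ζ ∈ s N
        · rw [hH, Set.indicator_of_mem hζ, RCLike.norm_conj, mul_right_comm, RCLike.mul_conj]
          push_cast; rfl
        · rw [hH, Set.indicator_of_notMem hζ]; simp
      have e2 : ∫⁻ ζ, ‖H ζ‖ₑ ^ 2 = ‖∫ ζ, m ζ * H ζ * ψ ζ‖ₑ := by
        rw [e1, ← ofReal_norm, Complex.norm_real, Real.norm_of_nonneg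
          (integral_nonneg fun ζ => by positivity), ofReal_integral_eq_lintegral_ofReal
          (hHm.integrable_norm_pow (by norm_num)) (Filter.Eventually.of_forall fun x => by positivity)]
        congr 1; ext x
        rw [← ofReal_norm, ENNReal.ofReal_pow (norm_nonneg _)]
      calc ∫⁻ ζ, ‖H ζ‖ₑ ^ 2 = ‖∫ z, G z * schwartzFourier ψ z‖ₑ := by
            rw [e2, hG.2.2 ψ, fourierInt_schwartz]
        _ ≤ ∫⁻ z, ‖G z * schwartzFourier ψ z‖ₑ := enorm_integral_le_lintegral_enorm _
        _ ≤ K * mixedNorm q r G := hK G hG.1.aestronglyMeasurable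
        _ ≤ K * (C * eLpNorm H 2 volume) := by gcongr
        _ = _ := by rw [eLpNorm_two_eq, ← mul_assoc, ENNReal.coe_mul]
    rw [← hI]
    set I := ∫⁻ ζ, ‖H ζ‖ₑ ^ 2
    by_cases h0 : I = 0
    · rw [h0]; exact zero_le
    have h2 : I = I ^ (1 / 2 : ℝ) * I ^ (1 / 2 : ℝ) := by
      rw [← ENNReal.rpow_add _ _ h0 hfin]; norm_num
    have h3 : I ^ (1 / 2 : ℝ) ≤ (K * C : ℝ≥0) := by
      have hne : I ^ (1 / 2 : ℝ) ≠ 0 := by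
        simp [ENNReal.rpow_eq_zero_iff, h0]
      have hnt : I ^ (1 / 2 : ℝ) ≠ ⊤ := ENNReal.rpow_ne_top_of_nonneg (by norm_num) hfin
      rw [← ENNReal.mul_le_mul_iff_left hne hnt, ← h2]
      exact h1
    calc I = I ^ (1 / 2 : ℝ) * I ^ (1 / 2 : ℝ) := h2
      _ ≤ (K * C : ℝ≥0) * (K * C : ℝ≥0) := by gcongr
      _ = _ := by rw [sq]
  have hU : ⋃ N, s N = Set.univ := by
    ext ζ
    simp only [Set.mem_iUnion, Set.mem_univ, iff_true]
    exact exists_nat_ge ‖m ζ‖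
  have hmono : Monotone s := fun a b hab ζ (hζ : ‖m ζ‖ ≤ a) => hζ.trans (by exact_mod_cast hab)
  rw [← setLIntegral_univ, ← hU, setLIntegral_iUnion_of_directed _ hmono.directed_le]
  exact iSup_le key

theorem FourierBoundedWith.memLp_mul_schwartz {d : ℕ} {q r : ℝ} (hq : 1 < q) (hr : 1 < r) {C : ℝ≥0}
    {m : SpaceTime d → ℂ} (hm : Measurable m) (h : FourierBoundedWith d q r C m)
    (ψ : 𝓢(SpaceTime d, ℂ)) : MemLp (fun ζ => m ζ * ψ ζ) 2 volume := by
  obtain ⟨K, hK⟩ := exists_lintegral_mul_schwartz_sq_le hq hr ψ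
  refine ⟨(hm.mul ψ.continuous.measurable).aestronglyMeasurable, ?_⟩
  rw [eLpNorm_two_eq]
  exact ENNReal.rpow_lt_top_of_nonneg (by norm_num) (ne_top_of_le_ne_top
    (ENNReal.pow_ne_top ENNReal.coe_ne_top) (hK C m hm h))

/-! ### Pointwise expansion of |a + b|^r for r ≥ 2 -/

section PowerInequalities

/-- The tangent line inequality for `t ↦ t ^ p`, `p ≥ 1`. -/
theorem rpow_tangent_le {p x y : ℝ} (hp : 1 ≤ p) (hx : 0 ≤ x) (hy : 0 ≤ y) :
    p * x ^ (p - 1) * y ≤ y ^ p + (p - 1) * x ^ p := by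
  rcases hp.eq_or_lt with rfl | hp
  · simp
  have hc := Real.HolderConjugate.conjExponent hp
  have h := Real.young_inequality_of_nonneg hy (Real.rpow_nonneg hx (p - 1)) hc
  rw [← Real.rpow_mul hx] at h
  have e : (p - 1) * p.conjExponent = p := by
    rw [Real.conjExponent]; field_simp [(sub_pos.2 hp).ne']
  rw [e] at h
  have h2 : x ^ p / p.conjExponent = (p - 1) / p * x ^ p := by
    rw [Real.conjExponent]
    have : p - 1 ≠ 0 := (sub_pos.2 hp).ne'
    field_simp
  rw [h2] at h
  have hp0 : 0 < p := by linarith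
  have := mul_le_mul_of_nonneg_left h hp0.le
  field_simp at this
  linarith

/-- The derivative (up to a factor) of `|z| ^ r`: the duality map `z ↦ |z| ^ (r - 2) z̄`. -/
def dualityMap (r : ℝ) (z : ℂ) : ℂ := ((‖z‖ ^ (r - 2) : ℝ) : ℂ) * starRingEnd ℂ z

theorem norm_dualityMap (r : ℝ) (z : ℂ) : ‖dualityMap r z‖ = ‖z‖ ^ (r - 2) * ‖z‖ := by
  rw [dualityMap, norm_mul, Complex.norm_real, RCLike.norm_conj,
    Real.norm_of_nonneg (Real.rpow_nonneg (norm_nonneg _) _)]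

theorem continuous_dualityMap {r : ℝ} (hr : 2 ≤ r) : Continuous (dualityMap r) := by
  unfold dualityMap
  have : Continuous fun z : ℂ => ‖z‖ ^ (r - 2) :=
    continuous_norm.rpow_const fun _ => Or.inr (by linarith)
  fun_prop

/-- With |b| ≤ |a| and s = r - 2, the difference splits as |a|^s times the conjugate of a - b, plus
(|a|^s - |b|^s) times the conjugate of b. The tangent line inequality with exponent s + 1 bounds the
second part by s |a|^s (|a| - |b|). -/
theorem norm_dualityMap_sub_le {r : ℝ} (hr : 2 ≤ r) (a b : ℂ) :
    ‖dualityMap r a - dualityMap r b‖ ≤ (r - 1) * (‖a‖ + ‖b‖) ^ (r - 2) * ‖a - b‖ := by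
  wlog hab : ‖b‖ ≤ ‖a‖ generalizing a b
  · rw [norm_sub_rev, add_comm, norm_sub_rev a b]
    exact this b a (le_of_not_ge hab)
  set s := r - 2 with hs
  have hs0 : 0 ≤ s := by linarith
  have e : dualityMap r a - dualityMap r b =
      ((‖a‖ ^ s : ℝ) : ℂ) * starRingEnd ℂ (a - b) +
        ((‖a‖ ^ s - ‖b‖ ^ s : ℝ) : ℂ) * starRingEnd ℂ b := by
    rw [dualityMap, dualityMap]; push_cast; rw [map_sub]; ring
  have h1 : 0 ≤ ‖a‖ ^ s - ‖b‖ ^ s :=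
    sub_nonneg.2 (Real.rpow_le_rpow (norm_nonneg _) hab hs0)
  have h2 : ‖dualityMap r a - dualityMap r b‖ ≤
      ‖a‖ ^ s * ‖a - b‖ + (‖a‖ ^ s - ‖b‖ ^ s) * ‖b‖ := by
    rw [e]
    refine (norm_add_le _ _).trans (le_of_eq ?_)
    rw [norm_mul, norm_mul, RCLike.norm_conj, RCLike.norm_conj, Complex.norm_real,
      Complex.norm_real, Real.norm_of_nonneg h1, Real.norm_of_nonneg (by positivity)]
  have h3 := rpow_tangent_le (p := s + 1) (by linarith) (norm_nonneg a) (norm_nonneg b)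
  rw [add_sub_cancel_right, Real.rpow_add_one' (norm_nonneg _) (by linarith),
    Real.rpow_add_one' (norm_nonneg _) (by linarith)] at h3
  have h4 : ‖a‖ - ‖b‖ ≤ ‖a - b‖ := norm_sub_norm_le a b
  have h5 : ‖a‖ ^ s ≤ (‖a‖ + ‖b‖) ^ s :=
    Real.rpow_le_rpow (norm_nonneg _) (by linarith [norm_nonneg b]) hs0
  have h6 : 0 ≤ ‖a‖ ^ s := by positivity
  have h7 : s * ‖a‖ ^ s * (‖a‖ - ‖b‖) ≤ s * ‖a‖ ^ s * ‖a - b‖ :=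
    mul_le_mul_of_nonneg_left h4 (by positivity)
  calc _ ≤ (s + 1) * ‖a‖ ^ s * ‖a - b‖ := by nlinarith
    _ ≤ (s + 1) * (‖a‖ + ‖b‖) ^ s * ‖a - b‖ := by gcongr
    _ = _ := by rw [hs]; ring

/-- A Taylor expansion with quadratic remainder. Convexity at w = a + b gives |w|^r ≤ |a|^r plus r
times the real part of the duality map at w applied to b; replacing w by a in the duality map costs
the remainder, by `norm_dualityMap_sub_le`. -/
theorem norm_add_rpow_le {r : ℝ} (hr : 2 ≤ r) (a b : ℂ) :
    ‖a + b‖ ^ r ≤ ‖a‖ ^ r + r * (dualityMap r a * b).re +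
      r * (r - 1) * ((‖a + b‖ + ‖a‖) ^ (r - 2) * ‖b‖ * ‖b‖) := by
  set w := a + b with hw
  have h1 := rpow_tangent_le (p := r) (by linarith) (norm_nonneg w) (norm_nonneg a)
  have h2 : (dualityMap r w * a).re ≤ ‖w‖ ^ (r - 1) * ‖a‖ := by
    refine (Complex.re_le_norm _).trans (le_of_eq ?_)
    rw [norm_mul, norm_dualityMap, ← Real.rpow_add_one' (norm_nonneg _) (by linarith)]
    congr 2; ring
  have h3 : (dualityMap r w * w).re = ‖w‖ ^ r := by
    rw [dualityMap, mul_assoc, mul_comm (starRingEnd ℂ w), Complex.mul_conj,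
      Complex.normSq_eq_norm_sq, ← Complex.ofReal_mul, Complex.ofReal_re, ← Real.rpow_natCast,
      ← Real.rpow_add' (norm_nonneg _) (by push_cast; linarith)]
    congr 1; push_cast; ring
  have h4 : (dualityMap r w * b).re = (dualityMap r w * w).re - (dualityMap r w * a).re := by
    rw [← Complex.sub_re, ← mul_sub, hw, add_sub_cancel_left]
  have h5 : (dualityMap r w * b).re - (dualityMap r a * b).re ≤
      (r - 1) * ((‖w‖ + ‖a‖) ^ (r - 2) * ‖b‖ * ‖b‖) := by
    rw [← Complex.sub_re, ← sub_mul]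
    refine (Complex.re_le_norm _).trans ?_
    rw [norm_mul]
    have := norm_dualityMap_sub_le hr w a
    rw [hw, add_sub_cancel_left, ← hw] at this
    calc _ ≤ (r - 1) * (‖w‖ + ‖a‖) ^ (r - 2) * ‖b‖ * ‖b‖ := by gcongr
      _ = _ := by ring
  have h6 : r * ((dualityMap r w * b).re - (dualityMap r a * b).re) ≤
      r * ((r - 1) * ((‖w‖ + ‖a‖) ^ (r - 2) * ‖b‖ * ‖b‖)) :=
    mul_le_mul_of_nonneg_left h5 (by linarith)
  have h7 : r * (dualityMap r w * a).re ≤ r * (‖w‖ ^ (r - 1) * ‖a‖) :=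
    mul_le_mul_of_nonneg_left h2 (by linarith)
  rw [h4, h3] at h6
  nlinarith

end PowerInequalities

/-! ### Hölder's inequality with exponents r/(r-2), r, r -/

section TripleHolder

variable {X : Type*} [MeasurableSpace X] {μ : Measure X}

/-- Formulated with the weights (r-2)/r, 1/r, 1/r of total one, so that r = 2 is included, with
first weight zero. -/
theorem lintegral_rpow_mul_mul_le {r : ℝ} (hr : 2 ≤ r) {a b c : X → ℝ≥0∞} (ha : AEMeasurable a μ)
    (hb : AEMeasurable b μ) (hc : AEMeasurable c μ) :
    ∫⁻ x, a x ^ (r - 2) * b x * c x ∂μ ≤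
      ((∫⁻ x, a x ^ r ∂μ) ^ (1 / r)) ^ (r - 2) * (∫⁻ x, b x ^ r ∂μ) ^ (1 / r) *
        (∫⁻ x, c x ^ r ∂μ) ^ (1 / r) := by
  have hr0 : 0 < r := by linarith
  have h := ENNReal.lintegral_prod_norm_pow_le (μ := μ) (Finset.univ : Finset (Fin 3))
    (f := ![fun x => a x ^ r, fun x => b x ^ r, fun x => c x ^ r])
    (fun i _ => by fin_cases i <;> simp <;> fun_prop)
    (p := ![(r - 2) / r, 1 / r, 1 / r])
    (by rw [Fin.sum_univ_three]; simp; field_simp; ring)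
    (fun i _ => by
      fin_cases i
      · exact div_nonneg (by linarith) hr0.le
      · simp; positivity
      · simp; positivity)
  simp only [Fin.prod_univ_three, Matrix.cons_val_zero, Matrix.cons_val_one, Matrix.cons_val_two,
    Matrix.tail_cons, Matrix.head_cons] at h
  have e1 : ∀ t : ℝ≥0∞, (t ^ r) ^ (1 / r) = t := fun t => by
    rw [← ENNReal.rpow_mul, mul_one_div_cancel hr0.ne', ENNReal.rpow_one]
  have e2 : ∀ t : ℝ≥0∞, (t ^ r) ^ ((r - 2) / r) = t ^ (r - 2) := fun t => by
    rw [← ENNReal.rpow_mul, mul_div_cancel₀ _ hr0.ne']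
  have e3 : ∀ t : ℝ≥0∞, (t ^ (1 / r)) ^ (r - 2) = t ^ ((r - 2) / r) := fun t => by
    rw [← ENNReal.rpow_mul]; congr 1; ring
  simp_rw [e1, e2] at h
  rw [e3]
  exact h

/-- The real-valued `L^r` norm. -/
def lrNorm (r : ℝ) (μ : Measure X) (f : X → ℂ) : ℝ := (eLpNorm f (ENNReal.ofReal r) μ).toReal

theorem eLpNorm_ofReal_eq {r : ℝ} (hr : 0 < r) (f : X → ℂ) :
    eLpNorm f (ENNReal.ofReal r) μ = (∫⁻ x, ‖f x‖ₑ ^ r ∂μ) ^ (1 / r) := by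
  rw [eLpNorm_eq_lintegral_rpow_enorm_toReal (by simpa using hr) ENNReal.ofReal_ne_top,
    ENNReal.toReal_ofReal hr.le]

theorem integrable_and_integral_rpow_mul_mul_le {r : ℝ} (hr : 2 ≤ r) {f g h : X → ℂ}
    (hf : MemLp f (ENNReal.ofReal r) μ) (hg : MemLp g (ENNReal.ofReal r) μ)
    (hh : MemLp h (ENNReal.ofReal r) μ) :
    Integrable (fun x => ‖f x‖ ^ (r - 2) * ‖g x‖ * ‖h x‖) μ ∧
      ∫ x, ‖f x‖ ^ (r - 2) * ‖g x‖ * ‖h x‖ ∂μ ≤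
        lrNorm r μ f ^ (r - 2) * lrNorm r μ g * lrNorm r μ h := by
  have hr0 : 0 < r := by linarith
  have key := lintegral_rpow_mul_mul_le (μ := μ) hr hf.1.enorm hg.1.enorm hh.1.enorm
  rw [← eLpNorm_ofReal_eq hr0, ← eLpNorm_ofReal_eq hr0, ← eLpNorm_ofReal_eq hr0] at key
  have hm : AEStronglyMeasurable (fun x => ‖f x‖ ^ (r - 2) * ‖g x‖ * ‖h x‖) μ :=
    (((hf.1.norm.aemeasurable.pow_const _).mul hg.1.norm.aemeasurable).mul
      hh.1.norm.aemeasurable).aestronglyMeasurable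
  have e : ∀ x, ENNReal.ofReal (‖f x‖ ^ (r - 2) * ‖g x‖ * ‖h x‖) =
      ‖f x‖ₑ ^ (r - 2) * ‖g x‖ₑ * ‖h x‖ₑ := fun x => by
    rw [ENNReal.ofReal_mul (by positivity), ENNReal.ofReal_mul (by positivity),
      ← ENNReal.ofReal_rpow_of_nonneg (norm_nonneg _) (by linarith), ofReal_norm, ofReal_norm,
      ofReal_norm]
  have hfin : eLpNorm f (ENNReal.ofReal r) μ ^ (r - 2) * eLpNorm g (ENNReal.ofReal r) μ *
      eLpNorm h (ENNReal.ofReal r) μ ≠ ⊤ :=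
    ENNReal.mul_ne_top (ENNReal.mul_ne_top (ENNReal.rpow_ne_top_of_nonneg (by linarith) hf.2.ne)
      hg.2.ne) hh.2.ne
  have hnn : ∀ x, 0 ≤ ‖f x‖ ^ (r - 2) * ‖g x‖ * ‖h x‖ := fun x => by positivity
  refine ⟨⟨hm, ?_⟩, ?_⟩
  · rw [hasFiniteIntegral_iff_ofReal (Filter.Eventually.of_forall hnn)]
    simp_rw [e]
    exact key.trans_lt hfin.lt_top
  · rw [integral_eq_lintegral_of_nonneg_ae (Filter.Eventually.of_forall hnn) hm]
    simp_rw [e]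
    have := ENNReal.toReal_mono hfin key
    rwa [ENNReal.toReal_mul, ENNReal.toReal_mul, ← ENNReal.toReal_rpow] at this

theorem integrable_norm_rpow_and_integral {r : ℝ} (hr : 0 < r) {f : X → ℂ}
    (hf : MemLp f (ENNReal.ofReal r) μ) :
    Integrable (fun x => ‖f x‖ ^ r) μ ∧ ∫ x, ‖f x‖ ^ r ∂μ = lrNorm r μ f ^ r := by
  have h1 := hf.integrable_norm_rpow (by simpa using hr) ENNReal.ofReal_ne_top
  rw [ENNReal.toReal_ofReal hr.le] at h1
  refine ⟨h1, ?_⟩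
  rw [lrNorm, hf.eLpNorm_eq_integral_rpow_norm (by simpa using hr) ENNReal.ofReal_ne_top,
    ENNReal.toReal_ofReal hr.le, ENNReal.toReal_ofReal (by positivity), ← Real.rpow_mul
    (integral_nonneg fun x => by positivity), inv_mul_cancel₀ hr.ne', Real.rpow_one]

end TripleHolder

/-! ### An ℓ² bound from a recursive inequality -/

section Recursion

/-- Closing the recursive estimate for the partial sums of a lacunary series. -/
theorem sq_le_of_rpow_recursion {r C μ : ℝ} (hr : 2 ≤ r) (hC : 0 ≤ C) (hμ0 : 0 ≤ μ) (hμ : μ < 1)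
    {n : ℕ} {s b c : ℕ → ℝ} (hs : ∀ j, 0 ≤ s j) (hs0 : s 0 = 0)
    (hb0 : b 0 = 0) (hb : ∀ j, b (j + 1) = μ * (b j + c j))
    (h : ∀ S, (∀ j ≤ n, s j ≤ S) → ∀ j < n,
      s (j + 1) ^ r ≤ s j ^ r + C * S ^ (r - 2) * (b j * c j + c j * c j)) :
    s n ^ 2 ≤ C * (2 + 1 / (1 - μ) ^ 2) * ∑ j ∈ Finset.range n, c j ^ 2 := by
  have hμ1 : 0 < 1 - μ := by linarith
  -- The sequence `b` is `c` convolved with a geometric sequence, so its ℓ² norm is controlled by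
  -- that of `c`. Keeping the term b_k² on the left makes the induction telescope.
  have hbsum : ∀ k, (1 - μ) * ∑ j ∈ Finset.range k, b j ^ 2 + b k ^ 2 ≤
      1 / (1 - μ) * ∑ j ∈ Finset.range k, c j ^ 2 := by
    intro k
    induction k with
    | zero => simp [hb0]
    | succ k ih =>
      rw [Finset.sum_range_succ, Finset.sum_range_succ, hb k]
      have h1 : (μ * (b k + c k)) ^ 2 ≤ μ * b k ^ 2 + 1 / (1 - μ) * c k ^ 2 := by
        rw [div_mul_eq_mul_div, one_mul, ← sub_le_iff_le_add', le_div_iff₀ hμ1]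
        have e : c k ^ 2 - ((μ * (b k + c k)) ^ 2 - μ * b k ^ 2) * (1 - μ) =
            μ * ((1 - μ) * b k - μ * c k) ^ 2 + (1 - μ ^ 2) * c k ^ 2 := by ring
        have : 0 ≤ μ * ((1 - μ) * b k - μ * c k) ^ 2 + (1 - μ ^ 2) * c k ^ 2 := by
          have : 0 ≤ 1 - μ ^ 2 := by nlinarith
          positivity
        linarith
      linarith
  have hbc : ∀ n, ∑ j ∈ Finset.range n, (b j * c j + c j * c j) ≤
      (2 + 1 / (1 - μ) ^ 2) * ∑ j ∈ Finset.range n, c j ^ 2 := by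
    intro n
    have h1 : ∑ j ∈ Finset.range n, b j ^ 2 ≤ 1 / (1 - μ) ^ 2 * ∑ j ∈ Finset.range n, c j ^ 2 := by
      have := hbsum n
      have h2 : (1 - μ) * ∑ j ∈ Finset.range n, b j ^ 2 ≤
          1 / (1 - μ) * ∑ j ∈ Finset.range n, c j ^ 2 := by nlinarith [sq_nonneg (b n)]
      rw [← le_div_iff₀' hμ1] at h2
      refine h2.trans (le_of_eq ?_)
      field_simp
    calc ∑ j ∈ Finset.range n, (b j * c j + c j * c j)
        ≤ ∑ j ∈ Finset.range n, (b j ^ 2 + 2 * c j ^ 2) :=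
          Finset.sum_le_sum fun j _ => by nlinarith [sq_nonneg (b j - c j)]
      _ = ∑ j ∈ Finset.range n, b j ^ 2 + 2 * ∑ j ∈ Finset.range n, c j ^ 2 := by
          rw [Finset.sum_add_distrib, Finset.mul_sum]
      _ ≤ _ := by linarith
  -- The recursion involves a bound S for all partial norms. Taking S to be their maximum and
  -- summing only up to an index m attaining it, the factor S^(r-2) can be divided out of s_m^r.
  obtain ⟨m, hm, hmax⟩ := Finset.exists_max_image (Finset.range (n + 1)) s ⟨0, by simp⟩
  have hmn : m ≤ n := by simpa [Nat.lt_succ_iff] using hm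
  have hmax' : ∀ j ≤ n, s j ≤ s m := fun j hj => hmax j (by simpa [Nat.lt_succ_iff] using hj)
  have hrec : ∀ k ≤ n, s k ^ r ≤ C * s m ^ (r - 2) *
      ∑ j ∈ Finset.range k, (b j * c j + c j * c j) := by
    intro k
    induction k with
    | zero => intro _; simp [hs0, Real.zero_rpow (show r ≠ 0 by linarith)]
    | succ k ih =>
      intro hk
      have h1 := h (s m) hmax' k (by omega)
      have h2 := ih (by omega)
      rw [Finset.sum_range_succ, mul_add]
      linarith
  have hsum : s m ^ 2 ≤ C * (2 + 1 / (1 - μ) ^ 2) * ∑ j ∈ Finset.range m, c j ^ 2 := by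
    rcases (hs m).eq_or_lt with h0 | h0
    · rw [← h0, zero_pow two_ne_zero]
      have : 0 ≤ ∑ j ∈ Finset.range m, c j ^ 2 := Finset.sum_nonneg fun j _ => sq_nonneg _
      positivity
    · have h1 : s m ^ (r - 2) * s m ^ 2 ≤
          s m ^ (r - 2) * (C * (2 + 1 / (1 - μ) ^ 2) * ∑ j ∈ Finset.range m, c j ^ 2) := by
        calc s m ^ (r - 2) * s m ^ 2 = s m ^ r := by
              rw [← Real.rpow_natCast, ← Real.rpow_add h0]; congr 1; push_cast; ring
          _ ≤ C * s m ^ (r - 2) * ∑ j ∈ Finset.range m, (b j * c j + c j * c j) := hrec m hmn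
          _ ≤ C * s m ^ (r - 2) * ((2 + 1 / (1 - μ) ^ 2) * ∑ j ∈ Finset.range m, c j ^ 2) := by
              gcongr; exact hbc m
          _ = _ := by ring
      exact le_of_mul_le_mul_left h1 (Real.rpow_pos_of_pos h0 _)
  calc s n ^ 2 ≤ s m ^ 2 := pow_le_pow_left₀ (hs n) (hmax' n le_rfl) 2
    _ ≤ C * (2 + 1 / (1 - μ) ^ 2) * ∑ j ∈ Finset.range m, c j ^ 2 := hsum
    _ ≤ _ := by
        gcongr

end Recursion

/-! ### Convolution kernels reproducing functions with frequencies in an annulus -/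

section Kernel

variable {V : Type*} [NormedAddCommGroup V] [InnerProductSpace ℝ V] [FiniteDimensional ℝ V]
  [MeasurableSpace V] [BorelSpace V]

/-- Young's convolution inequality `‖k * g‖_r ≤ ‖k‖_1 ‖g‖_r` for nonnegative functions. -/
theorem lintegral_conv_rpow_le {r : ℝ} (hr : 1 < r) {k g : V → ℝ≥0∞} (hk : Measurable k)
    (hg : Measurable g) :
    (∫⁻ x, (∫⁻ u, k u * g (x - u)) ^ r) ^ (1 / r) ≤ (∫⁻ u, k u) * (∫⁻ x, g x ^ r) ^ (1 / r) := by
  have hr0 : 0 < r := by linarith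
  have hc := (Real.HolderConjugate.conjExponent hr).symm
  set p := r.conjExponent
  have hp0 : 0 < p := hc.pos
  have hpr : 1 / p + 1 / r = 1 := by simpa using hc.inv_add_inv_eq_one
  -- Hölder after splitting k = k^(1/p) k^(1/r), p the conjugate exponent, so that the second factor
  -- carries the weight k only to the first power after raising to r.
  have h1 : ∀ x, (∫⁻ u, k u * g (x - u)) ^ r ≤
      (∫⁻ u, k u) ^ (r / p) * ∫⁻ u, k u * g (x - u) ^ r := by
    intro x
    have hm : Measurable fun u => g (x - u) := hg.comp (measurable_const.sub measurable_id)
    have h := ENNReal.lintegral_mul_le_Lp_mul_Lq volume hc (f := fun u => k u ^ (1 / p))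
      (g := fun u => k u ^ (1 / r) * g (x - u)) (hk.pow_const _).aemeasurable
      ((hk.pow_const _).mul hm).aemeasurable
    have e1 : ∀ u, ((fun u => k u ^ (1 / p)) * fun u => k u ^ (1 / r) * g (x - u)) u =
        k u * g (x - u) := fun u => by
      change k u ^ (1 / p) * (k u ^ (1 / r) * g (x - u)) = _
      rw [← mul_assoc, ← ENNReal.rpow_add_of_nonneg _ _ (by positivity) (by positivity), hpr,
        ENNReal.rpow_one]
    have e2 : ∀ u, (k u ^ (1 / p)) ^ p = k u := fun u => by
      rw [← ENNReal.rpow_mul, one_div_mul_cancel hp0.ne', ENNReal.rpow_one]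
    have e3 : ∀ u, (k u ^ (1 / r) * g (x - u)) ^ r = k u * g (x - u) ^ r := fun u => by
      rw [ENNReal.mul_rpow_of_nonneg _ _ hr0.le, ← ENNReal.rpow_mul, one_div_mul_cancel hr0.ne',
        ENNReal.rpow_one]
    simp_rw [e1, e2, e3] at h
    calc _ ≤ ((∫⁻ u, k u) ^ (1 / p) * (∫⁻ u, k u * g (x - u) ^ r) ^ (1 / r)) ^ r := by gcongr
      _ = _ := by
        rw [ENNReal.mul_rpow_of_nonneg _ _ hr0.le, ← ENNReal.rpow_mul, ← ENNReal.rpow_mul,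
          one_div_mul_cancel hr0.ne', ENNReal.rpow_one]
        congr 2; ring
  have h2 : ∫⁻ x, (∫⁻ u, k u * g (x - u)) ^ r ≤ (∫⁻ u, k u) ^ r * ∫⁻ x, g x ^ r := by
    have hmeas : Measurable fun z : V × V => k z.2 * g (z.1 - z.2) ^ r := by fun_prop
    calc _ ≤ ∫⁻ x, (∫⁻ u, k u) ^ (r / p) * ∫⁻ u, k u * g (x - u) ^ r := lintegral_mono h1
      _ = (∫⁻ u, k u) ^ (r / p) * ∫⁻ x, ∫⁻ u, k u * g (x - u) ^ r :=
          lintegral_const_mul _ hmeas.lintegral_prod_right'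
      _ = (∫⁻ u, k u) ^ (r / p) * ∫⁻ u, ∫⁻ x, k u * g (x - u) ^ r := by
          rw [lintegral_lintegral_swap hmeas.aemeasurable]
      _ = (∫⁻ u, k u) ^ (r / p) * ((∫⁻ u, k u) * ∫⁻ x, g x ^ r) := by
          congr 1
          rw [← lintegral_mul_const _ hk]
          congr 1; ext u
          rw [lintegral_const_mul _ (by fun_prop),
            lintegral_sub_right_eq_self (fun x => g x ^ r) u]
      _ = _ := by
          rw [← mul_assoc]
          congr 1
          conv_lhs => rw [← ENNReal.rpow_one (∫⁻ u, k u)]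
          rw [← ENNReal.rpow_mul, one_mul, ← ENNReal.rpow_add_of_nonneg _ _ (by positivity)
            zero_le_one]
          congr 1
          have : r / p = r * (1 / p) := by ring
          rw [this, eq_sub_of_add_eq hpr, mul_sub, mul_one_div_cancel hr0.ne']; ring
  calc _ ≤ ((∫⁻ u, k u) ^ r * ∫⁻ x, g x ^ r) ^ (1 / r) := by gcongr
    _ = _ := by
      rw [ENNReal.mul_rpow_of_nonneg _ _ (by positivity), ← ENNReal.rpow_mul,
        mul_one_div_cancel hr0.ne', ENNReal.rpow_one]

/-- The fundamental theorem of calculus along the segment from u to u + y, then Tonelli and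
translation invariance. -/
theorem lintegral_translate_sub_le (L : 𝓢(V, ℂ)) (y : V) :
    ∫⁻ u, ‖L (u + y) - L u‖ₑ ≤ (∫⁻ u, ‖fderiv ℝ L u‖ₑ) * ‖y‖ₑ := by
  have hd : Continuous (fderiv ℝ L) := (L.smooth ⊤).continuous_fderiv (by simp)
  have h1 : ∀ u, ‖L (u + y) - L u‖ₑ ≤ ∫⁻ t in Set.Ioc (0 : ℝ) 1, ‖fderiv ℝ L (u + t • y)‖ₑ * ‖y‖ₑ := by
    intro u
    have hderiv : ∀ t ∈ Set.uIcc (0 : ℝ) 1, HasDerivAt (fun t : ℝ => L (u + t • y))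
        (fderiv ℝ L (u + t • y) y) t := by
      intro t _
      have e1 : HasDerivAt (fun t : ℝ => u + t • y) y t := by
        simpa using ((hasDerivAt_id t).smul_const y).const_add u
      exact (L.differentiable.differentiableAt.hasFDerivAt (x := u + t • y)).comp_hasDerivAt t e1
    have hint : IntervalIntegrable (fun t : ℝ => fderiv ℝ L (u + t • y) y) volume 0 1 :=
      Continuous.intervalIntegrable (by fun_prop) 0 1
    have h := intervalIntegral.integral_eq_sub_of_hasDerivAt hderiv hint
    simp only [one_smul, zero_smul, add_zero] at h
    rw [← h, intervalIntegral.integral_of_le zero_le_one]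
    refine (enorm_integral_le_lintegral_enorm _).trans (lintegral_mono fun t => ?_)
    exact ContinuousLinearMap.le_opENorm _ _
  have hm : Measurable fun z : V × ℝ => ‖fderiv ℝ L (z.1 + z.2 • y)‖ₑ * ‖y‖ₑ :=
    (Continuous.measurable (by fun_prop)).enorm.mul_const _
  calc _ ≤ ∫⁻ u, ∫⁻ t in Set.Ioc (0 : ℝ) 1, ‖fderiv ℝ L (u + t • y)‖ₑ * ‖y‖ₑ := lintegral_mono h1
    _ = ∫⁻ t in Set.Ioc (0 : ℝ) 1, ∫⁻ u, ‖fderiv ℝ L (u + t • y)‖ₑ * ‖y‖ₑ :=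
        lintegral_lintegral_swap hm.aemeasurable
    _ = ∫⁻ _ in Set.Ioc (0 : ℝ) 1, (∫⁻ u, ‖fderiv ℝ L u‖ₑ) * ‖y‖ₑ := by
        congr 1; ext t
        rw [lintegral_add_right_eq_self (fun u => ‖fderiv ℝ L u‖ₑ * ‖y‖ₑ) (t • y),
          lintegral_mul_const _ hd.measurable.enorm]
    _ = _ := by simp

/-- The transform is prescribed as a difference of two bump functions: the outer one equals one up
to radius b, the inner one is supported in radius a. Both are one at the origin, which gives mean
zero. -/
theorem exists_schwartz_fourier_annulus {a b : ℝ} (ha : 0 < a) (hb : 0 < b) :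
    ∃ L : 𝓢(V, ℂ), ∫ u, L u = 0 ∧ ∀ ξ, a ≤ ‖ξ‖ → ‖ξ‖ ≤ b → expFourier L ξ = 1 := by
  let f₁ : ContDiffBump (0 : V) := ⟨b, b + 1, hb, by linarith⟩
  let f₂ : ContDiffBump (0 : V) := ⟨a / 2, a, by linarith, by linarith⟩
  let g : V → ℂ := fun x => ((f₁ x - f₂ x : ℝ) : ℂ)
  have h1 : HasCompactSupport g :=
    (f₁.hasCompactSupport.sub f₂.hasCompactSupport).comp_left (g := fun r : ℝ => (r : ℂ)) (by simp)
  have h2 : ContDiff ℝ ∞ g := Complex.ofRealCLM.contDiff.comp (f₁.contDiff.sub f₂.contDiff)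
  obtain ⟨L, hL⟩ := schwartzFourier_surjective (h1.toSchwartzMap h2)
  have hL' : ∀ ξ, expFourier L ξ = g ξ := fun ξ => by
    rw [← schwartzFourier_apply, hL]; rfl
  refine ⟨L, ?_, fun ξ h h' => ?_⟩
  · have h0 := hL' 0
    have e : g 0 = 0 := by
      simp only [g]
      rw [f₁.one_of_mem_closedBall (by simpa using hb.le), f₂.one_of_mem_closedBall
        (Metric.mem_closedBall_self f₂.rIn_pos.le)]
      simp
    rw [e] at h0
    simpa [expFourier] using h0
  · rw [hL']
    simp only [g]
    rw [f₁.one_of_mem_closedBall (by simpa using h'), f₂.zero_of_le_dist (by simpa using h)]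
    simp

/-- Kernels reproducing functions with frequencies in an annulus of radius `ρ`, with mean zero and
the scale invariant bounds for their moduli of continuity and their first moments. -/
theorem exists_annular_kernel {a b : ℝ} (ha : 0 < a) (hb : 0 < b) :
    ∃ c : ℝ≥0, ∀ ρ : ℝ, 0 < ρ → ∃ L : 𝓢(V, ℂ), ∫ u, L u = 0 ∧
      (∀ ξ, ρ * a ≤ ‖ξ‖ → ‖ξ‖ ≤ ρ * b → expFourier L ξ = 1) ∧
      (∀ y, ∫⁻ u, ‖L (u + y) - L u‖ₑ ≤ c * ENNReal.ofReal ρ * ‖y‖ₑ) ∧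
      ∫⁻ u, ‖L u‖ₑ * ‖u‖ₑ ≤ c * ENNReal.ofReal ρ⁻¹ := by
  obtain ⟨L, hL0, hL1⟩ := exists_schwartz_fourier_annulus (V := V) ha hb
  have hfin1 : ∫⁻ u, ‖fderiv ℝ L u‖ₑ ≠ ⊤ :=
    (SchwartzMap.fderivCLM ℝ V ℂ L).integrable.2.ne
  have hfin2 : ∫⁻ u, ‖L u‖ₑ * ‖u‖ₑ ≠ ⊤ := by
    have h := (SchwartzMap.integrable_pow_mul volume L 1).2.ne
    refine ne_of_eq_of_ne ?_ h
    congr 1; ext u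
    simp only [pow_one]
    rw [enorm_mul, enorm_norm, enorm_norm, mul_comm]
  set n := Module.finrank ℝ V
  refine ⟨(∫⁻ u, ‖fderiv ℝ L u‖ₑ).toNNReal + (∫⁻ u, ‖L u‖ₑ * ‖u‖ₑ).toNNReal, fun ρ hρ => ?_⟩
  have hρn : 0 < ρ ^ n := by positivity
  have hcancel : ENNReal.ofReal (ρ ^ n) * ENNReal.ofReal ((ρ ^ n)⁻¹) = 1 := by
    rw [← ENNReal.ofReal_mul hρn.le, mul_inv_cancel₀ hρn.ne', ENNReal.ofReal_one]
  -- The dilation preserving the L¹ norm: a derivative costs a factor ρ, a first moment gains ρ⁻¹,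
  -- and the transform is dilated without change of height.
  refine ⟨((ρ ^ n : ℝ) : ℂ) • schwartzDilate ρ hρ.ne' L, ?_, fun ξ h h' => ?_, fun y => ?_, ?_⟩
  · simp only [smul_apply, schwartzDilate_apply, smul_eq_mul]
    rw [integral_const_mul, Measure.integral_comp_smul, hL0]; simp
  · have h1 : expFourier L (ρ⁻¹ • ξ) = 1 := by
      refine hL1 _ ?_ ?_ <;> rw [norm_smul, Real.norm_of_nonneg (by positivity)]
      · rw [inv_mul_eq_div, le_div_iff₀ hρ]; linarith
      · rw [inv_mul_eq_div, div_le_iff₀ hρ]; linarith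
    rw [← h1]
    have := Measure.integral_comp_smul (volume : Measure V)
      (fun u => Complex.exp (-Complex.I * (inner ℝ u (ρ⁻¹ • ξ) : ℝ)) * L u) ρ
    rw [abs_of_pos (by positivity), Complex.real_smul] at this
    have h2 : expFourier L (ρ⁻¹ • ξ) = ((ρ ^ n : ℝ) : ℂ) *
        (((ρ ^ n)⁻¹ : ℝ) * expFourier L (ρ⁻¹ • ξ)) := by
      rw [← mul_assoc, ← Complex.ofReal_mul, mul_inv_cancel₀ hρn.ne']; simp
    rw [h2, expFourier, expFourier, ← this, ← integral_const_mul]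
    congr 1; ext u
    rw [smul_apply, schwartzDilate_apply, inner_smul_left, inner_smul_right,
      smul_eq_mul]
    simp [hρ.ne']
    ring
  · have h1 : ∀ u, ‖(((ρ ^ n : ℝ) : ℂ) • schwartzDilate ρ hρ.ne' L) (u + y) -
        (((ρ ^ n : ℝ) : ℂ) • schwartzDilate ρ hρ.ne' L) u‖ₑ =
        ENNReal.ofReal (ρ ^ n) * ‖L (ρ • u + ρ • y) - L (ρ • u)‖ₑ := by
      intro u
      rw [smul_apply, smul_apply, ← smul_sub, schwartzDilate_apply,
        schwartzDilate_apply, smul_add, enorm_smul, ← ofReal_norm, Complex.norm_real,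
        Real.norm_of_nonneg hρn.le]
    simp_rw [h1]
    rw [lintegral_const_mul' _ _ ENNReal.ofReal_ne_top, lintegral_comp_smul volume
      (fun u => ‖L (u + ρ • y) - L u‖ₑ) hρ, ← mul_assoc, hcancel, one_mul]
    refine (lintegral_translate_sub_le L _).trans ?_
    rw [enorm_smul, mul_assoc, ← ofReal_norm (ρ : ℝ), Real.norm_of_nonneg hρ.le, ENNReal.coe_add,
      ENNReal.coe_toNNReal hfin1]
    gcongr
    exact le_self_add
  · have h1 : ∀ u, ‖(((ρ ^ n : ℝ) : ℂ) • schwartzDilate ρ hρ.ne' L) u‖ₑ * ‖u‖ₑ =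
        ENNReal.ofReal (ρ ^ n) * (ENNReal.ofReal ρ⁻¹ * (‖L (ρ • u)‖ₑ * ‖ρ • u‖ₑ)) := by
      intro u
      have e : ENNReal.ofReal ρ⁻¹ * ‖ρ • u‖ₑ = ‖u‖ₑ := by
        rw [enorm_smul, ← mul_assoc, ← ofReal_norm (ρ : ℝ), Real.norm_of_nonneg hρ.le,
          ← ENNReal.ofReal_mul (by positivity), inv_mul_cancel₀ hρ.ne', ENNReal.ofReal_one, one_mul]
      rw [smul_apply, schwartzDilate_apply, enorm_smul, ← ofReal_norm,
        Complex.norm_real, Real.norm_of_nonneg hρn.le, mul_left_comm (ENNReal.ofReal ρ⁻¹), e,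
        mul_assoc]
    simp_rw [h1]
    rw [lintegral_const_mul' _ _ ENNReal.ofReal_ne_top,
      lintegral_const_mul' _ _ ENNReal.ofReal_ne_top, lintegral_comp_smul volume
      (fun u => ‖L u‖ₑ * ‖u‖ₑ) hρ, mul_left_comm, ← mul_assoc (ENNReal.ofReal (ρ ^ n)), hcancel,
      one_mul, mul_comm]
    rw [ENNReal.coe_add, ENNReal.coe_toNNReal hfin2]
    gcongr
    exact le_add_self

/-- A function with frequencies where the transform of `L` is one is reproduced by `L`. -/
theorem expFourierInv_eq_conv {α : V → ℂ} (hα : Integrable α) (L : 𝓢(V, ℂ))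
    (hL : ∀ ξ, α ξ ≠ 0 → expFourier L ξ = 1) (x : V) :
    ∫ u, L u * expFourierInv α (x - u) = expFourierInv α x := by
  have hint : Integrable (fun z : V × V => L z.1 *
      (Complex.exp (Complex.I * (inner ℝ (x - z.1) z.2 : ℝ)) * α z.2)) (volume.prod volume) := by
    have h := (L.integrable (μ := volume)).mul_prod hα
    have h2 := h.bdd_mul (c := 1) (f := fun z : V × V =>
        Complex.exp (Complex.I * (inner ℝ (x - z.1) z.2 : ℝ)))
      (Continuous.aestronglyMeasurable (by fun_prop))
      (Filter.Eventually.of_forall fun ξ => by rw [mul_comm Complex.I, Complex.norm_exp_ofReal_mul_I])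
    refine h2.congr (Filter.Eventually.of_forall fun z => ?_)
    simp only; ring
  calc ∫ u, L u * expFourierInv α (x - u)
      = ∫ u, ∫ ξ, L u * (Complex.exp (Complex.I * (inner ℝ (x - u) ξ : ℝ)) * α ξ) := by
        simp_rw [expFourierInv, integral_const_mul]
    _ = ∫ ξ, ∫ u, L u * (Complex.exp (Complex.I * (inner ℝ (x - u) ξ : ℝ)) * α ξ) :=
        integral_integral_swap hint
    _ = ∫ ξ, Complex.exp (Complex.I * (inner ℝ x ξ : ℝ)) * α ξ := by
        congr 1; ext ξ
        by_cases h0 : α ξ = 0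
        · simp [h0]
        · have : ∀ u, L u * (Complex.exp (Complex.I * (inner ℝ (x - u) ξ : ℝ)) * α ξ) =
              Complex.exp (Complex.I * (inner ℝ x ξ : ℝ)) * α ξ *
                (Complex.exp (-Complex.I * (inner ℝ u ξ : ℝ)) * L u) := fun u => by
            rw [inner_sub_left]; push_cast
            rw [mul_sub, sub_eq_add_neg, Complex.exp_add]; ring_nf
          simp_rw [this]
          rw [integral_const_mul]
          change _ * expFourier L ξ = _
          rw [hL ξ h0, mul_one]

end Kernel

/-! ### The ℓ² Littlewood–Paley inequality in L^r, r ≥ 2 -/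

section LittlewoodPaley

variable {V : Type*} [NormedAddCommGroup V] [InnerProductSpace ℝ V] [FiniteDimensional ℝ V]
  [MeasurableSpace V] [BorelSpace V]

theorem lrNorm_nonneg {X : Type*} [MeasurableSpace X] (r : ℝ) (μ : Measure X) (f : X → ℂ) :
    0 ≤ lrNorm r μ f := ENNReal.toReal_nonneg

theorem lrNorm_add_le {X : Type*} [MeasurableSpace X] {r : ℝ} {μ : Measure X} (hr : 1 ≤ r)
    {f g : X → ℂ} (hf : MemLp f (ENNReal.ofReal r) μ) (hg : MemLp g (ENNReal.ofReal r) μ) :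
    lrNorm r μ (f + g) ≤ lrNorm r μ f + lrNorm r μ g := by
  rw [lrNorm, lrNorm, lrNorm, ← ENNReal.toReal_add hf.2.ne hg.2.ne]
  exact ENNReal.toReal_mono (ENNReal.add_ne_top.2 ⟨hf.2.ne, hg.2.ne⟩)
    (eLpNorm_add_le hf.1 hg.1 (by simpa using hr))

/-- Supplies the first factor for the triple Hölder inequality, where the pointwise expansion
produces (|f| + |g|)^(r-2); the values are complex only to match `lrNorm`. -/
theorem memLp_norm_add_norm {X : Type*} [MeasurableSpace X] {r : ℝ} {μ : Measure X} (hr : 1 ≤ r)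
    {f g : X → ℂ} (hf : MemLp f (ENNReal.ofReal r) μ) (hg : MemLp g (ENNReal.ofReal r) μ) :
    MemLp (fun x => ((‖f x‖ + ‖g x‖ : ℝ) : ℂ)) (ENNReal.ofReal r) μ ∧
      lrNorm r μ (fun x => ((‖f x‖ + ‖g x‖ : ℝ) : ℂ)) ≤ lrNorm r μ f + lrNorm r μ g := by
  have h1 : ∀ {f : X → ℂ}, MemLp f (ENNReal.ofReal r) μ →
      MemLp (fun x => ((‖f x‖ : ℝ) : ℂ)) (ENNReal.ofReal r) μ := fun hf => hf.norm.ofReal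
  have h2 : ∀ f : X → ℂ, lrNorm r μ (fun x => ((‖f x‖ : ℝ) : ℂ)) = lrNorm r μ f := fun f => by
    rw [lrNorm, lrNorm]; congr 1
    exact eLpNorm_congr_norm_ae (Filter.Eventually.of_forall fun x => by simp)
  have e : (fun x => ((‖f x‖ + ‖g x‖ : ℝ) : ℂ)) =
      (fun x => ((‖f x‖ : ℝ) : ℂ)) + fun x => ((‖g x‖ : ℝ) : ℂ) := by
    ext x; simp
  rw [e]
  refine ⟨(h1 hf).add (h1 hg), (lrNorm_add_le hr (h1 hf) (h1 hg)).trans (le_of_eq ?_)⟩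
  rw [h2, h2]

theorem memLp_translate {p : ℝ≥0∞} {f : V → ℂ} (hf : MemLp f p volume) (y : V) :
    MemLp (fun x => f (x + y)) p volume :=
  hf.comp_measurePreserving (measurePreserving_add_right volume y)

theorem lrNorm_translate {r : ℝ} {f : V → ℂ} (hf : AEStronglyMeasurable f volume) (y : V) :
    lrNorm r volume (fun x => f (x + y)) = lrNorm r volume f := by
  rw [lrNorm, lrNorm]
  congr 1
  exact eLpNorm_comp_measurePreserving hf (measurePreserving_add_right volume y)

/-- Modulus of continuity in `L^r` of a function reproduced by a kernel. -/
theorem eLpNorm_translate_sub_le {r : ℝ} (hr : 1 < r) {h : V → ℂ} (hc : Continuous h) {B : ℝ}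
    (hB : ∀ x, ‖h x‖ ≤ B) (L : 𝓢(V, ℂ)) (hL : ∀ x, ∫ u, L u * h (x - u) = h x) (y : V) :
    eLpNorm (fun x => h (x + y) - h x) (ENNReal.ofReal r) volume ≤
      (∫⁻ u, ‖L (u + y) - L u‖ₑ) * eLpNorm h (ENNReal.ofReal r) volume := by
  have hr0 : 0 < r := by linarith
  rw [eLpNorm_ofReal_eq hr0, eLpNorm_ofReal_eq hr0]
  have hLy : Integrable (fun u => L (u + y)) := L.integrable.comp_add_right y
  have hcx : ∀ x, AEStronglyMeasurable (fun u => h (x - u)) volume := fun x =>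
    Continuous.aestronglyMeasurable (by fun_prop)
  -- Translating the reproducing formula moves the increment from h onto the kernel; Young's
  -- inequality then finishes.
  have h1 : ∀ x, ‖h (x + y) - h x‖ₑ ≤ ∫⁻ u, ‖L (u + y) - L u‖ₑ * ‖h (x - u)‖ₑ := by
    intro x
    have e1 : h (x + y) = ∫ u, L (u + y) * h (x - u) := by
      rw [← hL (x + y), ← integral_add_right_eq_self _ y]
      congr 1; ext u
      congr 2; abel
    rw [e1, ← hL x, ← integral_sub
      (hLy.mul_bdd (c := B) (hcx x) (Filter.Eventually.of_forall fun u => hB _))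
      (L.integrable.mul_bdd (c := B) (hcx x) (Filter.Eventually.of_forall fun u => hB _))]
    refine (enorm_integral_le_lintegral_enorm _).trans (lintegral_mono fun u => ?_)
    rw [← sub_mul, enorm_mul]
  refine le_trans ?_ (lintegral_conv_rpow_le hr (k := fun u => ‖L (u + y) - L u‖ₑ)
    (g := fun x => ‖h x‖ₑ) (Continuous.measurable (by have := L.continuous; fun_prop)).enorm
    hc.measurable.enorm)
  gcongr with x
  exact h1 x

/-- The linear term in the expansion of `‖F + h‖_r ^ r` gains from the smoothness of `F` when `h`
is reproduced by a mean zero kernel. -/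
theorem abs_integral_dualityMap_mul_le {r : ℝ} (hr : 2 ≤ r) {F h : V → ℂ} (hFc : Continuous F)
    (hhc : Continuous h) (hF : MemLp F (ENNReal.ofReal r) volume)
    (hh : MemLp h (ENNReal.ofReal r) volume) (L : 𝓢(V, ℂ)) (hL0 : ∫ u, L u = 0)
    (hL : ∀ x, ∫ u, L u * h (x - u) = h x) {η κ : ℝ} (hη : 0 ≤ η)
    (hFη : ∀ y, lrNorm r volume (fun x => F (x + y) - F x) ≤ η * ‖y‖)
    (hκi : Integrable fun u => ‖L u‖ * ‖u‖) (hκ : ∫ u, ‖L u‖ * ‖u‖ ≤ κ) :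
    ‖∫ x, dualityMap r (F x) * h x‖ ≤
      (r - 1) * (2 * lrNorm r volume F) ^ (r - 2) * η * lrNorm r volume h * κ := by
  have hr0 : 0 < r := by linarith
  set s := lrNorm r volume F
  set t := lrNorm r volume h
  have hs : 0 ≤ s := lrNorm_nonneg _ _ _
  have ht : 0 ≤ t := lrNorm_nonneg _ _ _
  have hdc := continuous_dualityMap hr
  have hhsub : ∀ u, MemLp (fun x => h (x - u)) (ENNReal.ofReal r) volume := fun u => by
    simpa [sub_eq_add_neg] using memLp_translate hh (-u)
  have hint1 : ∀ {F' h' : V → ℂ}, Continuous F' → Continuous h' →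
      MemLp F' (ENNReal.ofReal r) volume → MemLp h' (ENNReal.ofReal r) volume →
      Integrable (fun x => dualityMap r (F' x) * h' x) ∧
        ∫ x, ‖dualityMap r (F' x) * h' x‖ ≤
          lrNorm r volume F' ^ (r - 2) * lrNorm r volume F' * lrNorm r volume h' := by
    intro F' h' hF'c hh'c hF' hh'
    obtain ⟨i1, i2⟩ := integrable_and_integral_rpow_mul_mul_le hr hF' hF' hh'
    have e : ∀ x, ‖dualityMap r (F' x) * h' x‖ = ‖F' x‖ ^ (r - 2) * ‖F' x‖ * ‖h' x‖ := fun x => by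
      rw [norm_mul, norm_dualityMap]
    refine ⟨i1.mono' ((hdc.comp hF'c).mul hh'c).aestronglyMeasurable
      (Filter.Eventually.of_forall fun x => (e x).le), ?_⟩
    simp_rw [e]; exact i2
  have hswap : Integrable (fun z : V × V => L z.2 * (dualityMap r (F z.1) * h (z.1 - z.2)))
      (volume.prod volume) := by
    have hm : AEStronglyMeasurable
        (fun z : V × V => L z.2 * (dualityMap r (F z.1) * h (z.1 - z.2)))
        (volume.prod volume) := by
      refine Continuous.aestronglyMeasurable ?_
      have := L.continuous
      fun_prop
    rw [integrable_prod_iff' hm]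
    refine ⟨Filter.Eventually.of_forall fun u =>
      (hint1 hFc (by fun_prop) hF (hhsub u)).1.const_mul (L u), ?_⟩
    refine (L.integrable.norm.mul_const (s ^ (r - 2) * s * t)).mono'
      hm.norm.prod_swap.integral_prod_right' (Filter.Eventually.of_forall fun u => ?_)
    rw [Real.norm_of_nonneg (integral_nonneg fun _ => norm_nonneg _)]
    simp_rw [norm_mul (L u)]
    rw [integral_const_mul]
    refine mul_le_mul_of_nonneg_left ((hint1 hFc (by fun_prop) hF (hhsub u)).2.trans ?_)
      (norm_nonneg _)
    have : lrNorm r volume (fun x => h (x - u)) = t := by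
      simpa [sub_eq_add_neg] using lrNorm_translate (r := r) hh.1 (-u)
    rw [this]
  -- Inserting the reproducing formula for h and translating in x puts the shift on F instead of h.
  -- Everything becomes an average of `I` against the kernel.
  let I : V → ℂ := fun y => ∫ x, dualityMap r (F (x + y)) * h x
  have hI : ∀ u, ∫ x, dualityMap r (F x) * h (x - u) = I u := by
    intro u
    rw [← integral_add_right_eq_self _ u]
    simp only [I, add_sub_cancel_right]
  have h1 : ∫ x, dualityMap r (F x) * h x = ∫ u, L u * I u := by
    calc ∫ x, dualityMap r (F x) * h x
        = ∫ x, ∫ u, L u * (dualityMap r (F x) * h (x - u)) := by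
          congr 1; ext x
          rw [← hL x, ← integral_const_mul]
          congr 1; ext u
          ring
      _ = ∫ u, ∫ x, L u * (dualityMap r (F x) * h (x - u)) := integral_integral_swap hswap
      _ = ∫ u, L u * I u := by
          congr 1; ext u; rw [integral_const_mul, hI]
  have hLI : Integrable (fun u => L u * I u) := by
    refine hswap.integral_prod_right.congr (Filter.Eventually.of_forall fun u => ?_)
    simp only
    rw [integral_const_mul, hI]
  -- Mean zero of the kernel is used here: only increments of `I` count, and these are controlled by
  -- the modulus of continuity of F.
  have h2 : ∫ u, L u * I u = ∫ u, L u * (I u - I 0) := by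
    simp_rw [mul_sub]
    rw [integral_sub hLI (L.integrable.mul_const _), integral_mul_const, hL0, zero_mul, sub_zero]
  have h3 : ∀ y, ‖I y - I 0‖ ≤ (r - 1) * (2 * s) ^ (r - 2) * η * t * ‖y‖ := by
    intro y
    have hFy := memLp_translate hF y
    have hFyc : Continuous fun x => F (x + y) := by fun_prop
    obtain ⟨hsum, hsumn⟩ := memLp_norm_add_norm (by linarith) hFy hF
    rw [lrNorm_translate hF.1] at hsumn
    obtain ⟨i1, i2⟩ := integrable_and_integral_rpow_mul_mul_le hr hsum (hFy.sub hF) hh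
    have hi0 := (hint1 hFc hhc hF hh).1
    have hiy := (hint1 hFyc hhc hFy hh).1
    have e0 : I y - I 0 = ∫ x, (dualityMap r (F (x + y)) - dualityMap r (F x)) * h x := by
      simp only [I, add_zero, sub_mul]
      rw [integral_sub hiy hi0]
    rw [e0]
    calc _ ≤ ∫ x, (r - 1) * (‖((‖F (x + y)‖ + ‖F x‖ : ℝ) : ℂ)‖ ^ (r - 2) *
            ‖((fun x => F (x + y)) - F) x‖ * ‖h x‖) := by
          refine norm_integral_le_of_norm_le (i1.const_mul _)
            (Filter.Eventually.of_forall fun x => ?_)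
          rw [norm_mul, Complex.norm_real, Real.norm_of_nonneg (by positivity)]
          calc _ ≤ (r - 1) * (‖F (x + y)‖ + ‖F x‖) ^ (r - 2) * ‖F (x + y) - F x‖ * ‖h x‖ := by
                gcongr
                exact norm_dualityMap_sub_le hr _ _
            _ = _ := by simp only [Pi.sub_apply]; ring
      _ ≤ (r - 1) * ((2 * s) ^ (r - 2) * (η * ‖y‖) * t) := by
          rw [integral_const_mul]
          refine mul_le_mul_of_nonneg_left (i2.trans ?_) (by linarith)
          have h5 : lrNorm r volume ((fun x => F (x + y)) - F) ≤ η * ‖y‖ := hFη y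
          have h0 := lrNorm_nonneg r volume (fun x => ((‖F (x + y)‖ + ‖F x‖ : ℝ) : ℂ))
          have h0' := lrNorm_nonneg r volume ((fun x => F (x + y)) - F)
          have h6 : lrNorm r volume (fun x => ((‖F (x + y)‖ + ‖F x‖ : ℝ) : ℂ)) ^ (r - 2) ≤
              (2 * s) ^ (r - 2) :=
            Real.rpow_le_rpow h0 (hsumn.trans (le_of_eq (two_mul s).symm)) (by linarith)
          gcongr
      _ = _ := by ring
  rw [h1, h2]
  set K := (r - 1) * (2 * s) ^ (r - 2) * η * t with hK
  have hK0 : 0 ≤ K := by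
    have : 0 ≤ r - 1 := by linarith
    positivity
  calc _ ≤ ∫ u, K * (‖L u‖ * ‖u‖) := by
        refine norm_integral_le_of_norm_le (hκi.const_mul _) (Filter.Eventually.of_forall fun u => ?_)
        rw [norm_mul]
        calc _ ≤ ‖L u‖ * (K * ‖u‖) := by gcongr; exact h3 u
          _ = _ := by ring
    _ ≤ K * κ := by
        rw [integral_const_mul]; gcongr

/-- One step of the Littlewood–Paley recursion. -/
theorem lrNorm_add_rpow_le {r : ℝ} (hr : 2 ≤ r) {F h : V → ℂ} (hF : MemLp F (ENNReal.ofReal r) volume)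
    (hh : MemLp h (ENNReal.ofReal r) volume) (hFc : Continuous F) (hhc : Continuous h) :
    lrNorm r volume (F + h) ^ r ≤ lrNorm r volume F ^ r +
      r * ‖∫ x, dualityMap r (F x) * h x‖ + r * (r - 1) *
        ((lrNorm r volume (F + h) + lrNorm r volume F) ^ (r - 2) * lrNorm r volume h *
          lrNorm r volume h) := by
  have hr0 : 0 < r := by linarith
  have hFh := hF.add hh
  obtain ⟨i1, e1⟩ := integrable_norm_rpow_and_integral hr0 hFh
  obtain ⟨i2, e2⟩ := integrable_norm_rpow_and_integral hr0 hF
  obtain ⟨hsum, hsumn⟩ := memLp_norm_add_norm (show 1 ≤ r by linarith) hFh hF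
  obtain ⟨i3, b3⟩ := integrable_and_integral_rpow_mul_mul_le hr hsum hh hh
  obtain ⟨i4, -⟩ := integrable_and_integral_rpow_mul_mul_le hr hF hF hh
  have i5 : Integrable (fun x => dualityMap r (F x) * h x) :=
    i4.mono' (((continuous_dualityMap hr).comp hFc).mul hhc).aestronglyMeasurable
      (Filter.Eventually.of_forall fun x => by rw [norm_mul, norm_dualityMap])
  have i6 : Integrable (fun x => (dualityMap r (F x) * h x).re) := i5.re
  have e6 : ∫ x, (dualityMap r (F x) * h x).re = (∫ x, dualityMap r (F x) * h x).re :=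
    integral_re i5
  have hpt : ∀ x, ‖(F + h) x‖ ^ r ≤ ‖F x‖ ^ r + r * (dualityMap r (F x) * h x).re +
      r * (r - 1) * (‖((‖(F + h) x‖ + ‖F x‖ : ℝ) : ℂ)‖ ^ (r - 2) * ‖h x‖ * ‖h x‖) := by
    intro x
    rw [Complex.norm_real, Real.norm_of_nonneg (by positivity)]
    exact norm_add_rpow_le hr (F x) (h x)
  have hint := integral_mono i1 ((i2.add (i6.const_mul r)).add (i3.const_mul (r * (r - 1)))) hpt
  have esplit : ∫ x, (((fun x => ‖F x‖ ^ r) + fun x => r * (dualityMap r (F x) * h x).re) +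
      fun x => r * (r - 1) * (‖((‖(F + h) x‖ + ‖F x‖ : ℝ) : ℂ)‖ ^ (r - 2) * ‖h x‖ * ‖h x‖)) x =
      lrNorm r volume F ^ r + r * (∫ x, dualityMap r (F x) * h x).re + r * (r - 1) *
        ∫ x, ‖((‖(F + h) x‖ + ‖F x‖ : ℝ) : ℂ)‖ ^ (r - 2) * ‖h x‖ * ‖h x‖ := by
    rw [integral_add' (i2.add (i6.const_mul r)) (i3.const_mul _), integral_add' i2 (i6.const_mul r),
      e2, integral_const_mul, integral_const_mul, e6]
  rw [e1, esplit] at hint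
  refine hint.trans ?_
  have h1 : (∫ x, dualityMap r (F x) * h x).re ≤ ‖∫ x, dualityMap r (F x) * h x‖ :=
    Complex.re_le_norm _
  have h0 := lrNorm_nonneg r volume (fun x => ((‖(F + h) x‖ + ‖F x‖ : ℝ) : ℂ))
  have h0' := lrNorm_nonneg r volume h
  have h2 : lrNorm r volume (fun x => ((‖(F + h) x‖ + ‖F x‖ : ℝ) : ℂ)) ^ (r - 2) ≤
      (lrNorm r volume (F + h) + lrNorm r volume F) ^ (r - 2) :=
    Real.rpow_le_rpow h0 hsumn (by linarith)
  have h3 : 0 ≤ r - 1 := by linarith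
  gcongr
  refine b3.trans ?_
  gcongr

/-- The constant of one step of the Littlewood–Paley recursion. -/
def lpStepConst (r c : ℝ) : ℝ := r * (r - 1) * 2 ^ (r - 2) * (c * c + 1)

/-- The pieces are added in order of increasing frequency. The partial sum F_j has only frequencies
up to R lam^j, so it is smooth at the scale on which h_j oscillates. Its modulus of continuity is
measured by a geometrically weighted sum of the earlier norms, which is the sequence `b` of
`sq_le_of_rpow_recursion` with ratio lam⁻¹. -/
theorem lrNorm_sum_sq_le {r lam : ℝ} (hr : 2 ≤ r) (hlam : 1 < lam) {c : ℝ≥0}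
    (hc : ∀ ρ : ℝ, 0 < ρ → ∃ L : 𝓢(V, ℂ), ∫ u, L u = 0 ∧
      (∀ ξ, ρ * 1 ≤ ‖ξ‖ → ‖ξ‖ ≤ ρ * lam → expFourier L ξ = 1) ∧
      (∀ y, ∫⁻ u, ‖L (u + y) - L u‖ₑ ≤ c * ENNReal.ofReal ρ * ‖y‖ₑ) ∧
      ∫⁻ u, ‖L u‖ₑ * ‖u‖ₑ ≤ c * ENNReal.ofReal ρ⁻¹)
    {R : ℝ} (hR : 0 < R) (n : ℕ) {a : ℕ → V → ℂ} (ha : ∀ i, Integrable (a i))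
    (hsupp : ∀ i ξ, a i ξ ≠ 0 → R * lam ^ i ≤ ‖ξ‖ ∧ ‖ξ‖ ≤ R * lam ^ (i + 1))
    (hmem : ∀ i, MemLp (expFourierInv (a i)) (ENNReal.ofReal r) volume) :
    lrNorm r volume (fun x => ∑ i ∈ Finset.range n, expFourierInv (a i) x) ^ 2 ≤
      lpStepConst r c * (2 + 1 / (1 - lam⁻¹) ^ 2) *
        ∑ i ∈ Finset.range n, lrNorm r volume (expFourierInv (a i)) ^ 2 := by
  have hr0 : 0 < r := by linarith
  have hr1 : 0 ≤ r - 1 := by linarith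
  have hlam0 : 0 < lam := by linarith
  set h : ℕ → V → ℂ := fun i => expFourierInv (a i) with hh
  have hhc : ∀ i, Continuous (h i) := fun i => continuous_expFourierInv (ha i)
  set F : ℕ → V → ℂ := fun j x => ∑ i ∈ Finset.range j, h i x with hFdef
  have hFc : ∀ j, Continuous (F j) := fun j => continuous_finsetSum _ fun i _ => hhc i
  have hFm : ∀ j, MemLp (F j) (ENNReal.ofReal r) volume := fun j =>
    memLp_finsetSum _ fun i _ => hmem i
  have hFs : ∀ j, F (j + 1) = F j + h j := fun j => by
    ext x; simp [hFdef, Finset.sum_range_succ]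
  set t : ℕ → ℝ := fun j => lrNorm r volume (h j)
  have ht : ∀ j, 0 ≤ t j := fun j => lrNorm_nonneg _ _ _
  -- Normalised so that F_j has modulus of continuity at most c R lam^j b_j: each step adds t_j, and
  -- the factor lam⁻¹ compensates for the growth of the reference frequency.
  let b : ℕ → ℝ := fun j => Nat.rec 0 (fun j b => lam⁻¹ * (b + t j)) j
  have hbs : ∀ j, b (j + 1) = lam⁻¹ * (b j + t j) := fun j => rfl
  have hb0 : ∀ j, 0 ≤ b j := by
    intro j
    induction j with
    | zero => exact le_rfl
    | succ j ih => rw [hbs]; have := ht j; positivity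
  have hρ : ∀ j, 0 < R * lam ^ j := fun j => by positivity
  choose L hL0 hL1 hL2 hL3 using fun j => hc _ (hρ j)
  have hrep : ∀ j x, ∫ u, L j u * h j (x - u) = h j x := fun j x =>
    expFourierInv_eq_conv (ha j) (L j) (fun ξ hξ => by
      obtain ⟨h1, h2⟩ := hsupp j ξ hξ
      refine hL1 j ξ (by linarith) ?_
      rw [pow_succ] at h2; linarith) x
  have hmod : ∀ j y, lrNorm r volume (fun x => h j (x + y) - h j x) ≤
      c * (R * lam ^ j) * ‖y‖ * t j := by
    intro j y
    have h1 := (eLpNorm_translate_sub_le (show 1 < r by linarith) (hhc j)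
      (norm_expFourierInv_le (a j)) (L j) (hrep j) y).trans (mul_le_mul_left (hL2 j y) _)
    have h2 := ENNReal.toReal_mono (ENNReal.mul_ne_top (ENNReal.mul_ne_top
      (ENNReal.mul_ne_top ENNReal.coe_ne_top ENNReal.ofReal_ne_top) enorm_ne_top) (hmem j).2.ne) h1
    rw [ENNReal.toReal_mul, ENNReal.toReal_mul, ENNReal.toReal_mul, toReal_enorm,
      ENNReal.toReal_ofReal (hρ j).le, ENNReal.coe_toReal] at h2
    exact h2
  have hmodF : ∀ j y, lrNorm r volume (fun x => F j (x + y) - F j x) ≤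
      (c * (R * lam ^ j) * b j) * ‖y‖ := by
    intro j y
    induction j with
    | zero => simp [hFdef, lrNorm, b]
    | succ j ih =>
      have e : (fun x => F (j + 1) (x + y) - F (j + 1) x) =
          (fun x => F j (x + y) - F j x) + fun x => h j (x + y) - h j x := by
        ext x; rw [hFs]; simp only [Pi.add_apply]; ring
      rw [e]
      refine (lrNorm_add_le (by linarith) ((memLp_translate (hFm j) y).sub (hFm j))
        ((memLp_translate (hmem j) y).sub (hmem j))).trans ((add_le_add ih (hmod j y)).trans
          (le_of_eq ?_))
      rw [hbs, pow_succ]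
      field_simp
  refine sq_le_of_rpow_recursion (s := fun j => lrNorm r volume (F j)) (b := b) (c := t)
    (μ := lam⁻¹) hr ?_ (by positivity) (inv_lt_one_of_one_lt₀ hlam) (fun j => lrNorm_nonneg _ _ _)
    ?_ rfl hbs ?_
  · unfold lpStepConst; positivity
  · simp [hFdef, lrNorm]
  · intro S hS j hj
    have hSj := hS j hj.le
    have hSj1 := hS (j + 1) hj
    have hs0 := lrNorm_nonneg r volume (F j)
    have hs1 := lrNorm_nonneg r volume (F (j + 1))
    have hS0 : 0 ≤ S := hs0.trans hSj
    have hκ : ∫⁻ u, ‖‖L j u‖ * ‖u‖‖ₑ ≤ ENNReal.ofReal (c * (R * lam ^ j)⁻¹) := by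
      simp_rw [enorm_mul, enorm_norm]
      rw [ENNReal.ofReal_mul c.coe_nonneg, ENNReal.ofReal_coe_nnreal]
      exact hL3 j
    have hκi : Integrable fun u => ‖L j u‖ * ‖u‖ :=
      ⟨Continuous.aestronglyMeasurable (by have := (L j).continuous; fun_prop),
        hκ.trans_lt ENNReal.ofReal_lt_top⟩
    have hκ' : ∫ u, ‖L j u‖ * ‖u‖ ≤ c * (R * lam ^ j)⁻¹ := by
      have h1 := ENNReal.toReal_mono ENNReal.ofReal_ne_top hκ
      rw [ENNReal.toReal_ofReal (by have := hρ j; positivity)] at h1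
      refine le_trans (le_of_eq ?_) h1
      rw [← integral_norm_eq_lintegral_enorm hκi.1]
      simp
    have hlin := abs_integral_dualityMap_mul_le hr (hFc j) (hhc j) (hFm j) (hmem j) (L j) (hL0 j)
      (hrep j) (η := c * (R * lam ^ j) * b j) (by have := hρ j; have := hb0 j; positivity)
      (hmodF j) hκi hκ'
    have hstep := lrNorm_add_rpow_le hr (hFm j) (hmem j) (hFc j) (hhc j)
    rw [← hFs j] at hstep
    have h1 : (2 * lrNorm r volume (F j)) ^ (r - 2) ≤ 2 ^ (r - 2) * S ^ (r - 2) := by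
      rw [← Real.mul_rpow two_pos.le hS0]
      exact Real.rpow_le_rpow (by positivity) (by linarith) (by linarith)
    have h2 : (lrNorm r volume (F (j + 1)) + lrNorm r volume (F j)) ^ (r - 2) ≤
        2 ^ (r - 2) * S ^ (r - 2) := by
      rw [← Real.mul_rpow two_pos.le hS0]
      exact Real.rpow_le_rpow (by positivity) (by linarith) (by linarith)
    have hbj := hb0 j
    have htj := ht j
    have h3 : ‖∫ x, dualityMap r (F j x) * h j x‖ ≤
        (r - 1) * (2 ^ (r - 2) * S ^ (r - 2)) * (c * c) * (b j * t j) := by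
      refine hlin.trans ?_
      have hne := (hρ j).ne'
      -- The frequency R lam^j from the modulus of continuity of F_j cancels the inverse frequency
      -- from the first moment of the kernel, so the constant depends on neither R nor j.
      calc _ = (r - 1) * (2 * lrNorm r volume (F j)) ^ (r - 2) * (c * c) * (b j * t j) *
            ((R * lam ^ j) * (R * lam ^ j)⁻¹) := by ring
        _ ≤ _ := by
          rw [mul_inv_cancel₀ hne, mul_one]
          gcongr
    have h4 : (lrNorm r volume (F (j + 1)) + lrNorm r volume (F j)) ^ (r - 2) * t j * t j ≤
        2 ^ (r - 2) * S ^ (r - 2) * (t j * t j) := by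
      rw [mul_assoc]; gcongr
    have h5 : 0 ≤ r * (r - 1) * (2 ^ (r - 2) * S ^ (r - 2)) := by positivity
    calc _ ≤ _ := hstep
      _ ≤ lrNorm r volume (F j) ^ r +
          r * ((r - 1) * (2 ^ (r - 2) * S ^ (r - 2)) * (c * c) * (b j * t j)) +
          r * (r - 1) * (2 ^ (r - 2) * S ^ (r - 2) * (t j * t j)) := by gcongr
      _ = lrNorm r volume (F j) ^ r + r * (r - 1) * (2 ^ (r - 2) * S ^ (r - 2)) *
          (c * c * (b j * t j) + t j * t j) := by ring
      _ ≤ lrNorm r volume (F j) ^ r + r * (r - 1) * (2 ^ (r - 2) * S ^ (r - 2)) *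
          ((c * c + 1) * (b j * t j + t j * t j)) := by
        gcongr
        have hcc : (0 : ℝ) ≤ c * c := by positivity
        have : 0 ≤ b j * t j := by positivity
        have : 0 ≤ c * c * (t j * t j) := by positivity
        nlinarith
      _ = _ := by unfold lpStepConst; ring

/-- The upper Littlewood–Paley (Besov) inequality `‖∑ h_i‖_r² ≤ K ∑ ‖h_i‖_r²`, `r ≥ 2`, for
functions `h_i` with frequencies in the annuli `R λ^i ≤ |ξ| ≤ R λ^(i+1)`. -/
theorem exists_eLpNorm_sum_sq_le (V : Type*) [NormedAddCommGroup V] [InnerProductSpace ℝ V]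
    [FiniteDimensional ℝ V] [MeasurableSpace V] [BorelSpace V] {r lam : ℝ} (hr : 2 ≤ r)
    (hlam : 1 < lam) :
    ∃ K : ℝ≥0, ∀ R : ℝ, 0 < R → ∀ (n : ℕ) (a : ℕ → V → ℂ), (∀ i, Integrable (a i)) →
      (∀ i ξ, a i ξ ≠ 0 → R * lam ^ i ≤ ‖ξ‖ ∧ ‖ξ‖ ≤ R * lam ^ (i + 1)) →
      eLpNorm (fun x => ∑ i ∈ Finset.range n, expFourierInv (a i) x) (ENNReal.ofReal r) volume ^ 2 ≤
        K * ∑ i ∈ Finset.range n,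
          eLpNorm (expFourierInv (a i)) (ENNReal.ofReal r) volume ^ 2 := by
  obtain ⟨c, hc⟩ := exists_annular_kernel (V := V) one_pos (show 0 < lam by linarith)
  set C := lpStepConst r c * (2 + 1 / (1 - lam⁻¹) ^ 2) with hC
  have hC0 : 0 ≤ C := by
    have : 0 ≤ r - 1 := by linarith
    unfold C lpStepConst
    positivity
  refine ⟨C.toNNReal + 1, fun R hR n a ha hsupp => ?_⟩
  -- If some piece has infinite norm the right side is infinite; the constant was enlarged by one so
  -- that this also works when C = 0.
  by_cases htop : ∃ i ∈ Finset.range n, eLpNorm (expFourierInv (a i)) (ENNReal.ofReal r) volume = ⊤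
  · obtain ⟨i, hi, hit⟩ := htop
    have : ∑ i ∈ Finset.range n, eLpNorm (expFourierInv (a i)) (ENNReal.ofReal r) volume ^ 2 = ⊤ :=
      ENNReal.sum_eq_top.2 ⟨i, hi, by simp [hit]⟩
    rw [this, ENNReal.mul_top (by simp)]
    exact le_top
  push Not at htop
  let a' : ℕ → V → ℂ := fun i => if i < n then a i else 0
  have ha'e : ∀ i ∈ Finset.range n, a' i = a i := fun i hi => if_pos (Finset.mem_range.1 hi)
  have ha'0 : ∀ i, ¬ i < n → a' i = 0 := fun i hi => if_neg hi
  have ha' : ∀ i, Integrable (a' i) := fun i => by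
    by_cases hi : i < n
    · rw [ha'e i (Finset.mem_range.2 hi)]; exact ha i
    · rw [ha'0 i hi]; exact integrable_zero _ _ _
  have hsupp' : ∀ i ξ, a' i ξ ≠ 0 → R * lam ^ i ≤ ‖ξ‖ ∧ ‖ξ‖ ≤ R * lam ^ (i + 1) := fun i ξ h => by
    by_cases hi : i < n
    · rw [ha'e i (Finset.mem_range.2 hi)] at h; exact hsupp i ξ h
    · rw [ha'0 i hi] at h; exact absurd rfl h
  have hmem : ∀ i, MemLp (expFourierInv (a' i)) (ENNReal.ofReal r) volume := fun i => by
    refine ⟨(continuous_expFourierInv (ha' i)).aestronglyMeasurable, ?_⟩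
    by_cases hi : i < n
    · rw [ha'e i (Finset.mem_range.2 hi)]; exact (htop i (Finset.mem_range.2 hi)).lt_top
    · have : expFourierInv (a' i) = 0 := by
        rw [ha'0 i hi]; ext x; simp [expFourierInv]
      rw [this]; simp
  have key := lrNorm_sum_sq_le hr hlam hc hR n ha' hsupp' hmem
  have e1 : (fun x => ∑ i ∈ Finset.range n, expFourierInv (a' i) x) =
      fun x => ∑ i ∈ Finset.range n, expFourierInv (a i) x := by
    ext x; exact Finset.sum_congr rfl fun i hi => by rw [ha'e i hi]
  have hofReal : ∀ {f : V → ℂ}, MemLp f (ENNReal.ofReal r) volume →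
      eLpNorm f (ENNReal.ofReal r) volume ^ 2 = ENNReal.ofReal (lrNorm r volume f ^ 2) :=
    fun hf => by
      rw [lrNorm, ENNReal.ofReal_pow ENNReal.toReal_nonneg, ENNReal.ofReal_toReal hf.2.ne]
  have hm : MemLp (fun x => ∑ i ∈ Finset.range n, expFourierInv (a' i) x) (ENNReal.ofReal r)
      volume := memLp_finsetSum _ fun i _ => hmem i
  have e2 : ∑ i ∈ Finset.range n, eLpNorm (expFourierInv (a i)) (ENNReal.ofReal r) volume ^ 2 =
      ENNReal.ofReal (∑ i ∈ Finset.range n, lrNorm r volume (expFourierInv (a' i)) ^ 2) := by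
    rw [ENNReal.ofReal_sum_of_nonneg fun i _ => sq_nonneg _]
    exact Finset.sum_congr rfl fun i hi => by rw [← hofReal (hmem i), ha'e i hi]
  rw [← e1, hofReal hm, e2]
  refine (ENNReal.ofReal_le_ofReal key).trans ?_
  rw [← hC, ENNReal.ofReal_mul hC0]
  gcongr
  rw [ENNReal.coe_add]
  exact le_self_add

end LittlewoodPaley

/-! ### Slicing the sphere by parallel hyperplanes -/

section SphereSlices

/-- Integration in polar coordinates of a function which is homogeneous of degree zero in the unit
ball and vanishes outside it. -/
theorem lintegral_sphere_eq {m : ℕ} {F : Space (m + 1) → ℝ≥0∞} (hF : Measurable F)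
    {f : Velocity (m + 1) → ℝ≥0∞} (hf : Measurable f)
    (h : ∀ (v : Velocity (m + 1)) (ρ : ℝ), 0 < ρ → F (ρ • (v : Space (m + 1))) =
      if ρ < 1 then f v else 0) :
    ∫⁻ v, f v ∂(sphereMeasure (m + 1)) = (m + 1 : ℝ≥0∞) * ∫⁻ x, F x := by
  set e := homeomorphUnitSphereProd (Space (m + 1))
  have hmp := (volume : Measure (Space (m + 1))).measurePreserving_homeomorphUnitSphereProd
  rw [finrank_euclideanSpace_fin, Nat.add_sub_cancel] at hmp
  have hsub : ∀ x : ({0}ᶜ : Set (Space (m + 1))), F x =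
      (fun p : Velocity (m + 1) × Set.Ioi (0 : ℝ) => F (p.2.1 • (p.1 : Space (m + 1)))) (e x) := by
    intro x
    have : (e.symm (e x) : Space (m + 1)) = x := by rw [e.symm_apply_apply]
    rw [homeomorphUnitSphereProd_symm_apply_coe] at this
    simp only
    rw [this]
  have h1 : ∫⁻ x, F x = ∫⁻ p : Velocity (m + 1) × Set.Ioi (0 : ℝ),
      F (p.2.1 • (p.1 : Space (m + 1))) ∂((volume : Measure (Space (m + 1))).toSphere.prod
        (Measure.volumeIoiPow m)) := by
    rw [← hmp.lintegral_comp (by fun_prop)]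
    have h2 : ∫⁻ x, F x = ∫⁻ x in ({0}ᶜ : Set (Space (m + 1))), F x := by
      rw [restrict_compl_singleton]
    rw [h2, ← lintegral_subtype_comap (measurableSet_singleton _).compl]
    exact lintegral_congr hsub
  have h3 : ∀ p : Velocity (m + 1) × Set.Ioi (0 : ℝ), F (p.2.1 • (p.1 : Space (m + 1))) =
      f p.1 * (Set.Iio (⟨1, Set.mem_Ioi.2 one_pos⟩ : Set.Ioi (0 : ℝ))).indicator 1 p.2 := by
    intro p
    rw [h p.1 p.2.1 p.2.2]
    by_cases hp : p.2.1 < 1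
    · rw [if_pos hp, Set.indicator_of_mem (show p.2 ∈ Set.Iio (⟨1, Set.mem_Ioi.2 one_pos⟩ : Set.Ioi (0 : ℝ)) from hp)]
      simp
    · rw [if_neg hp, Set.indicator_of_notMem
        (show p.2 ∉ Set.Iio (⟨1, Set.mem_Ioi.2 one_pos⟩ : Set.Ioi (0 : ℝ)) from hp)]
      simp
  simp_rw [h3] at h1
  rw [lintegral_prod_mul hf.aemeasurable (measurable_one.indicator measurableSet_Iio).aemeasurable,
    lintegral_indicator_one measurableSet_Iio, Measure.volumeIoiPow_apply_Iio] at h1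
  rw [h1, mul_left_comm]
  have h4 : (m + 1 : ℝ≥0∞) * ENNReal.ofReal (1 ^ (m + 1) / (m + 1)) = 1 := by
    rw [show (m + 1 : ℝ≥0∞) = ENNReal.ofReal (m + 1) by
      rw [ENNReal.ofReal_add (by positivity) zero_le_one]; simp, ← ENNReal.ofReal_mul (by positivity)]
    rw [one_pow, mul_one_div_cancel (by positivity), ENNReal.ofReal_one]
  rw [h4, mul_one]
  rfl

/-- Any linear isometry, followed by the reflection exchanging the image of `e` with the last unit
vector, which has the same norm. -/
theorem exists_isometry_spaceTime (m : ℕ) {e : Space (m + 1)} (he : ‖e‖ = 1) :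
    ∃ J : Space (m + 1) ≃ₗᵢ[ℝ] SpaceTime m, J e = WithLp.toLp 2 (0, 1) := by
  let b := (stdOrthonormalBasis ℝ (SpaceTime m)).reindex (finCongr (finrank_spaceTime m))
  let J₀ : Space (m + 1) ≃ₗᵢ[ℝ] SpaceTime m := b.repr.symm
  have hn : ‖J₀ e‖ = ‖(WithLp.toLp 2 (0, 1) : SpaceTime m)‖ := by
    rw [LinearIsometryEquiv.norm_map, he, WithLp.prod_norm_eq_of_L2]
    simp
  exact ⟨J₀.trans (Submodule.reflection _), Submodule.reflection_sub hn⟩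

/-- The substitution `s = R u / √(1 - u²)`. -/
theorem lintegral_slope_substitution {R : ℝ} (hR : 0 < R) (f : ℝ → ℝ≥0∞) :
    ∫⁻ s, f s = ∫⁻ u in Set.Ioo (-1 : ℝ) 1,
      ENNReal.ofReal (R * (1 - u ^ 2) ^ (-(3 / 2) : ℝ)) * f (R * u * (1 - u ^ 2) ^ (-(1 / 2) : ℝ)) := by
  set T : ℝ → ℝ := fun u => R * u * (1 - u ^ 2) ^ (-(1 / 2) : ℝ) with hT
  have hpos : ∀ u ∈ Set.Ioo (-1 : ℝ) 1, 0 < 1 - u ^ 2 := fun u hu => by nlinarith [hu.1, hu.2]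
  -- The explicit inverse s ↦ s/√(s² + R²) yields injectivity here and surjectivity below.
  have hinv : ∀ u ∈ Set.Ioo (-1 : ℝ) 1, T u / √(T u ^ 2 + R ^ 2) = u := by
    intro u hu
    have h0 := hpos u hu
    have e1 : T u ^ 2 + R ^ 2 = (R * (1 - u ^ 2) ^ (-(1 / 2) : ℝ)) ^ 2 := by
      have e2 : ((1 - u ^ 2) ^ (-(1 / 2) : ℝ)) ^ 2 * (1 - u ^ 2) = 1 := by
        rw [← Real.rpow_natCast, ← Real.rpow_mul h0.le, ← Real.rpow_add_one h0.ne']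
        norm_num
      rw [hT]; simp only
      linear_combination (-R ^ 2) * e2
    have h1 : 0 < (1 - u ^ 2) ^ (-(1 / 2) : ℝ) := Real.rpow_pos_of_pos h0 _
    rw [e1, Real.sqrt_sq (by positivity), hT]
    field_simp
  have himage : T '' Set.Ioo (-1 : ℝ) 1 = Set.univ := by
    refine Set.eq_univ_of_forall fun s => ?_
    have hD : 0 < s ^ 2 + R ^ 2 := by positivity
    have hsD : 0 < √(s ^ 2 + R ^ 2) := Real.sqrt_pos.2 hD
    have hlt : |s| < √(s ^ 2 + R ^ 2) := by
      rw [← Real.sqrt_sq_eq_abs]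
      exact Real.sqrt_lt_sqrt (sq_nonneg _) (by nlinarith [sq_pos_of_pos hR])
    have hsq : √(s ^ 2 + R ^ 2) ^ 2 = s ^ 2 + R ^ 2 := Real.sq_sqrt hD.le
    refine ⟨s / √(s ^ 2 + R ^ 2), ?_, ?_⟩
    · refine abs_lt.1 ?_
      rw [abs_div, abs_of_pos hsD, div_lt_one hsD]
      exact hlt
    · have e1 : 1 - (s / √(s ^ 2 + R ^ 2)) ^ 2 = R ^ 2 / (s ^ 2 + R ^ 2) := by
        rw [div_pow, hsq]; field_simp; ring
      rw [hT]; simp only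
      rw [e1, Real.rpow_neg (by positivity), ← Real.sqrt_eq_rpow, Real.sqrt_div' _ hD.le,
        Real.sqrt_sq hR.le]
      field_simp
  have hderiv : ∀ u ∈ Set.Ioo (-1 : ℝ) 1,
      HasDerivWithinAt T (R * (1 - u ^ 2) ^ (-(3 / 2) : ℝ)) (Set.Ioo (-1 : ℝ) 1) u := by
    intro u hu
    have h0 := hpos u hu
    have h1 : HasDerivAt (fun u : ℝ => 1 - u ^ 2) (-(2 * u)) u := by
      simpa using (hasDerivAt_pow 2 u).const_sub 1
    have h2 := h1.rpow_const (p := (-(1 / 2) : ℝ)) (Or.inl h0.ne')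
    have h3 := ((hasDerivAt_id u).const_mul R).mul h2
    refine (h3.congr_deriv ?_).hasDerivWithinAt
    have e1 : (1 - u ^ 2) ^ (-(1 / 2) : ℝ) = (1 - u ^ 2) ^ (-(3 / 2) : ℝ) * (1 - u ^ 2) := by
      rw [← Real.rpow_add_one h0.ne']; norm_num
    have e2 : (-(1 / 2) - 1 : ℝ) = -(3 / 2) := by norm_num
    simp only [id]
    rw [e2, e1]; ring
  have hinj : Set.InjOn T (Set.Ioo (-1 : ℝ) 1) := fun u hu w hw huw => by
    rw [← hinv u hu, huw, hinv w hw]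
  have key := lintegral_image_eq_lintegral_abs_deriv_mul measurableSet_Ioo hderiv hinj f
  rw [himage, setLIntegral_univ] at key
  rw [key]
  refine setLIntegral_congr_fun measurableSet_Ioo fun u hu => ?_
  have : 0 < (1 - u ^ 2) ^ (-(3 / 2) : ℝ) := Real.rpow_pos_of_pos (hpos u hu) _
  rw [abs_of_pos (by positivity)]

/-- The first moment of the unit ball. -/
def ballMoment (m : ℕ) : ℝ≥0∞ := ∫⁻ y : Space m in Metric.ball 0 1, ENNReal.ofReal ‖y‖

theorem ballMoment_ne_top (m : ℕ) : ballMoment m ≠ ⊤ := by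
  refine ne_top_of_le_ne_top (measure_ball_lt_top (μ := (volume : Measure (Space m))) (x := 0)
    (r := 1)).ne ?_
  rw [ballMoment, ← setLIntegral_one]
  refine setLIntegral_mono measurable_const fun y hy => ?_
  rw [ENNReal.ofReal_le_one]
  exact (mem_ball_zero_iff.1 hy).le

theorem ballMoment_ne_zero {m : ℕ} (hm : 1 ≤ m) : ballMoment m ≠ 0 := by
  have : Nonempty (Fin m) := ⟨⟨0, hm⟩⟩
  rw [ballMoment, ← pos_iff_ne_zero, setLIntegral_pos_iff (by fun_prop)]
  have h1 : Metric.ball (0 : Space m) 1 \ {0} ⊆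
      (Function.support fun y : Space m => ENNReal.ofReal ‖y‖) ∩ Metric.ball 0 1 := by
    intro y hy
    refine ⟨?_, hy.1⟩
    rw [Function.mem_support, ne_eq, ENNReal.ofReal_eq_zero, not_le]
    exact norm_pos_iff.2 hy.2
  refine lt_of_lt_of_le ?_ (measure_mono h1)
  rw [measure_sdiff_null (measure_singleton _)]
  exact Metric.measure_ball_pos _ _ one_pos

theorem lintegral_ball_norm {m : ℕ} {c : ℝ} (hc : 0 < c) :
    ∫⁻ y : Space m in Metric.ball 0 c, ENNReal.ofReal ‖y‖ =
      ENNReal.ofReal (c ^ (m + 1)) * ballMoment m := by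
  have h := lintegral_comp_smul (volume : Measure (Space m))
    ((Metric.ball 0 c).indicator fun y => ENNReal.ofReal ‖y‖) hc
  rw [lintegral_indicator measurableSet_ball, finrank_euclideanSpace_fin] at h
  have h1 : ∀ y : Space m, (Metric.ball 0 c).indicator (fun y => ENNReal.ofReal ‖y‖) (c • y) =
      ENNReal.ofReal c * (Metric.ball 0 1).indicator (fun y => ENNReal.ofReal ‖y‖) y := by
    intro y
    have hn : ‖c • y‖ = c * ‖y‖ := by rw [norm_smul, Real.norm_of_nonneg hc.le]
    by_cases hy : ‖y‖ < 1
    · rw [Set.indicator_of_mem (by rw [mem_ball_zero_iff, hn]; nlinarith),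
        Set.indicator_of_mem (by simpa using hy), hn, ENNReal.ofReal_mul hc.le]
    · rw [Set.indicator_of_notMem (by rw [mem_ball_zero_iff, hn]; nlinarith),
        Set.indicator_of_notMem (by simpa using hy), mul_zero]
  simp_rw [h1] at h
  rw [lintegral_const_mul' _ _ ENNReal.ofReal_ne_top, lintegral_indicator measurableSet_ball] at h
  change ENNReal.ofReal c * ballMoment m = _ at h
  have h2 : ENNReal.ofReal (c ^ m) * ENNReal.ofReal ((c ^ m)⁻¹) = 1 := by
    rw [← ENNReal.ofReal_mul (by positivity), mul_inv_cancel₀ (by positivity), ENNReal.ofReal_one]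
  rw [pow_succ, ENNReal.ofReal_mul (by positivity), mul_assoc, h, ← mul_assoc, h2, one_mul]

/-- Slicing the sphere `𝕊^m ⊂ ℝ^(m+1)` by hyperplanes orthogonal to a unit vector. -/
theorem lintegral_sphere_inner {m : ℕ} (hm : 1 ≤ m) {e : Space (m + 1)} (he : ‖e‖ = 1) {g : ℝ → ℝ≥0∞}
    (hg : Measurable g) :
    ∫⁻ v : Velocity (m + 1), g (inner ℝ (v : Space (m + 1)) e) ∂(sphereMeasure (m + 1)) =
      (m + 1 : ℝ≥0∞) * ballMoment m *
        ∫⁻ u in Set.Ioo (-1 : ℝ) 1, ENNReal.ofReal ((1 - u ^ 2) ^ (((m : ℝ) - 2) / 2)) * g u := by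
  obtain ⟨J, hJ⟩ := exists_isometry_spaceTime m he
  -- the degree zero extension, in the coordinates of `J`
  let F₀ : SpaceTime m → ℝ≥0∞ := fun z => if ‖z‖ < 1 then g (z.snd / ‖z‖) else 0
  have hF₀ : Measurable F₀ :=
    Measurable.ite (measurableSet_lt measurable_norm measurable_const)
      (hg.comp (measurable_snd_spaceTime.div measurable_norm)) measurable_const
  have hsnd : ∀ x, (J x).snd = inner ℝ x e := by
    intro x
    rw [← J.inner_map_map, hJ, WithLp.prod_inner_apply]
    simp
  have h1 := lintegral_sphere_eq (m := m) (F := F₀ ∘ J) (hF₀.comp J.continuous.measurable)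
    (f := fun v => g (inner ℝ (v : Space (m + 1)) e)) (by fun_prop) (by
      intro v ρ hρ
      have hv : ‖(v : Space (m + 1))‖ = 1 := mem_sphere_zero_iff_norm.1 v.2
      have hn : ‖J (ρ • (v : Space (m + 1)))‖ = ρ := by
        rw [LinearIsometryEquiv.norm_map, norm_smul, hv, Real.norm_of_nonneg hρ.le, mul_one]
      simp only [Function.comp, F₀]
      rw [hn, hsnd, inner_smul_left]
      simp [hρ.ne'])
  rw [h1, mul_assoc]
  congr 1
  have h2 : ∫⁻ x, (F₀ ∘ J) x = ∫⁻ z, F₀ z := J.measurePreserving.lintegral_comp hF₀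
  rw [h2, lintegral_spaceTime hF₀.aemeasurable]
  have hF₀' : Measurable fun p : ℝ × Space m => F₀ (WithLp.toLp 2 (p.2, p.1)) :=
    hF₀.comp (measurePreserving_toLp_swap m).measurable
  -- For fixed y the height s is integrated first. In the substitution s = ‖y‖ u/√(1 - u²) the
  -- variable u is the normalised height s/‖z‖ with z = (y, s), and ‖z‖ < 1 becomes ‖y‖ < √(1 - u²).
  rw [lintegral_lintegral_swap hF₀'.aemeasurable]
  have hpos : ∀ u ∈ Set.Ioo (-1 : ℝ) 1, 0 < 1 - u ^ 2 := fun u hu => by nlinarith [hu.1, hu.2]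
  have : Nonempty (Fin m) := ⟨⟨0, hm⟩⟩
  have h3 : ∀ᵐ y : Space m, ∫⁻ s : ℝ, F₀ (WithLp.toLp 2 (y, s)) =
      ∫⁻ u in Set.Ioo (-1 : ℝ) 1, ENNReal.ofReal ((1 - u ^ 2) ^ (-(3 / 2) : ℝ)) * g u *
        (if ‖y‖ < √(1 - u ^ 2) then ENNReal.ofReal ‖y‖ else 0) := by
    have hne : ∀ᵐ y : Space m, y ≠ 0 := by
      rw [ae_iff]; simp
    filter_upwards [hne] with y hy
    have hR : 0 < ‖y‖ := norm_pos_iff.2 hy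
    rw [lintegral_slope_substitution hR]
    refine setLIntegral_congr_fun measurableSet_Ioo fun u hu => ?_
    have h0 := hpos u hu
    set w := √(1 - u ^ 2) with hw
    have hw0 : 0 < w := Real.sqrt_pos.2 h0
    have hw2 : w ^ 2 = 1 - u ^ 2 := Real.sq_sqrt h0.le
    have e1 : (1 - u ^ 2) ^ (-(1 / 2) : ℝ) = w⁻¹ := by
      rw [Real.rpow_neg h0.le, ← Real.sqrt_eq_rpow]
    have hn : ‖(WithLp.toLp 2 (y, ‖y‖ * u * w⁻¹) : SpaceTime m)‖ = ‖y‖ / w := by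
      rw [WithLp.prod_norm_eq_of_L2]
      simp only [Real.norm_eq_abs, sq_abs]
      rw [← Real.sqrt_sq (show 0 ≤ ‖y‖ / w by positivity)]
      congr 1
      change ‖y‖ ^ 2 + (‖y‖ * u * w⁻¹) ^ 2 = _
      field_simp
      rw [hw2]; ring
    have h3 : 0 < (1 - u ^ 2) ^ (-(3 / 2) : ℝ) := Real.rpow_pos_of_pos h0 _
    rw [e1]
    simp only [F₀]
    simp only [hn, div_lt_one hw0]
    rw [ENNReal.ofReal_mul hR.le]
    split_ifs with hlt
    · change _ * g (‖y‖ * u * w⁻¹ / (‖y‖ / w)) = _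
      have e2 : ‖y‖ * u * w⁻¹ / (‖y‖ / w) = u := by field_simp
      rw [e2]; ring
    · simp
  rw [lintegral_congr_ae h3, lintegral_lintegral_swap]
  · rw [← lintegral_const_mul _ (by fun_prop)]
    refine setLIntegral_congr_fun measurableSet_Ioo fun u hu => ?_
    beta_reduce
    have h0 := hpos u hu
    have e1 : ∀ y : Space m, (if ‖y‖ < √(1 - u ^ 2) then ENNReal.ofReal ‖y‖ else 0) =
        (Metric.ball 0 (√(1 - u ^ 2))).indicator (fun y => ENNReal.ofReal ‖y‖) y := fun y => by
      split_ifs with h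
      · rw [Set.indicator_of_mem (mem_ball_zero_iff.2 h)]
      · rw [Set.indicator_of_notMem (fun h' => h (mem_ball_zero_iff.1 h'))]
    simp_rw [e1]
    rw [lintegral_const_mul _ ((by fun_prop : Measurable fun y : Space m =>
        ENNReal.ofReal ‖y‖).indicator measurableSet_ball), lintegral_indicator measurableSet_ball,
      lintegral_ball_norm (Real.sqrt_pos.2 h0)]
    -- The Jacobian contributes the exponent -3/2 and the integral of ‖y‖ over the ball of radius
    -- √(1 - u²) contributes (m+1)/2.
    have e2 : ENNReal.ofReal ((1 - u ^ 2) ^ (((m : ℝ) - 2) / 2)) =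
        ENNReal.ofReal ((1 - u ^ 2) ^ (-(3 / 2) : ℝ)) * ENNReal.ofReal (√(1 - u ^ 2) ^ (m + 1)) := by
      rw [← ENNReal.ofReal_mul (Real.rpow_nonneg h0.le _), Real.sqrt_eq_rpow,
        ← Real.rpow_natCast ((1 - u ^ 2) ^ (1 / 2 : ℝ)), ← Real.rpow_mul h0.le, ← Real.rpow_add h0]
      congr 2; push_cast; ring
    rw [e2]; ring
  · refine Measurable.aemeasurable ?_
    refine Measurable.mul (by fun_prop) (Measurable.ite (measurableSet_lt ?_ ?_) ?_ ?_) <;> fun_prop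

end SphereSlices

/-! ### The cone density, and pairing velocity averages with Schwartz functions -/

section VelocityPairing

variable {d : ℕ}

instance (d : ℕ) : IsFiniteMeasure (sphereMeasure d) := by
  unfold sphereMeasure; infer_instance

instance (d : ℕ) : SFinite (phaseMeasure d) := by
  unfold phaseMeasure; infer_instance

/-- The density of the image of `dξ dσ(v)` under `(ξ, v) ↦ (ξ, -v·ξ)`. -/
def coneDensity (d : ℕ) (ζ : SpaceTime d) : ℝ :=
  if |ζ.snd| < ‖ζ.fst‖ then
    (d * ballMoment (d - 1)).toReal *
      (‖ζ.fst‖⁻¹ * (1 - ζ.snd ^ 2 / ‖ζ.fst‖ ^ 2) ^ (((d : ℝ) - 3) / 2))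
  else 0

theorem one_sub_div_sq_pos {a b : ℝ} (h : |a| < b) : 0 < 1 - a ^ 2 / b ^ 2 := by
  have hb : 0 < b := (abs_nonneg a).trans_lt h
  rw [sub_pos, div_lt_one (by positivity)]
  exact sq_lt_sq.2 (by rwa [abs_of_pos hb])

theorem coneDensity_nonneg (ζ : SpaceTime d) : 0 ≤ coneDensity d ζ := by
  unfold coneDensity
  split_ifs with h
  · have := one_sub_div_sq_pos h
    positivity
  · exact le_rfl

theorem measurable_coneDensity : Measurable (coneDensity d) := by
  have h1 := measurable_fst_spaceTime (d := d)
  have h2 := measurable_snd_spaceTime (d := d)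
  unfold coneDensity
  refine Measurable.ite (measurableSet_lt ?_ ?_) ?_ measurable_const
  · exact h2.norm
  · exact h1.norm
  · fun_prop

/-- The map `ξ ↦ (ξ, -v·ξ)` as a continuous linear map. -/
def sliceMap (v : Space d) : Space d →L[ℝ] SpaceTime d :=
  (WithLp.prodContinuousLinearEquiv 2 ℝ (Space d) ℝ).symm.toContinuousLinearMap ∘L
    (ContinuousLinearMap.id ℝ (Space d)).prod (-(innerSL ℝ v))

theorem sliceMap_apply (v ξ : Space d) : sliceMap v ξ = WithLp.toLp 2 (ξ, -inner ℝ v ξ) := rfl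

/-- The image of `dξ dσ(v)` under `(ξ, v) ↦ (ξ, -v·ξ)` has density `coneDensity`. -/
theorem lintegral_sliceMap (hd : 2 ≤ d) {h : SpaceTime d → ℝ≥0∞} (hh : Measurable h) :
    ∫⁻ ξ : Space d, ∫⁻ v : Velocity d, h (sliceMap (v : Space d) ξ) ∂(sphereMeasure d) =
      ∫⁻ ζ, ENNReal.ofReal (coneDensity d ζ) * h ζ := by
  obtain ⟨m, rfl⟩ : ∃ m, d = m + 1 := ⟨d - 1, by omega⟩
  have hm : 1 ≤ m := by omega
  have hκh : Measurable fun ζ => ENNReal.ofReal (coneDensity (m + 1) ζ) * h ζ :=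
    measurable_coneDensity.ennreal_ofReal.mul hh
  have hsw := lintegral_lintegral_swap
    (f := fun (t : ℝ) (x : Space (m + 1)) =>
      ENNReal.ofReal (coneDensity (m + 1) (WithLp.toLp 2 (x, t))) * h (WithLp.toLp 2 (x, t)))
    (μ := volume) (ν := volume)
    (hκh.comp (measurePreserving_toLp_swap (m + 1)).measurable).aemeasurable
  rw [lintegral_spaceTime hκh.aemeasurable, hsw]
  have hne : ∀ᵐ ξ : Space (m + 1), ξ ≠ 0 := by
    rw [ae_iff]; simp
  refine lintegral_congr_ae ?_
  filter_upwards [hne] with ξ hξ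
  have hR : 0 < ‖ξ‖ := norm_pos_iff.2 hξ
  set R := ‖ξ‖ with hRdef
  -- The sphere is sliced along -ξ/|ξ|, so that the slice variable u satisfies R u = -v·ξ = τ.
  have he : ‖(-R⁻¹) • ξ‖ = 1 := by
    rw [norm_smul, norm_neg, Real.norm_of_nonneg (by positivity), inv_mul_cancel₀ hR.ne']
  have hsec : Measurable fun τ : ℝ => h (WithLp.toLp 2 (ξ, τ)) :=
    hh.comp ((WithLp.measurable_toLp 2 (Space (m + 1) × ℝ)).comp measurable_prodMk_left)
  have h1 := lintegral_sphere_inner hm he (g := fun u => h (WithLp.toLp 2 (ξ, R * u)))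
    (hsec.comp (measurable_const_mul R))
  have e1 : ∀ v : Velocity (m + 1), R * inner ℝ (v : Space (m + 1)) ((-R⁻¹) • ξ) =
      -inner ℝ (v : Space (m + 1)) ξ := fun v => by
    rw [inner_smul_right]; field_simp
  simp_rw [e1] at h1
  simp_rw [sliceMap_apply]
  rw [h1]
  -- rescale the frequency variable
  have h2 := lintegral_comp_smul (volume : Measure ℝ) (fun τ =>
    ENNReal.ofReal (coneDensity (m + 1) (WithLp.toLp 2 (ξ, τ))) * h (WithLp.toLp 2 (ξ, τ))) hR
  rw [Module.finrank_self, pow_one] at h2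
  have hRR : ENNReal.ofReal R * ENNReal.ofReal R⁻¹ = 1 := by
    rw [← ENNReal.ofReal_mul hR.le, mul_inv_cancel₀ hR.ne', ENNReal.ofReal_one]
  have h3 : ∫⁻ τ : ℝ, ENNReal.ofReal (coneDensity (m + 1) (WithLp.toLp 2 (ξ, τ))) *
      h (WithLp.toLp 2 (ξ, τ)) = ENNReal.ofReal R * ∫⁻ u : ℝ,
        ENNReal.ofReal (coneDensity (m + 1) (WithLp.toLp 2 (ξ, R • u))) *
          h (WithLp.toLp 2 (ξ, R • u)) := by
    rw [h2, ← mul_assoc, hRR, one_mul]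
  have hfin : (m + 1 : ℝ≥0∞) * ballMoment m ≠ ⊤ :=
    ENNReal.mul_ne_top (by finiteness) (ballMoment_ne_top m)
  rw [h3, ← lintegral_const_mul' _ _ ENNReal.ofReal_ne_top, ← lintegral_const_mul' _ _ hfin,
    ← lintegral_indicator measurableSet_Ioo]
  refine lintegral_congr fun u => ?_
  by_cases hu : u ∈ Set.Ioo (-1 : ℝ) 1
  · rw [Set.indicator_of_mem hu]
    have hlt : |R * u| < R := by
      rw [abs_mul, abs_of_pos hR]
      have := abs_lt.2 hu
      nlinarith
    have e2 : coneDensity (m + 1) (WithLp.toLp 2 (ξ, R • u)) =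
        ((m + 1 : ℝ≥0∞) * ballMoment m).toReal * (R⁻¹ * (1 - u ^ 2) ^ (((m : ℝ) - 2) / 2)) := by
      have hlt' : |(WithLp.toLp 2 (ξ, R • u) : SpaceTime (m + 1)).snd| <
          ‖(WithLp.toLp 2 (ξ, R • u) : SpaceTime (m + 1)).fst‖ := hlt
      rw [coneDensity, if_pos hlt']
      have e3 : (R * u) ^ 2 / R ^ 2 = u ^ 2 := by field_simp
      change (((m + 1 : ℕ) : ℝ≥0∞) * ballMoment m).toReal *
        (R⁻¹ * (1 - (R * u) ^ 2 / R ^ 2) ^ ((((m + 1 : ℕ) : ℝ) - 3) / 2)) = _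
      rw [e3]
      push_cast
      congr 3
      ring
    have hu2 : 0 ≤ (1 - u ^ 2) ^ (((m : ℝ) - 2) / 2) :=
      Real.rpow_nonneg (by nlinarith [hu.1, hu.2]) _
    rw [e2, ENNReal.ofReal_mul ENNReal.toReal_nonneg, ENNReal.ofReal_toReal hfin,
      ENNReal.ofReal_mul (by positivity), smul_eq_mul]
    calc _ = (ENNReal.ofReal R * ENNReal.ofReal R⁻¹) * ((m + 1 : ℝ≥0∞) * ballMoment m *
          (ENNReal.ofReal ((1 - u ^ 2) ^ (((m : ℝ) - 2) / 2)) * h (WithLp.toLp 2 (ξ, R * u)))) := by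
          rw [hRR, one_mul]
      _ = _ := by ring
  · rw [Set.indicator_of_notMem hu]
    have hlt : ¬ |(WithLp.toLp 2 (ξ, R • u) : SpaceTime (m + 1)).snd| <
        ‖(WithLp.toLp 2 (ξ, R • u) : SpaceTime (m + 1)).fst‖ := by
      change ¬ |R * u| < R
      rw [abs_mul, abs_of_pos hR, not_lt]
      have : 1 ≤ |u| := by
        by_contra hcon
        exact hu (abs_lt.1 (not_le.1 hcon))
      nlinarith
    rw [coneDensity, if_neg hlt]
    simp

theorem exists_norm_schwartz_le_fst (ψ : 𝓢(SpaceTime d, ℂ)) :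
    ∃ C : ℝ≥0, ∀ z, ‖ψ z‖ ≤ C * (1 + ‖z.fst‖) ^ (-(d + 1 : ℝ)) := by
  obtain ⟨C, hC⟩ := exists_norm_schwartz_le_decayWeight ψ
  refine ⟨C, fun z => (hC z).trans ?_⟩
  unfold decayWeight
  have : (1 + ‖z.snd‖) ^ (-(2 : ℝ)) ≤ 1 :=
    Real.rpow_le_one_of_one_le_of_nonpos (by linarith [norm_nonneg z.snd]) (by norm_num)
  calc _ ≤ C * ((1 + ‖z.fst‖) ^ (-(d + 1 : ℝ)) * 1) := by gcongr
    _ = _ := by rw [mul_one]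

/-- Decay of a Schwartz function along the free transport flow. -/
theorem exists_norm_schwartz_transport_le (ψ : 𝓢(SpaceTime d, ℂ)) :
    ∃ C : ℝ≥0, ∀ (x : Space d) (v : Velocity d) (t : ℝ),
      ‖ψ (WithLp.toLp 2 (x + t • (v : Space d), t))‖ ≤
        C * ((1 + ‖t‖) ^ (-(2 : ℝ)) * (1 + ‖x‖) ^ (-(d + 1 : ℝ))) := by
  have h := SchwartzMap.one_add_le_sup_seminorm_apply (𝕜 := ℂ) (m := (d + 3, 0)) (k := d + 3)
    (n := 0) le_rfl le_rfl ψ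
  set C := 2 ^ (d + 3, 0).1 * ((Finset.Iic (d + 3, 0)).sup
    fun m : ℕ × ℕ => SchwartzMap.seminorm ℂ m.1 m.2) ψ
  have hC : 0 ≤ C := le_trans (by positivity) (h 0)
  refine ⟨⟨2 ^ (d + 3) * C, by positivity⟩, fun x v t => ?_⟩
  have hz := h (WithLp.toLp 2 (x + t • (v : Space d), t))
  rw [norm_iteratedFDeriv_zero] at hz
  set z : SpaceTime d := WithLp.toLp 2 (x + t • (v : Space d), t) with hzdef
  have h1 : ‖x + t • (v : Space d)‖ ≤ ‖z‖ := WithLp.norm_fst_le _ z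
  have h2 : ‖t‖ ≤ ‖z‖ := WithLp.norm_snd_le _ z
  have hv : ‖(v : Space d)‖ = 1 := mem_sphere_zero_iff_norm.1 v.2
  have h3 : ‖x‖ ≤ 2 * ‖z‖ := by
    have : x = (x + t • (v : Space d)) - t • (v : Space d) := by abel
    rw [this]
    refine (norm_sub_le _ _).trans ?_
    rw [norm_smul, hv, mul_one]
    linarith
  have hzn := norm_nonneg z
  have h4 : (1 + ‖x‖) ^ (d + 1) * (1 + ‖t‖) ^ 2 ≤ 2 ^ (d + 3) * (1 + ‖z‖) ^ (d + 3) := by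
    rw [← mul_pow, pow_add (2 * (1 + ‖z‖)) (d + 1) 2]
    gcongr <;> linarith
  have e : (1 + ‖t‖) ^ (-(2 : ℝ)) * (1 + ‖x‖) ^ (-(d + 1 : ℝ)) =
      ((1 + ‖x‖) ^ (d + 1) * (1 + ‖t‖) ^ 2)⁻¹ := by
    rw [Real.rpow_neg (by positivity), Real.rpow_neg (by positivity), mul_inv, mul_comm]
    norm_cast
  rw [e]
  change _ ≤ 2 ^ (d + 3) * C * _
  rw [← div_eq_mul_inv, le_div_iff₀ (by positivity), mul_comm]
  calc _ ≤ 2 ^ (d + 3) * (1 + ‖z‖) ^ (d + 3) * ‖ψ z‖ := by gcongr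
    _ = 2 ^ (d + 3) * ((1 + ‖z‖) ^ (d + 3) * ‖ψ z‖) := by ring
    _ ≤ _ := by gcongr

/-- Free transport preserves the measure on time and phase space. -/
theorem measurePreserving_transport (d : ℕ) :
    MeasurePreserving (fun p : ℝ × (Space d × Velocity d) =>
      (p.1, (p.2.1 - p.1 • (p.2.2 : Space d), p.2.2)))
      ((volume : Measure ℝ).prod (phaseMeasure d)) ((volume : Measure ℝ).prod (phaseMeasure d)) := by
  have hfix : ∀ t : ℝ, MeasurePreserving
      (fun p : Space d × Velocity d => (p.1 - t • (p.2 : Space d), p.2))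
      (phaseMeasure d) (phaseMeasure d) := by
    intro t
    have h1 : MeasurePreserving (fun p : Velocity d × Space d => (p.1, p.2 - t • (p.1 : Space d)))
        ((sphereMeasure d).prod volume) ((sphereMeasure d).prod volume) := by
      refine (MeasurePreserving.id _).skew_product (g := fun (v : Velocity d) (x : Space d) =>
        x - t • (v : Space d)) ?_ (Filter.Eventually.of_forall fun v => ?_)
      · exact Continuous.measurable (by fun_prop)
      · exact (measurePreserving_sub_right volume (t • (v : Space d))).map_eq
    exact (Measure.measurePreserving_swap.comp h1).comp Measure.measurePreserving_swap
  refine (MeasurePreserving.id _).skew_product (g := fun (t : ℝ) (p : Space d × Velocity d) =>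
    (p.1 - t • (p.2 : Space d), p.2)) ?_ (Filter.Eventually.of_forall fun t => (hfix t).map_eq)
  exact Continuous.measurable (by fun_prop)

theorem measurable_one_add_norm_rpow (d : ℕ) (s : ℝ) :
    Measurable fun p : Space d × Velocity d => (1 + ‖p.1‖) ^ s := by fun_prop

theorem memLp_two_spatialWeight (d : ℕ) :
    MemLp (fun p : Space d × Velocity d => (1 + ‖p.1‖) ^ (-(d + 1 : ℝ))) 2 (phaseMeasure d) := by
  rw [memLp_two_iff_integrable_sq (measurable_one_add_norm_rpow d _).aestronglyMeasurable]
  have h1 : Integrable (fun p : Space d × Velocity d => (1 + ‖p.1‖) ^ (-(d + 1 : ℝ)) * 1)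
      (phaseMeasure d) :=
    (integrable_one_add_norm (μ := (volume : Measure (Space d))) (by simp)).mul_prod
      (integrable_const (1 : ℝ))
  refine h1.mono' ((measurable_one_add_norm_rpow d _).pow_const 2).aestronglyMeasurable
    (Filter.Eventually.of_forall fun p => ?_)
  have h2 : (1 + ‖p.1‖) ^ (-(d + 1 : ℝ)) ≤ 1 :=
    Real.rpow_le_one_of_one_le_of_nonpos (by linarith [norm_nonneg p.1])
      (by have : (0 : ℝ) ≤ d := by positivity
          linarith)
  have h3 : 0 ≤ (1 + ‖p.1‖) ^ (-(d + 1 : ℝ)) := by positivity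
  rw [Real.norm_of_nonneg (by positivity), mul_one, sq]
  exact mul_le_of_le_one_right h3 h2

/-- Along the flow a Schwartz function is dominated by a product of decaying weights in t and x. The
weight in x is square integrable on phase space, so Cauchy–Schwarz pairs it with `f`, and the weight
in t is integrable. -/
theorem integrable_transport_pairing {f : Space d × Velocity d → ℂ}
    (hf : MemLp f 2 (phaseMeasure d)) (χ : 𝓢(SpaceTime d, ℂ)) :
    Integrable (fun p : ℝ × (Space d × Velocity d) =>
      f p.2 * χ (WithLp.toLp 2 (p.2.1 + p.1 • (p.2.2 : Space d), p.1)))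
      ((volume : Measure ℝ).prod (phaseMeasure d)) := by
  obtain ⟨C, hC⟩ := exists_norm_schwartz_transport_le χ
  have h1 : Integrable (fun p : Space d × Velocity d => ‖f p‖ * (1 + ‖p.1‖) ^ (-(d + 1 : ℝ)))
      (phaseMeasure d) := MemLp.integrable_mul hf.norm (memLp_two_spatialWeight d)
  have h2 : Integrable (fun t : ℝ => (1 + ‖t‖) ^ (-(2 : ℝ))) :=
    integrable_one_add_norm (by rw [Module.finrank_self]; norm_num)
  have hcont : Continuous fun p : ℝ × (Space d × Velocity d) =>
      (WithLp.toLp 2 (p.2.1 + p.1 • (p.2.2 : Space d), p.1) : SpaceTime d) :=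
    (WithLp.prod_continuous_toLp 2 (Space d) ℝ).comp (by fun_prop)
  refine ((h2.mul_prod h1).const_mul (C : ℝ)).mono' ?_ (Filter.Eventually.of_forall fun p => ?_)
  · exact (hf.1.comp_snd).mul (χ.continuous.comp hcont).aestronglyMeasurable
  · rw [norm_mul]
    calc _ ≤ ‖f p.2‖ * (C * ((1 + ‖p.1‖) ^ (-(2 : ℝ)) * (1 + ‖p.2.1‖) ^ (-(d + 1 : ℝ)))) := by
          gcongr
          exact hC _ _ _
      _ = _ := by ring

/-- The velocity average is a tempered function, and its pairing with a Schwartz function. -/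
theorem integrable_velocityAverage_mul {f : Space d × Velocity d → ℂ}
    (hf : MemLp f 2 (phaseMeasure d)) (χ : 𝓢(SpaceTime d, ℂ)) :
    Integrable (fun z => velocityAverage f z * χ z) ∧
      ∫ z, velocityAverage f z * χ z = ∫ p : Space d × Velocity d,
        f p * (∫ t : ℝ, χ (WithLp.toLp 2 (p.1 + t • (p.2 : Space d), t))) ∂(phaseMeasure d) := by
  have hΦ := integrable_transport_pairing hf χ
  have hS := measurePreserving_transport d
  -- Integrability is known with f evaluated at the starting point of the trajectory; the measure
  -- preserving transport map carries it, and the value of the integral, to the fixed space-time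
  -- point.
  have hΦ' : Integrable (fun p : ℝ × (Space d × Velocity d) =>
      f (p.2.1 - p.1 • (p.2.2 : Space d), p.2.2) * χ (WithLp.toLp 2 (p.2.1, p.1)))
      ((volume : Measure ℝ).prod (phaseMeasure d)) := by
    have := hS.integrable_comp_of_integrable hΦ
    simpa [Function.comp_def] using this
  have hint : ∫ p : ℝ × (Space d × Velocity d),
      f (p.2.1 - p.1 • (p.2.2 : Space d), p.2.2) * χ (WithLp.toLp 2 (p.2.1, p.1))
        ∂((volume : Measure ℝ).prod (phaseMeasure d)) = ∫ p : Space d × Velocity d,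
        f p * (∫ t : ℝ, χ (WithLp.toLp 2 (p.1 + t • (p.2 : Space d), t))) ∂(phaseMeasure d) := by
    have h1 := integral_map (μ := (volume : Measure ℝ).prod (phaseMeasure d))
      hS.measurable.aemeasurable (f := fun p : ℝ × (Space d × Velocity d) =>
      f p.2 * χ (WithLp.toLp 2 (p.2.1 + p.1 • (p.2.2 : Space d), p.1))) (by
        rw [hS.map_eq]; exact hΦ.1)
    rw [hS.map_eq] at h1
    simp only [sub_add_cancel] at h1
    rw [← h1, integral_prod_symm _ hΦ]
    simp_rw [integral_const_mul]
  -- reassociate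
  have hassoc : MeasurePreserving (MeasurableEquiv.prodAssoc :
      (ℝ × Space d) × Velocity d ≃ᵐ ℝ × (Space d × Velocity d))
      (((volume : Measure ℝ).prod (volume : Measure (Space d))).prod (sphereMeasure d))
      ((volume : Measure ℝ).prod (phaseMeasure d)) := measurePreserving_prodAssoc _ _ _
  have h3 := hassoc.integrable_comp_of_integrable hΦ'
  have h4 := hassoc.integral_comp' (fun p : ℝ × (Space d × Velocity d) =>
      f (p.2.1 - p.1 • (p.2.2 : Space d), p.2.2) * χ (WithLp.toLp 2 (p.2.1, p.1)))
  rw [hint] at h4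
  have h5 := h3.integral_prod_left
  have h6 := integral_prod _ h3
  have e1 : ∀ p : ℝ × Space d, ∫ v : Velocity d,
      ((fun p : ℝ × (Space d × Velocity d) =>
      f (p.2.1 - p.1 • (p.2.2 : Space d), p.2.2) * χ (WithLp.toLp 2 (p.2.1, p.1))) ∘
        (MeasurableEquiv.prodAssoc : (ℝ × Space d) × Velocity d ≃ᵐ ℝ × (Space d × Velocity d)))
          (p, v) ∂(sphereMeasure d) =
      (fun z => velocityAverage f z * χ z) (WithLp.toLp 2 (p.2, p.1)) := by
    intro p
    change ∫ v : Velocity d, f (p.2 - p.1 • (v : Space d), v) * χ (WithLp.toLp 2 (p.2, p.1))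
      ∂(sphereMeasure d) = _
    rw [integral_mul_const]; rfl
  simp_rw [e1] at h5 h6
  have hemb : MeasurableEmbedding
      (fun p : ℝ × Space d => (WithLp.toLp 2 (p.2, p.1) : SpaceTime d)) :=
    (MeasurableEquiv.prodComm.trans (MeasurableEquiv.toLp 2 (Space d × ℝ))).measurableEmbedding
  have hmp := measurePreserving_toLp_swap d
  refine ⟨(hmp.integrable_comp_emb hemb).1 h5, ?_⟩
  rw [← hmp.integral_comp hemb, ← h4]
  exact h6.symm

end VelocityPairing

/-! ### The Fourier transform of a velocity average -/

section ConeRestriction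

variable {d : ℕ}

/-- Fourier inversion evaluated at the origin. -/
theorem integral_expFourier {Q : ℝ → ℂ} (hQ : Integrable Q) (hF : Integrable (expFourier Q))
    (hc : ContinuousAt Q 0) : ∫ t, expFourier Q t = (2 * Real.pi : ℝ) * Q 0 := by
  have e : expFourier Q = fun t => 𝓕 Q ((2 * Real.pi)⁻¹ • t) := funext (expFourier_eq Q)
  have hF' : Integrable (𝓕 Q) := by
    rw [e] at hF
    exact (integrable_comp_smul_iff volume (𝓕 Q) two_pi_inv_ne_zero).1 hF
  rw [e, Measure.integral_comp_inv_smul volume (𝓕 Q) (2 * Real.pi), Module.finrank_self, pow_one,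
    abs_of_pos (by positivity), Complex.real_smul, ← hQ.fourierInv_fourier_eq hF' hc,
    Real.fourierInv_eq']
  simp

/-- Integrating the Fourier transform in time restricts the function to frequency `τ = 0`. -/
theorem integral_schwartzFourier_time (Ψ : 𝓢(SpaceTime d, ℂ)) (x : Space d) :
    ∫ t : ℝ, schwartzFourier Ψ (WithLp.toLp 2 (x, t)) =
      (2 * Real.pi : ℝ) * expFourier (fun ξ : Space d => Ψ (WithLp.toLp 2 (ξ, 0))) x := by
  -- The transform in ξ alone. The space-time transform at (x, t) is the transform of `Q` at t, so
  -- its time integral picks out Q(0).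
  set Q : ℝ → ℂ := fun τ => ∫ ξ : Space d, Complex.exp (-Complex.I * (inner ℝ ξ x : ℝ)) *
    Ψ (WithLp.toLp 2 (ξ, τ)) with hQdef
  have hemb : MeasurableEmbedding
      (fun p : ℝ × Space d => (WithLp.toLp 2 (p.2, p.1) : SpaceTime d)) :=
    (MeasurableEquiv.prodComm.trans (MeasurableEquiv.toLp 2 (Space d × ℝ))).measurableEmbedding
  have hmp := measurePreserving_toLp_swap d
  have hunit : ∀ s : ℝ, ‖Complex.exp (-Complex.I * (s : ℂ))‖ = 1 := fun s => by
    rw [show -Complex.I * (s : ℂ) = ((-s : ℝ) : ℂ) * Complex.I by push_cast; ring,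
      Complex.norm_exp_ofReal_mul_I]
  have hint : ∀ t : ℝ, Integrable (fun p : ℝ × Space d =>
      Complex.exp (-Complex.I * (inner ℝ (WithLp.toLp 2 (p.2, p.1) : SpaceTime d)
        (WithLp.toLp 2 (x, t)) : ℝ)) * Ψ (WithLp.toLp 2 (p.2, p.1))) (volume.prod volume) := by
    intro t
    have h1 : Integrable (fun z : SpaceTime d =>
        Complex.exp (-Complex.I * (inner ℝ z (WithLp.toLp 2 (x, t)) : ℝ)) * Ψ z) :=
      Ψ.integrable.bdd_mul (c := 1) (by fun_prop) (Filter.Eventually.of_forall fun z => (hunit _).le)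
    exact (hmp.integrable_comp_emb hemb).2 h1
  have hinner : ∀ (ξ : Space d) (τ t : ℝ), inner ℝ (WithLp.toLp 2 (ξ, τ) : SpaceTime d)
      (WithLp.toLp 2 (x, t)) = inner ℝ ξ x + τ * t := fun ξ τ t => by
    rw [WithLp.prod_inner_apply]; simp [mul_comm]
  have hQF : ∀ t : ℝ, schwartzFourier Ψ (WithLp.toLp 2 (x, t)) = expFourier Q t := by
    intro t
    rw [schwartzFourier_apply, expFourier, ← hmp.integral_comp hemb]
    refine (integral_prod _ (hint t)).trans ?_
    rw [expFourier]
    congr 1; ext τ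
    rw [hQdef, ← integral_const_mul]
    congr 1; ext ξ
    rw [hinner, ← mul_assoc, ← Complex.exp_add]
    congr 2
    have : inner ℝ τ t = τ * t := by simp [mul_comm]
    rw [this]
    push_cast; ring
  have hQi : Integrable Q := by
    have := (hint 0).integral_prod_left
    simpa [hinner, hQdef] using this
  have hQc : Continuous Q := by
    obtain ⟨C, hC⟩ := exists_norm_schwartz_le_fst Ψ
    have hcont : ∀ ξ : Space d, Continuous fun τ : ℝ => (WithLp.toLp 2 (ξ, τ) : SpaceTime d) :=
      fun ξ => (WithLp.prod_continuous_toLp 2 (Space d) ℝ).comp (by fun_prop)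
    have hcont' : ∀ τ : ℝ, Continuous fun ξ : Space d => (WithLp.toLp 2 (ξ, τ) : SpaceTime d) :=
      fun ξ => (WithLp.prod_continuous_toLp 2 (Space d) ℝ).comp (by fun_prop)
    refine continuous_of_dominated (bound := fun ξ => C * (1 + ‖ξ‖) ^ (-(d + 1 : ℝ)))
      (fun τ => ?_) (fun τ => Filter.Eventually.of_forall fun ξ => ?_)
      ((integrable_one_add_norm (by simp)).const_mul _)
      (Filter.Eventually.of_forall fun ξ => ?_)
    · exact Continuous.aestronglyMeasurable
        (Continuous.mul (by fun_prop) (Ψ.continuous.comp (hcont' τ)))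
    · rw [norm_mul, hunit, one_mul]
      exact hC _
    · exact continuous_const.mul (Ψ.continuous.comp (hcont ξ))
  have hFi : Integrable (expFourier Q) := by
    have hcont : Continuous fun t : ℝ => (WithLp.toLp 2 (x, t) : SpaceTime d) :=
      (WithLp.prod_continuous_toLp 2 (Space d) ℝ).comp (by fun_prop)
    obtain ⟨C, hC⟩ := exists_norm_schwartz_le_decayWeight (schwartzFourier Ψ)
    have h2 : Integrable (fun t : ℝ => (1 + ‖t‖) ^ (-(2 : ℝ))) :=
      integrable_one_add_norm (by rw [Module.finrank_self]; norm_num)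
    rw [show expFourier Q = fun t => schwartzFourier Ψ (WithLp.toLp 2 (x, t)) from
      (funext hQF).symm]
    refine (h2.const_mul (C : ℝ)).mono' ((schwartzFourier Ψ).continuous.comp
      hcont).aestronglyMeasurable (Filter.Eventually.of_forall fun t => (hC _).trans ?_)
    unfold decayWeight
    have : (1 + ‖x‖) ^ (-(d + 1 : ℝ)) ≤ 1 :=
      Real.rpow_le_one_of_one_le_of_nonpos (by linarith [norm_nonneg x])
        (by have : (0 : ℝ) ≤ d := by positivity
            linarith)
    gcongr
    calc _ ≤ 1 * (1 + ‖t‖) ^ (-(2 : ℝ)) := by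
          change (1 + ‖x‖) ^ (-(d + 1 : ℝ)) * (1 + ‖t‖) ^ (-(2 : ℝ)) ≤ _
          gcongr
      _ = _ := one_mul _
  simp_rw [hQF]
  rw [integral_expFourier hQi hFi hQc.continuousAt]
  rfl

/-- The shear `(ξ, τ) ↦ (ξ, τ - v·ξ)`. -/
def shear (v : Space d) : SpaceTime d →L[ℝ] SpaceTime d :=
  (WithLp.prodContinuousLinearEquiv 2 ℝ (Space d) ℝ).symm.toContinuousLinearMap ∘L
    ((ContinuousLinearMap.fst ℝ (Space d) ℝ).prod
      (ContinuousLinearMap.snd ℝ (Space d) ℝ - innerSL ℝ v ∘L ContinuousLinearMap.fst ℝ _ _)) ∘L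
    (WithLp.prodContinuousLinearEquiv 2 ℝ (Space d) ℝ).toContinuousLinearMap

theorem shear_apply (v ξ : Space d) (τ : ℝ) :
    shear v (WithLp.toLp 2 (ξ, τ)) = WithLp.toLp 2 (ξ, τ - inner ℝ v ξ) := rfl

theorem shear_neg_shear (v : Space d) (z : SpaceTime d) : shear (-v) (shear v z) = z := by
  obtain ⟨ξ, τ⟩ := z
  change shear (-v) (shear v (WithLp.toLp 2 (ξ, τ))) = _
  rw [shear_apply, shear_apply, inner_neg_left]
  simp

/-- The shear as a continuous linear equivalence. -/
def shearEquiv (v : Space d) : SpaceTime d ≃L[ℝ] SpaceTime d :=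
  ContinuousLinearEquiv.equivOfInverse (shear v) (shear (-v)) (shear_neg_shear v) fun z => by
    have := shear_neg_shear (-v) z
    rwa [neg_neg] at this

theorem measurePreserving_shear (v : Space d) : MeasurePreserving (shear v) := by
  have h1 : MeasurePreserving (fun p : Space d × ℝ => (p.1, p.2 - inner ℝ v p.1))
      (volume.prod volume) (volume.prod volume) := by
    refine (MeasurePreserving.id _).skew_product (g := fun (ξ : Space d) (τ : ℝ) =>
      τ - inner ℝ v ξ) ?_ (Filter.Eventually.of_forall fun ξ => ?_)
    · exact Continuous.measurable (by fun_prop)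
    · exact (measurePreserving_sub_right volume (inner ℝ v ξ)).map_eq
  exact ((WithLp.volume_preserving_toLp (Space d) ℝ).comp h1).comp
    (WithLp.volume_preserving_ofLp (Space d) ℝ)

/-- Restriction of Schwartz functions to the hyperplane `τ = -v·ξ`. -/
def schwartzSlice (v : Space d) : 𝓢(SpaceTime d, ℂ) →L[ℂ] 𝓢(Space d, ℂ) :=
  SchwartzMap.compCLMOfAntilipschitz ℂ (K := 1) (sliceMap v).hasTemperateGrowth
    ((sliceMap v).antilipschitz_of_bound fun ξ => by
      rw [NNReal.coe_one, one_mul]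
      exact WithLp.norm_fst_le _ (sliceMap v ξ))

theorem schwartzSlice_apply (v : Space d) (ψ : 𝓢(SpaceTime d, ℂ)) (ξ : Space d) :
    schwartzSlice v ψ ξ = ψ (sliceMap v ξ) := rfl

/-- Integration of a Fourier transform along a trajectory of the free transport flow. -/
theorem integral_schwartzFourier_transport (ψ : 𝓢(SpaceTime d, ℂ)) (x v : Space d) :
    ∫ t : ℝ, schwartzFourier ψ (WithLp.toLp 2 (x + t • v, t)) =
      (2 * Real.pi : ℝ) * schwartzFourier (schwartzSlice v ψ) x := by
  -- A measure preserving shear in frequency straightens the trajectory, reducing to integration in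
  -- time at a fixed point; the hyperplane τ = 0 for Ψ is τ = -v·ξ for ψ.
  set Ψ : 𝓢(SpaceTime d, ℂ) := SchwartzMap.compCLMOfContinuousLinearEquiv ℂ (shearEquiv v) ψ
  have hΨ : ∀ z, Ψ z = ψ (shear v z) := fun z => rfl
  have h1 : ∀ t : ℝ, schwartzFourier ψ (WithLp.toLp 2 (x + t • v, t)) =
      schwartzFourier Ψ (WithLp.toLp 2 (x, t)) := by
    intro t
    rw [schwartzFourier_apply, schwartzFourier_apply, expFourier, expFourier,
      ← (measurePreserving_shear v).integral_comp
        (shearEquiv v).toHomeomorph.measurableEmbedding]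
    congr 1; ext z
    rw [hΨ]
    obtain ⟨ξ, τ⟩ := z
    have : inner ℝ (shear v (WithLp.toLp 2 (ξ, τ))) (WithLp.toLp 2 (x + t • v, t) : SpaceTime d) =
        inner ℝ (WithLp.toLp 2 (ξ, τ)) (WithLp.toLp 2 (x, t) : SpaceTime d) := by
      rw [shear_apply, WithLp.prod_inner_apply, WithLp.prod_inner_apply]
      simp only [inner_add_right, inner_smul_right, real_inner_comm v ξ]
      simp
      ring
    change Complex.exp (-Complex.I * (inner ℝ (shear v (WithLp.toLp 2 (ξ, τ)))
      (WithLp.toLp 2 (x + t • v, t) : SpaceTime d) : ℝ)) * _ = _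
    rw [this]
  simp_rw [h1]
  rw [integral_schwartzFourier_time, schwartzFourier_apply]
  congr 2
  ext ξ
  rw [hΨ, shear_apply, schwartzSlice_apply, sliceMap_apply, zero_sub]

/-- The transpose of the velocity average, on Fourier transforms of Schwartz functions. -/
def averageTranspose (d : ℕ) : 𝓢(SpaceTime d, ℂ) →ₗ[ℂ] (Space d × Velocity d → ℂ) where
  toFun ψ p := (2 * Real.pi : ℝ) * schwartzFourier (schwartzSlice (p.2 : Space d) ψ) p.1
  map_add' a b := by ext p; simp [mul_add]
  map_smul' a b := by ext p; simp; ring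

theorem averageTranspose_apply (ψ : 𝓢(SpaceTime d, ℂ)) (p : Space d × Velocity d) :
    averageTranspose d ψ p =
      (2 * Real.pi : ℝ) * schwartzFourier (schwartzSlice (p.2 : Space d) ψ) p.1 := rfl

theorem integral_velocityAverage_mul_fourierInt {f : Space d × Velocity d → ℂ}
    (hf : MemLp f 2 (phaseMeasure d)) (ψ : 𝓢(SpaceTime d, ℂ)) :
    ∫ z, velocityAverage f z * fourierInt ψ z = ∫ p, f p * averageTranspose d ψ p
      ∂(phaseMeasure d) := by
  rw [fourierInt_schwartz, (integrable_velocityAverage_mul hf _).2]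
  congr 1; ext p
  rw [integral_schwartzFourier_transport, averageTranspose_apply]

theorem continuous_sliceMap_uncurry (d : ℕ) :
    Continuous fun p : Velocity d × Space d => sliceMap (p.1 : Space d) p.2 := by
  simp_rw [sliceMap_apply]
  exact (WithLp.prod_continuous_toLp 2 (Space d) ℝ).comp
    (f := fun p : Velocity d × Space d => (p.2, -inner ℝ (p.1 : Space d) p.2)) (by fun_prop)

theorem stronglyMeasurable_averageTranspose (ψ : 𝓢(SpaceTime d, ℂ)) :
    StronglyMeasurable (averageTranspose d ψ) := by
  have h : Continuous fun p : (Space d × Velocity d) × Space d =>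
      Complex.exp (-Complex.I * (inner ℝ p.2 p.1.1 : ℝ)) * ψ (sliceMap (p.1.2 : Space d) p.2) := by
    refine Continuous.mul (by fun_prop) (ψ.continuous.comp ?_)
    exact (continuous_sliceMap_uncurry d).comp
      (f := fun p : (Space d × Velocity d) × Space d => (p.1.2, p.2)) (by fun_prop)
  have e : averageTranspose d ψ = fun p => ((2 * Real.pi : ℝ) : ℂ) * ∫ ξ : Space d,
      Complex.exp (-Complex.I * (inner ℝ ξ p.1 : ℝ)) * ψ (sliceMap (p.2 : Space d) ξ) := by
    ext p
    rw [averageTranspose_apply, schwartzFourier_apply]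
    rfl
  rw [e]
  exact (h.stronglyMeasurable.integral_prod_right' (ν := volume)).const_mul _

theorem memLp_two_comp_sliceMap (ψ : 𝓢(SpaceTime d, ℂ)) :
    MemLp (fun p : Space d × Velocity d => ψ (sliceMap (p.2 : Space d) p.1)) 2
      (phaseMeasure d) := by
  obtain ⟨C, hC⟩ := exists_norm_schwartz_le_fst ψ
  refine (memLp_two_spatialWeight d).of_le_mul (c := C) ?_ (Filter.Eventually.of_forall fun p => ?_)
  · exact (ψ.continuous.comp
      ((continuous_sliceMap_uncurry d).comp continuous_swap)).aestronglyMeasurable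
  · rw [Real.norm_of_nonneg (by positivity)]
    exact hC _

/-- The measure `κ dζ` on space-time frequencies, with `κ` the cone density. -/
def coneMeasure (d : ℕ) : Measure (SpaceTime d) :=
  volume.withDensity fun ζ => ENNReal.ofReal (coneDensity d ζ)

theorem lintegral_coneMeasure {h : SpaceTime d → ℝ≥0∞} (hh : Measurable h) :
    ∫⁻ ζ, h ζ ∂(coneMeasure d) = ∫⁻ ζ, ENNReal.ofReal (coneDensity d ζ) * h ζ :=
  lintegral_withDensity_eq_lintegral_mul _ measurable_coneDensity.ennreal_ofReal hh

theorem lintegral_comp_sliceMap (hd : 2 ≤ d) (ψ : 𝓢(SpaceTime d, ℂ)) :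
    ∫⁻ p : Space d × Velocity d, ‖ψ (sliceMap (p.2 : Space d) p.1)‖ₑ ^ 2 ∂(phaseMeasure d) =
      ∫⁻ ζ, ‖ψ ζ‖ₑ ^ 2 ∂(coneMeasure d) := by
  have hm : Measurable fun ζ => ‖ψ ζ‖ₑ ^ 2 := ψ.continuous.measurable.enorm.pow_const 2
  rw [lintegral_coneMeasure hm, ← lintegral_sliceMap hd hm]
  exact lintegral_prod _ (hm.comp
    ((continuous_sliceMap_uncurry d).comp continuous_swap).measurable).aemeasurable

/-- Plancherel in x for each fixed v, which gives (2π)^d, together with the squared factor 2π of the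
transpose; then the slicing identity for the sphere. Up to a constant the transpose is thus an
isometry from L²(κ dζ). -/
theorem lintegral_averageTranspose (hd : 2 ≤ d) (ψ : 𝓢(SpaceTime d, ℂ)) :
    ∫⁻ p, ‖averageTranspose d ψ p‖ₑ ^ 2 ∂(phaseMeasure d) =
      ENNReal.ofReal ((2 * Real.pi) ^ (d + 2)) * ∫⁻ ζ, ‖ψ ζ‖ₑ ^ 2 ∂(coneMeasure d) := by
  have hm : Measurable fun ζ => ‖ψ ζ‖ₑ ^ 2 := ψ.continuous.measurable.enorm.pow_const 2
  have hc : ‖((2 * Real.pi : ℝ) : ℂ)‖ₑ ^ 2 * ENNReal.ofReal ((2 * Real.pi) ^ d) =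
      ENNReal.ofReal ((2 * Real.pi) ^ (d + 2)) := by
    rw [← ofReal_norm, ← ENNReal.ofReal_pow (norm_nonneg _), Complex.norm_real,
      Real.norm_of_nonneg (by positivity), ← ENNReal.ofReal_mul (by positivity), pow_add, mul_comm]
  rw [← lintegral_comp_sliceMap hd ψ, phaseMeasure,
    lintegral_prod_symm _ ((stronglyMeasurable_averageTranspose ψ).measurable.enorm.pow_const
      2).aemeasurable,
    lintegral_prod_symm (fun p : Space d × Velocity d => ‖ψ (sliceMap (p.2 : Space d) p.1)‖ₑ ^ 2)
      (hm.comp ((continuous_sliceMap_uncurry d).comp continuous_swap).measurable).aemeasurable,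
    ← lintegral_const_mul' _ _ ENNReal.ofReal_ne_top]
  congr 1; ext v
  simp only [averageTranspose_apply, enorm_mul, mul_pow (_ : ℝ≥0∞)]
  rw [lintegral_const_mul' _ _ (by finiteness), lintegral_enorm_sq_schwartzFourier, ← mul_assoc,
    finrank_euclideanSpace_fin, hc]
  rfl

theorem memLp_two_coneMeasure (hd : 2 ≤ d) (ψ : 𝓢(SpaceTime d, ℂ)) :
    MemLp ψ 2 (coneMeasure d) := by
  refine ⟨ψ.continuous.aestronglyMeasurable, ?_⟩
  rw [eLpNorm_two_eq, ← lintegral_comp_sliceMap hd, ← eLpNorm_two_eq (phaseMeasure d)]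
  exact (memLp_two_comp_sliceMap ψ).2

theorem eLpNorm_averageTranspose (hd : 2 ≤ d) (ψ : 𝓢(SpaceTime d, ℂ)) :
    eLpNorm (averageTranspose d ψ) 2 (phaseMeasure d) =
      (Real.toNNReal ((2 * Real.pi) ^ (d + 2)) ^ (1 / 2 : ℝ) : ℝ≥0) *
        eLpNorm ψ 2 (coneMeasure d) := by
  rw [eLpNorm_two_eq, lintegral_averageTranspose hd, ENNReal.mul_rpow_of_nonneg _ _ (by norm_num),
    eLpNorm_two_eq, ENNReal.coe_rpow_of_nonneg _ (by norm_num)]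
  rfl

theorem memLp_two_averageTranspose (hd : 2 ≤ d) (ψ : 𝓢(SpaceTime d, ℂ)) :
    MemLp (averageTranspose d ψ) 2 (phaseMeasure d) := by
  refine ⟨(stronglyMeasurable_averageTranspose ψ).aestronglyMeasurable, ?_⟩
  rw [eLpNorm_averageTranspose hd]
  exact ENNReal.mul_lt_top ENNReal.coe_lt_top (memLp_two_coneMeasure hd ψ).2

theorem integral_coneMeasure (h : SpaceTime d → ℂ) :
    ∫ ζ, h ζ ∂(coneMeasure d) = ∫ ζ, (coneDensity d ζ : ℂ) * h ζ := by
  rw [coneMeasure, integral_withDensity_eq_integral_toReal_smul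
    measurable_coneDensity.ennreal_ofReal (Filter.Eventually.of_forall fun _ => by finiteness)]
  congr 1; ext ζ
  rw [ENNReal.toReal_ofReal (coneDensity_nonneg ζ), Complex.real_smul]

theorem hasFourier_velocityAverage (hd : 2 ≤ d) {f : Space d × Velocity d → ℂ}
    (hf : MemLp f 2 (phaseMeasure d)) {g : SpaceTime d → ℂ} (hg : MemLp g 2 (coneMeasure d))
    (h : ∀ ψ : 𝓢(SpaceTime d, ℂ), ∫ ζ, g ζ * ψ ζ ∂(coneMeasure d) =
      ∫ p, f p * averageTranspose d ψ p ∂(phaseMeasure d)) :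
    HasFourier (velocityAverage f) (fun ζ => coneDensity d ζ * g ζ) := by
  refine ⟨fun ψ => (integrable_velocityAverage_mul hf ψ).1, fun ψ => ?_, fun ψ => ?_⟩
  · have h1 : Integrable (fun ζ => g ζ * ψ ζ) (coneMeasure d) :=
      MemLp.integrable_mul hg (memLp_two_coneMeasure hd ψ)
    rw [coneMeasure, integrable_withDensity_iff_integrable_smul'
      measurable_coneDensity.ennreal_ofReal (Filter.Eventually.of_forall fun _ => by finiteness)]
      at h1
    refine h1.congr (Filter.Eventually.of_forall fun ζ => ?_)
    simp only
    rw [ENNReal.toReal_ofReal (coneDensity_nonneg ζ), Complex.real_smul, mul_assoc]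
  · rw [integral_velocityAverage_mul_fourierInt hf, ← h, integral_coneMeasure]
    simp_rw [mul_assoc]

/-- The upper bound for the transpose, transposed. A strongly measurable representative `g'`
replaces `g`, which is determined only almost everywhere for κ dζ, so that later identities hold on
all of space-time. -/
theorem exists_fourier_velocityAverage (hd : 2 ≤ d) :
    ∃ c : ℝ≥0, ∀ f : Space d × Velocity d → ℂ, MemLp f 2 (phaseMeasure d) →
      ∃ g, Measurable g ∧ MemLp g 2 (coneMeasure d) ∧
        eLpNorm g 2 (coneMeasure d) ≤ c * eLpNorm f 2 (phaseMeasure d) ∧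
        HasFourier (velocityAverage f) (fun ζ => coneDensity d ζ * g ζ) := by
  refine ⟨Real.toNNReal ((2 * Real.pi) ^ (d + 2)) ^ (1 / 2 : ℝ), fun f hf => ?_⟩
  obtain ⟨g, hg, hn, he⟩ := exists_transpose (schwartzCoe (SpaceTime d)) (averageTranspose d)
    (memLp_two_coneMeasure hd) (memLp_two_averageTranspose hd) _
    (fun ψ => (eLpNorm_averageTranspose hd ψ).le) hf
  obtain ⟨g', hg'm, hgg'⟩ := hg.1
  refine ⟨g', hg'm.measurable, hg.ae_eq hgg', (eLpNorm_congr_ae hgg').symm.trans_le hn,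
    hasFourier_velocityAverage hd hf (hg.ae_eq hgg') fun ψ => ?_⟩
  rw [← he ψ]
  refine integral_congr_ae ?_
  filter_upwards [hgg'] with ζ h
  rw [h]; rfl

/-- The lower bound for the transpose gives the converse: every density in L²(κ dζ) is realised by
some f with controlled norm. This is what makes the reduction to a multiplier estimate an
equivalence. -/
theorem exists_velocityAverage_fourier (hd : 2 ≤ d) :
    ∃ c : ℝ≥0, ∀ g : SpaceTime d → ℂ, MemLp g 2 (coneMeasure d) →
      ∃ f, MemLp f 2 (phaseMeasure d) ∧
        eLpNorm f 2 (phaseMeasure d) ≤ c * eLpNorm g 2 (coneMeasure d) ∧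
        HasFourier (velocityAverage f) (fun ζ => coneDensity d ζ * g ζ) := by
  set K : ℝ≥0 := Real.toNNReal ((2 * Real.pi) ^ (d + 2)) ^ (1 / 2 : ℝ) with hK
  have hK0 : K ≠ 0 := by
    have : 0 < Real.toNNReal ((2 * Real.pi) ^ (d + 2)) := by
      rw [Real.toNNReal_pos]; positivity
    exact (NNReal.rpow_pos this).ne'
  refine ⟨K⁻¹, fun g hg => ?_⟩
  obtain ⟨f, hf, hn, he⟩ := exists_transpose (averageTranspose d) (schwartzCoe (SpaceTime d))
    (memLp_two_averageTranspose hd) (memLp_two_coneMeasure hd) K⁻¹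
    (fun ψ => by
      rw [eLpNorm_averageTranspose hd, ← mul_assoc, ← ENNReal.coe_mul, inv_mul_cancel₀ hK0]
      simp [schwartzCoe]) hg
  exact ⟨f, hf, hn, hasFourier_velocityAverage hd hf hg fun ψ => (he ψ).symm⟩

theorem eLpNorm_sqrt_coneDensity_mul {g : SpaceTime d → ℂ} (hg : Measurable g) :
    eLpNorm (fun ζ => (√(coneDensity d ζ) : ℂ) * g ζ) 2 volume = eLpNorm g 2 (coneMeasure d) := by
  rw [eLpNorm_two_eq, eLpNorm_two_eq, lintegral_coneMeasure (hg.enorm.pow_const 2)]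
  congr 2; ext ζ
  rw [enorm_mul, mul_pow, ← ofReal_norm (_ : ℂ), Complex.norm_real,
    Real.norm_of_nonneg (Real.sqrt_nonneg _), ← ENNReal.ofReal_pow (Real.sqrt_nonneg _),
    Real.sq_sqrt (coneDensity_nonneg ζ)]

/-- On the Fourier side the smoothing estimate is an `L²` multiplier estimate, with the
hyperbolic multiplier weighted by the square root of the cone density. -/
theorem smoothingEstimate_iff (hd : 2 ≤ d) {q r βp βm : ℝ} :
    SmoothingEstimate d q r βp βm ↔ FourierBounded d q r
      (fun ζ => hyperbolicMultiplier βp βm ζ * (√(coneDensity d ζ) : ℂ)) := by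
  have hsq : ∀ ζ : SpaceTime d, (√(coneDensity d ζ) : ℂ) * (√(coneDensity d ζ) : ℂ) =
      coneDensity d ζ := fun ζ => by
    rw [← Complex.ofReal_mul, Real.mul_self_sqrt (coneDensity_nonneg ζ)]
  have hsqm : Measurable fun ζ : SpaceTime d => (√(coneDensity d ζ) : ℂ) :=
    Complex.measurable_ofReal.comp measurable_coneDensity.sqrt
  constructor
  · rintro ⟨C, hC⟩
    obtain ⟨c, hc⟩ := exists_velocityAverage_fourier hd
    refine ⟨C * c, fun H hH => ?_⟩
    obtain ⟨H', hH'm, hHH'⟩ := hH.1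
    -- Where the density vanishes this quotient is zero by convention; there the weighted multiplier
    -- vanishes as well, so that part of H plays no role.
    set g : SpaceTime d → ℂ := fun ζ => H' ζ / (√(coneDensity d ζ) : ℂ)
    have hgm : Measurable g := hH'm.measurable.div hsqm
    have hgn : eLpNorm g 2 (coneMeasure d) ≤ eLpNorm H 2 volume := by
      rw [← eLpNorm_sqrt_coneDensity_mul hgm, eLpNorm_congr_ae hHH']
      refine eLpNorm_mono fun ζ => ?_
      by_cases h0 : (√(coneDensity d ζ) : ℂ) = 0
      · simp [h0]
      · rw [mul_div_cancel₀ _ h0]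
    obtain ⟨f, hf, hfn, hF⟩ := hc g ⟨hgm.aestronglyMeasurable, hgn.trans_lt hH.2⟩
    obtain ⟨G, ⟨U, hU, hG⟩, hn⟩ := hC f hf
    refine ⟨G, hG.congr (Filter.EventuallyEq.refl _ _) ?_, hn.trans ?_⟩
    · filter_upwards [hU.unique_right hF, hHH'] with ζ h1 h2
      rw [h1, h2, mul_assoc, ← hsq]
      by_cases h0 : (√(coneDensity d ζ) : ℂ) = 0
      · simp [h0]
      · rw [mul_assoc, mul_div_cancel₀ _ h0]
    · rw [ENNReal.coe_mul, mul_assoc]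
      gcongr
      exact hfn.trans (by gcongr)
  · rintro ⟨C, hC⟩
    obtain ⟨c, hc⟩ := exists_fourier_velocityAverage hd
    refine ⟨C * c, fun f hf => ?_⟩
    obtain ⟨g, hgm, hg, hgn, hF⟩ := hc f hf
    have hn' := eLpNorm_sqrt_coneDensity_mul hgm
    obtain ⟨G, hG, hn⟩ := hC (fun ζ => (√(coneDensity d ζ) : ℂ) * g ζ)
      ⟨(hsqm.mul hgm).aestronglyMeasurable, hn' ▸ hg.2⟩
    refine ⟨G, ⟨_, hF, ?_⟩, hn.trans ?_⟩
    · refine hG.congr (Filter.EventuallyEq.refl _ _) (Filter.Eventually.of_forall fun ζ => ?_)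
      simp only
      rw [← hsq]; ring
    · rw [ENNReal.coe_mul, mul_assoc, hn']
      gcongr

end ConeRestriction

/-! ### Littlewood–Paley in the mixed norm, and summation over frequency shells -/

section MixedLittlewoodPaley

variable {d : ℕ}

theorem lintegral_sum_rpow_le {X : Type*} [MeasurableSpace X] {μ : Measure X} {p : ℝ} (hp : 1 ≤ p)
    (F : ℕ → X → ℝ≥0∞) (hF : ∀ i, AEMeasurable (F i) μ) (n : ℕ) :
    (∫⁻ x, (∑ i ∈ Finset.range n, F i x) ^ p ∂μ) ^ (1 / p) ≤
      ∑ i ∈ Finset.range n, (∫⁻ x, F i x ^ p ∂μ) ^ (1 / p) := by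
  have hp0 : 0 < p := by linarith
  induction n with
  | zero => simp [ENNReal.zero_rpow_of_pos hp0, hp0]
  | succ n ih =>
    simp_rw [Finset.sum_range_succ]
    have := ENNReal.lintegral_Lp_add_le (Finset.aemeasurable_fun_sum (Finset.range n)
      fun i _ => hF i) (hF n) hp
    exact this.trans (by gcongr)

theorem mixedNorm_eq {q r : ℝ} (hr : 0 < r) (G : SpaceTime d → ℂ) :
    mixedNorm q r G = (∫⁻ t : ℝ, eLpNorm (fun x : Space d => G (WithLp.toLp 2 (x, t)))
      (ENNReal.ofReal r) volume ^ q) ^ (1 / q) := by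
  unfold mixedNorm
  congr 2; ext t
  rw [eLpNorm_eq_lintegral_rpow_enorm_toReal (by simpa using hr) ENNReal.ofReal_ne_top,
    ENNReal.toReal_ofReal hr.le, ← ENNReal.rpow_mul, one_div_mul_eq_div]

/-- The inverse Fourier transform in time of a function of `(ξ, τ)`. -/
def timeInverseFourier (a : SpaceTime d → ℂ) (t : ℝ) (ξ : Space d) : ℂ :=
  ∫ τ : ℝ, Complex.exp (Complex.I * (t * τ : ℝ)) * a (WithLp.toLp 2 (ξ, τ))

theorem integrable_timeInverseFourier_integrand {a : SpaceTime d → ℂ} (ha : Integrable a) (t : ℝ) :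
    Integrable (fun p : Space d × ℝ =>
      Complex.exp (Complex.I * (t * p.2 : ℝ)) * a (WithLp.toLp 2 p)) (volume.prod volume) := by
  have hemb : MeasurableEmbedding (fun p : Space d × ℝ => (WithLp.toLp 2 p : SpaceTime d)) :=
    (MeasurableEquiv.toLp 2 (Space d × ℝ)).measurableEmbedding
  have h1 : Integrable (fun p : Space d × ℝ => a (WithLp.toLp 2 p)) (volume.prod volume) :=
    ((WithLp.volume_preserving_toLp (Space d) ℝ).integrable_comp_emb hemb).2 ha
  refine h1.bdd_mul (c := 1) (by fun_prop) (Filter.Eventually.of_forall fun p => ?_)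
  rw [mul_comm Complex.I, Complex.norm_exp_ofReal_mul_I]

theorem integrable_timeInverseFourier {a : SpaceTime d → ℂ} (ha : Integrable a) (t : ℝ) :
    Integrable (timeInverseFourier a t) :=
  (integrable_timeInverseFourier_integrand ha t).integral_prod_left

theorem expFourierInv_spaceTime {a : SpaceTime d → ℂ} (ha : Integrable a) (x : Space d) (t : ℝ) :
    expFourierInv a (WithLp.toLp 2 (x, t)) = expFourierInv (timeInverseFourier a t) x := by
  have hemb : MeasurableEmbedding (fun p : Space d × ℝ => (WithLp.toLp 2 p : SpaceTime d)) :=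
    (MeasurableEquiv.toLp 2 (Space d × ℝ)).measurableEmbedding
  have hmp := WithLp.volume_preserving_toLp (Space d) ℝ
  have h1 : Integrable (fun p : Space d × ℝ => Complex.exp (Complex.I *
      (inner ℝ (WithLp.toLp 2 (x, t)) (WithLp.toLp 2 p : SpaceTime d) : ℝ)) *
        a (WithLp.toLp 2 p)) (volume.prod volume) :=
    (hmp.integrable_comp_emb hemb).2 (integrable_expFourierInv_integrand ha _)
  rw [expFourierInv, ← hmp.integral_comp hemb]
  refine (integral_prod _ h1).trans ?_
  rw [expFourierInv]
  congr 1; ext ξ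
  rw [timeInverseFourier, ← integral_const_mul]
  congr 1; ext τ
  rw [← mul_assoc, ← Complex.exp_add]
  congr 2
  have : inner ℝ (WithLp.toLp 2 (x, t)) (WithLp.toLp 2 (ξ, τ) : SpaceTime d) =
      inner ℝ x ξ + t * τ := by
    rw [WithLp.prod_inner_apply]; simp [mul_comm]
  rw [this]
  push_cast; ring

theorem eLpNorm_const_mul_sq (c : ℂ) (f : Space d → ℂ) (p : ℝ≥0∞) :
    eLpNorm (fun x => c * f x) p volume ^ 2 = ‖c‖ₑ ^ 2 * eLpNorm f p volume ^ 2 := by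
  rw [← mul_pow]
  congr 1
  exact eLpNorm_const_smul c f p volume

/-- For fixed t, inverting the transform in τ alone keeps the support in ξ, so the spatial
inequality applies at each time with a constant independent of t. -/
theorem exists_eLpNorm_slice_sum_sq_le (d : ℕ) {r lam : ℝ} (hr : 2 ≤ r) (hlam : 1 < lam) :
    ∃ K : ℝ≥0, ∀ R : ℝ, 0 < R → ∀ (n : ℕ) (a : ℕ → SpaceTime d → ℂ), (∀ i, Integrable (a i)) →
      (∀ i ζ, a i ζ ≠ 0 → R * lam ^ i ≤ ‖ζ.fst‖ ∧ ‖ζ.fst‖ ≤ R * lam ^ (i + 1)) → ∀ t : ℝ,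
      eLpNorm (fun x : Space d => ∑ i ∈ Finset.range n,
        inverseFourier (a i) (WithLp.toLp 2 (x, t))) (ENNReal.ofReal r) volume ^ 2 ≤
        K * ∑ i ∈ Finset.range n, eLpNorm (fun x : Space d =>
          inverseFourier (a i) (WithLp.toLp 2 (x, t))) (ENNReal.ofReal r) volume ^ 2 := by
  obtain ⟨K, hK⟩ := exists_eLpNorm_sum_sq_le (Space d) hr hlam
  refine ⟨K, fun R hR n a ha hsupp t => ?_⟩
  have hsupp' : ∀ i ξ, timeInverseFourier (a i) t ξ ≠ 0 →
      R * lam ^ i ≤ ‖ξ‖ ∧ ‖ξ‖ ≤ R * lam ^ (i + 1) := by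
    intro i ξ h
    by_contra hcon
    refine h (integral_eq_zero_of_ae (Filter.Eventually.of_forall fun τ => ?_))
    have h0 : a i (WithLp.toLp 2 (ξ, τ)) = 0 := by
      by_contra hne
      exact hcon (hsupp i (WithLp.toLp 2 (ξ, τ)) hne)
    simp only [h0, mul_zero, Pi.zero_apply]
  have h1 := hK R hR n (fun i => timeInverseFourier (a i) t)
    (fun i => integrable_timeInverseFourier (ha i) t) hsupp'
  have e : ∀ i, (fun x : Space d => inverseFourier (a i) (WithLp.toLp 2 (x, t))) =
      fun x => ((((2 * Real.pi) ^ (d + 1))⁻¹ : ℝ) : ℂ) *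
        expFourierInv (timeInverseFourier (a i) t) x := fun i => by
    ext x
    rw [inverseFourier, expFourierInv_spaceTime (ha i)]
  have e' : (fun x : Space d => ∑ i ∈ Finset.range n,
      inverseFourier (a i) (WithLp.toLp 2 (x, t))) = fun x =>
        ((((2 * Real.pi) ^ (d + 1))⁻¹ : ℝ) : ℂ) *
          ∑ i ∈ Finset.range n, expFourierInv (timeInverseFourier (a i) t) x := by
    ext x
    rw [Finset.mul_sum]
    exact Finset.sum_congr rfl fun i _ => congrFun (e i) x
  rw [e', eLpNorm_const_mul_sq]
  simp_rw [e, eLpNorm_const_mul_sq]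
  rw [← Finset.mul_sum, mul_left_comm]
  gcongr

/-- The Littlewood–Paley inequality in `L^q_t L^r_x` for dyadic pieces in the spatial frequency. -/
theorem exists_mixedNorm_sum_sq_le (d : ℕ) {q r lam : ℝ} (hq : 2 ≤ q) (hr : 2 ≤ r)
    (hlam : 1 < lam) :
    ∃ K : ℝ≥0, ∀ R : ℝ, 0 < R → ∀ (n : ℕ) (a : ℕ → SpaceTime d → ℂ), (∀ i, Integrable (a i)) →
      (∀ i ζ, a i ζ ≠ 0 → R * lam ^ i ≤ ‖ζ.fst‖ ∧ ‖ζ.fst‖ ≤ R * lam ^ (i + 1)) →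
      mixedNorm q r (fun z => ∑ i ∈ Finset.range n, inverseFourier (a i) z) ^ 2 ≤
        K * ∑ i ∈ Finset.range n, mixedNorm q r (inverseFourier (a i)) ^ 2 := by
  obtain ⟨K, hK⟩ := exists_eLpNorm_slice_sum_sq_le d hr hlam
  refine ⟨K, fun R hR n a ha hsupp => ?_⟩
  have hq0 : 0 < q := by linarith
  have hr0 : 0 < r := by linarith
  set N : ℕ → ℝ → ℝ≥0∞ := fun i t => eLpNorm (fun x : Space d =>
    inverseFourier (a i) (WithLp.toLp 2 (x, t))) (ENNReal.ofReal r) volume with hN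
  have hmeas : ∀ i, AEMeasurable (fun t => N i t ^ 2) := by
    intro i
    have h1 := aemeasurable_lintegral_section
      (continuous_inverseFourier (ha i)).aestronglyMeasurable r
    refine AEMeasurable.pow_const ?_ 2
    have : N i = fun t => (∫⁻ x : Space d,
        ‖inverseFourier (a i) (WithLp.toLp 2 (x, t))‖ₑ ^ r) ^ (1 / r) := by
      ext t
      rw [hN]
      simp only
      rw [eLpNorm_eq_lintegral_rpow_enorm_toReal (by simpa using hr0) ENNReal.ofReal_ne_top,
        ENNReal.toReal_ofReal hr0.le]
    rw [this]
    exact h1.pow_const _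
  have hp : 1 ≤ q / 2 := by linarith
  -- The square of an L^q norm is the L^(q/2) norm of the square. Since q ≥ 2, Minkowski's
  -- inequality in L^(q/2) takes the sum of squares out of the time integral.
  have hsq : ∀ (A : ℝ → ℝ≥0∞), ((∫⁻ t, A t ^ q) ^ (1 / q)) ^ 2 =
      (∫⁻ t, (A t ^ 2) ^ (q / 2)) ^ (1 / (q / 2)) := by
    intro A
    rw [← ENNReal.rpow_natCast, ← ENNReal.rpow_mul]
    congr 1
    · congr 1; ext t
      rw [← ENNReal.rpow_natCast, ← ENNReal.rpow_mul]
      congr 1; push_cast; field_simp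
    · push_cast; field_simp
  rw [mixedNorm_eq hr0, hsq]
  simp_rw [mixedNorm_eq hr0, hsq]
  calc _ ≤ (∫⁻ t, (K * ∑ i ∈ Finset.range n, N i t ^ 2) ^ (q / 2)) ^ (1 / (q / 2)) := by
        gcongr with t
        exact hK R hR n a ha hsupp t
    _ = K * (∫⁻ t, (∑ i ∈ Finset.range n, N i t ^ 2) ^ (q / 2)) ^ (1 / (q / 2)) := by
        simp_rw [ENNReal.mul_rpow_of_nonneg _ _ (show 0 ≤ q / 2 by positivity)]
        rw [lintegral_const_mul' _ _ (ENNReal.rpow_ne_top_of_nonneg (by positivity)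
          ENNReal.coe_ne_top), ENNReal.mul_rpow_of_nonneg _ _ (by positivity), ← ENNReal.rpow_mul,
          mul_one_div_cancel (by positivity), ENNReal.rpow_one]
    _ ≤ _ := by
        gcongr
        exact lintegral_sum_rpow_le hp _ hmeas n

/-- The set of frequencies with `a ≤ |ξ| < b`. -/
def frequencyShell (d : ℕ) (a b : ℝ) : Set (SpaceTime d) := {ζ | a ≤ ‖ζ.fst‖ ∧ ‖ζ.fst‖ < b}

theorem measurableSet_frequencyShell (a b : ℝ) : MeasurableSet (frequencyShell d a b) :=
  (measurableSet_le measurable_const measurable_fst_spaceTime.norm).inter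
    (measurableSet_lt measurable_fst_spaceTime.norm measurable_const)

theorem sum_indicator_frequencyShell {α : Type*} [AddCommMonoid α] {R lam : ℝ} (hR : 0 < R)
    (hlam : 1 < lam) (n : ℕ) (f : SpaceTime d → α) (ζ : SpaceTime d) :
    ∑ i ∈ Finset.range n, (frequencyShell d (R * lam ^ i) (R * lam ^ (i + 1))).indicator f ζ =
      (frequencyShell d R (R * lam ^ n)).indicator f ζ := by
  classical
  induction n with
  | zero =>
    rw [Finset.sum_range_zero, Set.indicator_of_notMem]
    rintro ⟨h1, h2⟩
    rw [pow_zero, mul_one] at h2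
    linarith
  | succ n ih =>
    have h1 : R ≤ R * lam ^ n := le_mul_of_one_le_right hR.le (one_le_pow₀ hlam.le)
    have h2 : R * lam ^ n ≤ R * lam ^ (n + 1) := by
      gcongr
      · exact hlam.le
      · omega
    rw [Finset.sum_range_succ, ih, ← congrFun (Set.indicator_union_of_disjoint _ f) ζ]
    · congr 1
      ext ζ
      simp only [frequencyShell, Set.mem_union, Set.mem_ofPred_eq]
      constructor
      · rintro (⟨h3, h4⟩ | ⟨h3, h4⟩)
        · exact ⟨h3, by linarith⟩
        · exact ⟨by linarith, h4⟩
      · rintro ⟨h3, h4⟩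
        rcases lt_or_ge ‖ζ.fst‖ (R * lam ^ n) with h | h
        · exact Or.inl ⟨h3, h⟩
        · exact Or.inr ⟨h, h4⟩
    · rw [Set.disjoint_left]
      rintro ζ ⟨_, h3⟩ ⟨h4, _⟩
      exact absurd h3 (not_lt.2 h4)

theorem eLpNorm_comp_smul_two (H : SpaceTime d → ℂ) {c : ℝ} (hc : 0 < c) :
    eLpNorm (fun ζ => H (c • ζ)) 2 volume =
      ENNReal.ofReal (c ^ (-((d + 1 : ℝ) / 2))) * eLpNorm H 2 volume := by
  rw [eLpNorm_two_eq, eLpNorm_two_eq, lintegral_comp_smul volume (fun ζ => ‖H ζ‖ₑ ^ 2) hc,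
    ENNReal.mul_rpow_of_nonneg _ _ (by norm_num), finrank_spaceTime,
    ENNReal.ofReal_rpow_of_nonneg (by positivity) (by norm_num)]
  congr 2
  rw [← Real.rpow_natCast, ← Real.rpow_neg hc.le, ← Real.rpow_mul hc.le]
  congr 1; push_cast; ring

/-- Scale invariance of the `L² → L^q_t L^r_x` bound for homogeneous multipliers. -/
theorem FourierBoundedWith.dilate {q r : ℝ} (hq : 0 < q) (hr : 0 < r) {C : ℝ≥0}
    {m m' : SpaceTime d → ℂ} (h : FourierBoundedWith d q r C m) {c : ℝ} (hc : 0 < c)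
    (hm : ∀ ζ, m' (c • ζ) = (c ^ ((d : ℝ) / r + 1 / q - (d + 1) / 2) : ℝ) * m ζ) :
    FourierBoundedWith d q r C m' := by
  intro H hH
  have hn := eLpNorm_comp_smul_two H hc
  have hHc : MemLp (fun ζ => H (c • ζ)) 2 volume := by
    refine ⟨?_, by rw [hn]; exact ENNReal.mul_lt_top ENNReal.ofReal_lt_top hH.2⟩
    have hq : Measure.QuasiMeasurePreserving (fun ζ : SpaceTime d => c • ζ) volume volume := by
      refine ⟨measurable_const_smul c, ?_⟩
      rw [Measure.map_addHaar_smul volume hc.ne']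
      exact Measure.smul_absolutelyContinuous
    exact hH.1.comp_quasiMeasurePreserving hq
  obtain ⟨G, hG, hb⟩ := h _ hHc
  set s := (d : ℝ) / r + 1 / q with hs
  -- The prefactor combines the Jacobian c^(d+1) of the Fourier transform with the homogeneity
  -- c^(s-(d+1)/2). It is exactly cancelled by c^(-s) from the mixed norm and c^(-(d+1)/2) from the
  -- L² norm.
  refine ⟨fun z => ((c ^ (s + (d + 1) / 2) : ℝ) : ℂ) * G (c • z),
    ((hG.dilate hc).const_mul _).congr (Filter.EventuallyEq.refl _ _)
      (Filter.Eventually.of_forall fun ζ => ?_), ?_⟩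
  · have h1 := hm (c⁻¹ • ζ)
    rw [smul_inv_smul₀ hc.ne'] at h1
    simp only [smul_inv_smul₀ hc.ne']
    rw [h1, ← mul_assoc, ← mul_assoc, ← Complex.ofReal_mul]
    congr 3
    rw [← Real.rpow_natCast, ← Real.rpow_neg hc.le, ← Real.rpow_add hc]
    congr 1; push_cast; ring
  · rw [mixedNorm_const_mul hq hr, mixedNorm_dilate hq hr, ← ofReal_norm, Complex.norm_real,
      Real.norm_of_nonneg (by positivity), ← mul_assoc, ← ENNReal.ofReal_mul (by positivity),
      ← Real.rpow_add hc]
    calc _ ≤ ENNReal.ofReal (c ^ (s + (d + 1) / 2 + -s)) *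
          (C * (ENNReal.ofReal (c ^ (-((d + 1 : ℝ) / 2))) * eLpNorm H 2 volume)) := by
          rw [← hn]; gcongr
      _ = (ENNReal.ofReal (c ^ (s + (d + 1) / 2 + -s)) *
          ENNReal.ofReal (c ^ (-((d + 1 : ℝ) / 2)))) * (C * eLpNorm H 2 volume) := by ring
      _ = _ := by
          rw [← ENNReal.ofReal_mul (by positivity), ← Real.rpow_add hc]
          ring_nf
          simp
    exact hc

/-- A multiplier supported in the cone which is bounded on a sequence of adjacent shells is bounded
on their union. -/
theorem exists_fourierBoundedWith_shell {q r lam : ℝ} (hq : 2 ≤ q) (hr : 2 ≤ r) (hlam : 1 < lam)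
    {C : ℝ≥0} {M : SpaceTime d → ℂ} (hM : Measurable M) (hcone : ∀ ζ, M ζ ≠ 0 → |ζ.snd| < ‖ζ.fst‖)
    (h : ∀ R : ℝ, 0 < R → FourierBoundedWith d q r C
      ((frequencyShell d R (R * lam)).indicator M)) :
    ∃ C' : ℝ≥0, ∀ R : ℝ, 0 < R → ∀ n : ℕ, FourierBoundedWith d q r C'
      ((frequencyShell d R (R * lam ^ n)).indicator M) := by
  obtain ⟨K, hK⟩ := exists_mixedNorm_sum_sq_le d hq hr hlam
  refine ⟨NNReal.sqrt K * C, fun R hR n H hH => ?_⟩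
  have hq1 : 1 < q := by linarith
  have hr1 : 1 < r := by linarith
  set S : ℕ → Set (SpaceTime d) := fun i => frequencyShell d (R * lam ^ i) (R * lam ^ (i + 1))
    with hS
  have hSm : ∀ i, MeasurableSet (S i) := fun i => measurableSet_frequencyShell _ _
  have hlam0 : 0 < lam := by linarith
  have hb : ∀ i, FourierBoundedWith d q r C ((S i).indicator M) := fun i => by
    have := h (R * lam ^ i) (by positivity)
    rwa [mul_assoc, ← pow_succ] at this
  -- A shell is unbounded in τ, but its part inside the cone is bounded, so some Schwartz function
  -- equals one there and local square integrability becomes global. The products with H are then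
  -- integrable and have pointwise inverse transforms.
  have hL2 : ∀ i, MemLp ((S i).indicator M) 2 volume := by
    intro i
    obtain ⟨ψ, hψ⟩ := exists_schwartz_eq_one_on_closedBall (V := SpaceTime d)
      (show 0 < 2 * (R * lam ^ (i + 1)) by positivity)
    have h1 := (hb i).memLp_mul_schwartz hq1 hr1 (hM.indicator (hSm i)) ψ
    convert h1 using 1
    ext ζ
    by_cases h0 : (S i).indicator M ζ = 0
    · simp [h0]
    · have hζ : ζ ∈ S i := Set.mem_of_indicator_ne_zero h0
      have h2 := hcone ζ (by rwa [Set.indicator_of_mem hζ] at h0)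
      have h3 : ‖ζ‖ ≤ ‖ζ.fst‖ + ‖ζ.snd‖ := by
        have := WithLp.prod_norm_sq_eq_of_L2 ζ
        exact abs_le_of_sq_le_sq' (by nlinarith [norm_nonneg ζ.fst, norm_nonneg ζ.snd])
          (by positivity) |>.2
      rw [hψ ζ (by have := hζ.2; rw [Real.norm_eq_abs] at h3; linarith), mul_one]
  set a : ℕ → SpaceTime d → ℂ := fun i ζ => (S i).indicator M ζ * H ζ with ha
  have hai : ∀ i, Integrable (a i) := fun i => MemLp.integrable_mul (hL2 i) hH
  have hpiece : ∀ i, mixedNorm q r (inverseFourier (a i)) ≤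
      C * eLpNorm ((S i).indicator H) 2 volume := by
    intro i
    obtain ⟨G, hG, hn⟩ := hb i ((S i).indicator H) (hH.indicator (hSm i))
    have e : (fun ζ => (S i).indicator M ζ * (S i).indicator H ζ) = a i := by
      ext ζ
      by_cases hζ : ζ ∈ S i <;> simp [ha, hζ]
    rw [e] at hG
    rwa [mixedNorm_congr ((hasFourier_inverseFourier (hai i)).unique_left hG)]
  have hsum : (fun ζ => (frequencyShell d R (R * lam ^ n)).indicator M ζ * H ζ) =
      fun ζ => ∑ i ∈ Finset.range n, a i ζ := by
    ext ζ
    simp only [ha, ← Finset.sum_mul]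
    rw [sum_indicator_frequencyShell hR hlam]
  refine ⟨fun z => ∑ i ∈ Finset.range n, inverseFourier (a i) z, ?_, ?_⟩
  · rw [hsum, ← inverseFourier_sum _ fun i _ => hai i]
    exact hasFourier_inverseFourier (integrable_finsetSum _ fun i _ => hai i)
  -- Orthogonality of the inputs on disjoint shells matches the sum of squares from
  -- Littlewood–Paley.
  have horth : ∑ i ∈ Finset.range n, eLpNorm ((S i).indicator H) 2 volume ^ 2 ≤
      eLpNorm H 2 volume ^ 2 := by
    have e1 : ∀ F : SpaceTime d → ℂ, eLpNorm F 2 volume ^ 2 = ∫⁻ ζ, ‖F ζ‖ₑ ^ 2 := fun F => by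
      rw [eLpNorm_two_eq, ← ENNReal.rpow_natCast, ← ENNReal.rpow_mul]; simp
    have e2 : ∀ (i : ℕ) (ζ : SpaceTime d), ‖(S i).indicator H ζ‖ₑ ^ 2 =
        (S i).indicator (fun ζ => ‖H ζ‖ₑ ^ 2) ζ := fun i ζ => by
      by_cases hζ : ζ ∈ S i <;> simp [hζ]
    simp_rw [e1, e2]
    rw [← lintegral_finsetSum' _ fun i _ => (hH.1.enorm.pow_const 2).indicator (hSm i)]
    refine lintegral_mono fun ζ => ?_
    rw [sum_indicator_frequencyShell hR hlam]
    exact Set.indicator_le_self _ _ _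
  have h2 : mixedNorm q r (fun z => ∑ i ∈ Finset.range n, inverseFourier (a i) z) ^ 2 ≤
      ((NNReal.sqrt K * C : ℝ≥0) * eLpNorm H 2 volume) ^ 2 := by
    calc _ ≤ K * ∑ i ∈ Finset.range n, mixedNorm q r (inverseFourier (a i)) ^ 2 :=
          hK R hR n a hai fun i ζ hne => by
            have hζ : ζ ∈ S i := Set.mem_of_indicator_ne_zero (left_ne_zero_of_mul hne)
            exact ⟨hζ.1, hζ.2.le⟩
      _ ≤ K * ∑ i ∈ Finset.range n, (C * eLpNorm ((S i).indicator H) 2 volume) ^ 2 := by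
          gcongr with i
          exact hpiece i
      _ = K * C ^ 2 * ∑ i ∈ Finset.range n, eLpNorm ((S i).indicator H) 2 volume ^ 2 := by
          simp_rw [mul_pow]
          rw [← Finset.mul_sum, mul_assoc]
      _ ≤ K * C ^ 2 * eLpNorm H 2 volume ^ 2 := by gcongr
      _ = _ := by
          rw [ENNReal.coe_mul, mul_pow, mul_pow, ← ENNReal.coe_pow (NNReal.sqrt K), NNReal.sq_sqrt]
  exact (ENNReal.pow_le_pow_left_iff (by norm_num)).1 h2

end MixedLittlewoodPaley

/-! ### From truncated multipliers to the full multiplier -/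

section Globalisation

open Filter Topology

variable {d : ℕ}

theorem HasFourier.sub {u u' U U' : SpaceTime d → ℂ} (h : HasFourier u U) (h' : HasFourier u' U') :
    HasFourier (u - u') (U - U') := by
  refine ⟨h.1.sub h'.1, h.2.1.sub h'.2.1, fun ψ => ?_⟩
  have e := h.2.2 ψ
  have e' := h'.2.2 ψ
  rw [fourierInt_schwartz] at e e' ⊢
  simp only [Pi.sub_apply, sub_mul]
  rw [integral_sub (h.2.1 ψ) (h'.2.1 ψ), integral_sub (h.1 _) (h'.1 _), e, e']

theorem tendsto_eLpNorm_indicator_compl {S : ℕ → Set (SpaceTime d)} (hS : ∀ N, MeasurableSet (S N))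
    (hmono : Monotone S) (hcov : ∀ᵐ ζ, ∃ N, ζ ∈ S N) {H : SpaceTime d → ℂ}
    (hH : MemLp H 2 volume) :
    Tendsto (fun N => eLpNorm ((S N)ᶜ.indicator H) 2 volume) atTop (𝓝 0) := by
  have hfin : ∫⁻ ζ, ‖H ζ‖ₑ ^ 2 ≠ ⊤ := by
    intro htop
    have := hH.2
    rw [eLpNorm_two_eq, htop] at this
    simp at this
  have h1 : Tendsto (fun N => ∫⁻ ζ, ‖(S N)ᶜ.indicator H ζ‖ₑ ^ 2) atTop
      (𝓝 (∫⁻ _ : SpaceTime d, 0)) := by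
    refine tendsto_lintegral_of_dominated_convergence' (fun ζ => ‖H ζ‖ₑ ^ 2)
      (fun N => ((hH.1.indicator (hS N).compl).enorm.pow_const 2))
      (fun N => Eventually.of_forall fun ζ => ?_) hfin ?_
    · by_cases hζ : ζ ∈ (S N)ᶜ <;> simp [hζ]
    · filter_upwards [hcov] with ζ ⟨N, hN⟩
      refine tendsto_const_nhds.congr' ?_
      filter_upwards [eventually_ge_atTop N] with n hn
      rw [Set.indicator_of_notMem (by simpa using hmono hn hN)]
      simp
  rw [lintegral_zero] at h1
  have h2 := (ENNReal.continuous_rpow_const (y := (1 / 2 : ℝ))).tendsto 0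
  rw [ENNReal.zero_rpow_of_pos (by norm_num)] at h2
  simp_rw [eLpNorm_two_eq]
  exact h2.comp h1

/-- The local square integrability bound depends on the multiplier only through its norm, so it is
uniform along the exhaustion and passes to the limit by monotone convergence. It guarantees that m H
is tempered, which belongs to the claim of boundedness. -/
theorem memLp_mul_schwartz_of_monotone {q r : ℝ} (hq : 1 < q) (hr : 1 < r) {C : ℝ≥0}
    {m : SpaceTime d → ℂ} (hm : Measurable m) {S : ℕ → Set (SpaceTime d)}
    (hS : ∀ N, MeasurableSet (S N)) (hmono : Monotone S) (hcov : ∀ᵐ ζ, ∃ N, ζ ∈ S N)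
    (h : ∀ N, FourierBoundedWith d q r C ((S N).indicator m)) (ψ : 𝓢(SpaceTime d, ℂ)) :
    MemLp (fun ζ => m ζ * ψ ζ) 2 volume := by
  obtain ⟨K, hK⟩ := exists_lintegral_mul_schwartz_sq_le (d := d) hq hr ψ
  refine ⟨(hm.mul ψ.continuous.measurable).aestronglyMeasurable, ?_⟩
  rw [eLpNorm_two_eq]
  refine ENNReal.rpow_lt_top_of_nonneg (by norm_num) (ne_top_of_le_ne_top
    (ENNReal.pow_ne_top ENNReal.coe_ne_top : ((K * C : ℝ≥0) : ℝ≥0∞) ^ 2 ≠ ⊤) ?_)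
  have hU : (⋃ N, S N : Set (SpaceTime d)) =ᵐ[volume] Set.univ := by
    rw [eventuallyEq_univ]
    filter_upwards [hcov] with ζ hζ
    exact Set.mem_iUnion.2 hζ
  rw [← setLIntegral_univ, ← setLIntegral_congr hU,
    setLIntegral_iUnion_of_directed _ hmono.directed_le]
  refine iSup_le fun N => ?_
  rw [← lintegral_indicator (hS N)]
  refine le_trans (lintegral_mono fun ζ => ?_) (hK C _ (hm.indicator (hS N)) (h N))
  by_cases hζ : ζ ∈ S N <;> simp [hζ]

/-- A multiplier is bounded if its restrictions to an exhausting sequence of sets are uniformly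
bounded. -/
theorem FourierBoundedWith.of_monotone {q r : ℝ} (hq : 1 < q) (hr : 1 < r) {C : ℝ≥0}
    {m : SpaceTime d → ℂ} (hm : Measurable m) {S : ℕ → Set (SpaceTime d)}
    (hS : ∀ N, MeasurableSet (S N)) (hmono : Monotone S) (hcov : ∀ᵐ ζ, ∃ N, ζ ∈ S N)
    (h : ∀ N, FourierBoundedWith d q r C ((S N).indicator m)) : FourierBoundedWith d q r C m := by
  intro H hH
  have hq0 : 0 < q := by linarith
  have hr0 : 0 < r := by linarith
  have hL2 := memLp_mul_schwartz_of_monotone hq hr hm hS hmono hcov h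
  have hmH : IsTempered (fun ζ => m ζ * H ζ) := fun ψ =>
    ((hL2 ψ).integrable_mul (q := 2) hH).congr
      (Eventually.of_forall fun ζ => by simp only [Pi.mul_apply]; ring)
  choose G hG hGn using fun N => h N H hH
  have hGm : ∀ N, AEStronglyMeasurable (G N) := fun N => (hG N).1.aestronglyMeasurable
  set ε : ℕ → ℝ≥0∞ := fun N => eLpNorm ((S N)ᶜ.indicator H) 2 volume with hε
  have hεlim : Tendsto ε atTop (𝓝 0) := tendsto_eLpNorm_indicator_compl hS hmono hcov hH
  -- The difference of two truncated images is the image of the part of H outside `S N`, whose L²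
  -- norm tends to zero; hence the images form a Cauchy sequence in the mixed norm.
  have hdiff1 : ∀ N n, N ≤ n → mixedNorm q r (G n - G N) ≤ C * ε N := by
    intro N n hn
    obtain ⟨G', hG', hb⟩ := h n _ (hH.indicator (hS N).compl)
    have e : (fun ζ => (S n).indicator m ζ * (S N)ᶜ.indicator H ζ) =
        (fun ζ => (S n).indicator m ζ * H ζ) - fun ζ => (S N).indicator m ζ * H ζ := by
      ext ζ
      by_cases h1 : ζ ∈ S N
      · simp [h1, hmono hn h1]
      · simp [h1]
    rw [e] at hG'
    rwa [mixedNorm_congr (((hG n).sub (hG N)).unique_left hG')]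
  have hdiff : ∀ N n k, N ≤ n → N ≤ k → mixedNorm q r (G n - G k) ≤ C * ε N := by
    have hanti : ∀ N n, N ≤ n → ε n ≤ ε N := fun N n hn => eLpNorm_mono fun ζ => by
      by_cases h1 : ζ ∈ S n
      · simp [h1]
      · have h2 : ζ ∉ S N := fun h2 => h1 (hmono hn h2)
        simp [h1, h2]
    intro N n k hn hk
    rcases le_total k n with hkn | hkn
    · exact (hdiff1 k n hkn).trans (by gcongr; exact hanti N k hk)
    · refine le_trans ?_ ((hdiff1 n k hkn).trans (by gcongr; exact hanti N n hn))
      refine mixedNorm_mono hq0 hr0 fun z => ?_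
      rw [Pi.sub_apply, Pi.sub_apply, enorm_sub_rev]
  -- an almost everywhere convergent subsequence
  obtain ⟨K, hK⟩ := exists_lintegral_decayWeight_le (d := d) hq hr
  have hKlim : Tendsto (fun N => (K : ℝ≥0∞) * (C * ε N)) atTop (𝓝 0) := by
    have h1 := ENNReal.Tendsto.const_mul (ENNReal.Tendsto.const_mul hεlim
      (Or.inr (ENNReal.coe_ne_top (r := C)))) (Or.inr (ENNReal.coe_ne_top (r := K)))
    simpa using h1
  obtain ⟨φ, hφ, hφε⟩ := extraction_forall_of_eventually'
    (P := fun j N => (K : ℝ≥0∞) * (C * ε N) < 2⁻¹ ^ j) fun j =>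
      (hKlim.eventually_lt_const (by simp [pos_iff_ne_zero])).exists_forall_of_atTop
  -- In L¹(ν) the subsequence is Cauchy at a geometric rate, so it converges ν-almost everywhere;
  -- the weight is positive, so ν has the same null sets as Lebesgue measure.
  set ν : Measure (SpaceTime d) := volume.withDensity fun z => ENNReal.ofReal (decayWeight z)
  have hνν : ∀ᵐ z, ∃ l : ℂ, Tendsto (fun j => G (φ j) z) atTop (𝓝 l) := by
    have hwm : Measurable fun z : SpaceTime d => ENNReal.ofReal (decayWeight z) :=
      measurable_decayWeight.ennreal_ofReal
    have hac : (volume : Measure (SpaceTime d)) ≪ ν :=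
      withDensity_absolutelyContinuous' hwm.aemeasurable (Eventually.of_forall fun z => by
        simpa using decayWeight_pos z)
    have hac' : ν ≪ volume := withDensity_absolutelyContinuous _ _
    refine hac.ae_le (Lp.ae_tendsto_of_cauchy_eLpNorm (p := 1) (B := fun j => 2⁻¹ ^ j)
      (fun j => (hGm (φ j)).mono_ac hac') le_rfl ?_ fun j n k hn hk => ?_)
    · rw [ENNReal.tsum_geometric, ENNReal.one_sub_inv_two, inv_inv]
      finiteness
    · refine lt_of_le_of_lt ?_ (hφε j)
      rw [eLpNorm_one_eq_lintegral_enorm]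
      have h1 := hdiff (φ j) (φ n) (φ k) (hφ.monotone hn) (hφ.monotone hk)
      have h2 := hK _ ((hGm (φ n)).sub (hGm (φ k)))
      refine le_trans (le_of_eq ?_) (h2.trans (by gcongr))
      rw [lintegral_withDensity_eq_lintegral_mul₀' hwm.aemeasurable
        (((hGm (φ n)).sub (hGm (φ k))).mono_ac hac').enorm]
      congr 1; ext z
      rw [Pi.mul_apply, mul_comm]
  obtain ⟨F, hFm, hF⟩ := exists_stronglyMeasurable_limit_of_tendsto_ae (fun j => hGm (φ j)) hνν
  have hFn : mixedNorm q r F ≤ C * eLpNorm H 2 volume :=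
    mixedNorm_le_of_tendsto hq0 hr0 (fun j => hGm (φ j)) hF fun j => hGn _
  have hFd : ∀ j, mixedNorm q r (G (φ j) - F) ≤ C * ε (φ j) := by
    intro j
    refine mixedNorm_le_of_tendsto hq0 hr0 (G := fun i => G (φ j) - G (φ (i + j)))
      (fun i => (hGm _).sub (hGm _)) ?_ fun i =>
        hdiff _ _ _ le_rfl (hφ.monotone (Nat.le_add_left j i))
    filter_upwards [hF] with z hz
    exact tendsto_const_nhds.sub (hz.comp (tendsto_add_atTop_nat j))
  have hFt : IsTempered F := isTempered_of_mixedNorm_ne_top hq hr hFm.aestronglyMeasurable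
    (ne_top_of_le_ne_top (ENNReal.mul_ne_top ENNReal.coe_ne_top hH.2.ne) hFn)
  refine ⟨F, ⟨hFt, hmH, fun ψ => ?_⟩, hFn⟩
  rw [fourierInt_schwartz]
  set χ := schwartzFourier ψ
  -- The pairing identity is passed to the limit on both sides: here by mixed norm convergence, and
  -- on the frequency side by dominated convergence.
  have hlim1 : Tendsto (fun j => ∫ z, G (φ j) z * χ z) atTop (𝓝 (∫ z, F z * χ z)) := by
    obtain ⟨K', hK'⟩ := exists_lintegral_mul_schwartz_le (d := d) hq hr χ
    refine tendsto_integral_of_L1 _ (hFt χ).1 (Eventually.of_forall fun j => (hG (φ j)).1 χ) ?_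
    have h1 : Tendsto (fun j => (K' : ℝ≥0∞) * (C * ε (φ j))) atTop (𝓝 0) := by
      have h1 := ENNReal.Tendsto.const_mul (ENNReal.Tendsto.const_mul
        (hεlim.comp hφ.tendsto_atTop)
        (Or.inr (ENNReal.coe_ne_top (r := C)))) (Or.inr (ENNReal.coe_ne_top (r := K')))
      simpa using h1
    refine tendsto_of_tendsto_of_tendsto_of_le_of_le tendsto_const_nhds h1
      (fun _ => zero_le) fun j => ?_
    have h2 := hK' _ ((hGm (φ j)).sub hFm.aestronglyMeasurable)
    simp only [Pi.sub_apply, sub_mul] at h2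
    exact h2.trans (by gcongr; exact hFd j)
  have hlim2 : Tendsto (fun j => ∫ ζ, (S (φ j)).indicator m ζ * H ζ * ψ ζ) atTop
      (𝓝 (∫ ζ, m ζ * H ζ * ψ ζ)) := by
    refine tendsto_integral_of_dominated_convergence (fun ζ => ‖m ζ * H ζ * ψ ζ‖)
      (fun j => ((hG (φ j)).2.1 ψ).1) (hmH ψ).norm (fun j => Eventually.of_forall fun ζ => ?_) ?_
    · by_cases hζ : ζ ∈ S (φ j)
      · simp [hζ]
      · simp only [Set.indicator_of_notMem hζ, zero_mul, norm_zero]; positivity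
    · filter_upwards [hcov] with ζ ⟨N, hN⟩
      refine tendsto_const_nhds.congr' ?_
      filter_upwards [eventually_ge_atTop N] with n hn
      rw [Set.indicator_of_mem (hmono (hn.trans (hφ.id_le n)) hN)]
  refine tendsto_nhds_unique hlim2 (hlim1.congr fun j => ?_)
  rw [(hG (φ j)).2.2 ψ, fourierInt_schwartz]

/-- A homogeneous multiplier of the scale invariant degree, supported in the cone, is bounded as
soon as its restriction to one frequency shell is. -/
theorem FourierBounded.of_shell {q r : ℝ} (hq : 2 ≤ q) (hr : 2 ≤ r) {M : SpaceTime d → ℂ} (hd : 1 ≤ d)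
    (hM : Measurable M) (hcone : ∀ ζ, M ζ ≠ 0 → |ζ.snd| < ‖ζ.fst‖)
    (hhom : ∀ c : ℝ, 0 < c → ∀ ζ,
      M (c • ζ) = (c ^ ((d : ℝ) / r + 1 / q - (d + 1) / 2) : ℝ) * M ζ)
    {a b : ℝ} (ha : 0 < a) (hab : a < b)
    (h : FourierBounded d q r ((frequencyShell d a b).indicator M)) : FourierBounded d q r M := by
  obtain ⟨C, hC⟩ := h
  set lam := b / a with hlamdef
  have hlam : 1 < lam := (one_lt_div ha).2 hab
  have hlam0 : 0 < lam := by linarith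
  have hstep : ∀ R : ℝ, 0 < R → FourierBoundedWith d q r C
      ((frequencyShell d R (R * lam)).indicator M) := by
    intro R hR
    refine hC.dilate (by linarith) (by linarith) (c := R / a) (by positivity) fun ζ => ?_
    have hiff : (R / a) • ζ ∈ frequencyShell d R (R * lam) ↔ ζ ∈ frequencyShell d a b := by
      have hc : 0 < R / a := by positivity
      have e : ‖((R / a) • ζ).fst‖ = R / a * ‖ζ.fst‖ := by
        rw [WithLp.smul_fst, norm_smul, Real.norm_of_nonneg hc.le]
      change R ≤ ‖((R / a) • ζ).fst‖ ∧ ‖((R / a) • ζ).fst‖ < R * lam ↔ a ≤ ‖ζ.fst‖ ∧ ‖ζ.fst‖ < b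
      rw [e, hlamdef, show R = R / a * a by field_simp, show R / a * a * (b / a) = R / a * b by
        field_simp, show R / a * a / a = R / a by field_simp,
        mul_le_mul_iff_right₀ hc, mul_lt_mul_iff_right₀ hc]
    by_cases hζ : ζ ∈ frequencyShell d a b
    · rw [Set.indicator_of_mem hζ, Set.indicator_of_mem (hiff.2 hζ), hhom _ (by positivity)]
    · rw [Set.indicator_of_notMem hζ, Set.indicator_of_notMem (fun h => hζ (hiff.1 h)), mul_zero]
  obtain ⟨C', hC'⟩ := exists_fourierBoundedWith_shell hq hr hlam hM hcone hstep
  have hR : ∀ N : ℕ, 0 < (lam ^ N)⁻¹ := fun N => by positivity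
  have hpow : ∀ N : ℕ, (lam ^ N)⁻¹ * lam ^ (2 * N) = lam ^ N := fun N => by
    rw [two_mul, pow_add, inv_mul_cancel_left₀ (by positivity)]
  -- The exhausting shells lam^(-N) ≤ |ξ| < lam^N consist of 2N adjacent steps of ratio lam, and
  -- they cover everything except the null set ξ = 0.
  refine ⟨C', FourierBoundedWith.of_monotone (by linarith) (by linarith) hM
    (S := fun N => frequencyShell d (lam ^ N)⁻¹ (lam ^ N))
    (fun N => measurableSet_frequencyShell _ _) (fun N n hn ζ hζ => ?_) ?_ fun N => ?_⟩
  · have h1 : lam ^ N ≤ lam ^ n := pow_le_pow_right₀ hlam.le hn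
    exact ⟨le_trans (inv_anti₀ (by positivity) h1) hζ.1, hζ.2.trans_le h1⟩
  · have hne : ∀ᵐ ζ : SpaceTime d, ζ.fst ≠ 0 := by
      have h1 : ∀ᵐ ξ : Space d, ξ ≠ 0 := by
        have : Nonempty (Fin d) := ⟨⟨0, by omega⟩⟩
        rw [ae_iff]; simp
      exact (WithLp.volume_preserving_ofLp (Space d) ℝ).quasiMeasurePreserving.ae
        (Measure.quasiMeasurePreserving_fst.ae h1)
    filter_upwards [hne] with ζ hζ
    have hpos : 0 < ‖ζ.fst‖ := norm_pos_iff.2 hζ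
    obtain ⟨n, hn⟩ := pow_unbounded_of_one_lt ‖ζ.fst‖ hlam
    obtain ⟨k, hk⟩ := pow_unbounded_of_one_lt ‖ζ.fst‖⁻¹ hlam
    refine ⟨max n k, ?_, hn.trans_le (pow_le_pow_right₀ hlam.le (le_max_left _ _))⟩
    rw [inv_le_comm₀ (by positivity) hpos]
    exact hk.le.trans (pow_le_pow_right₀ hlam.le (le_max_right _ _))
  · have := hC' _ (hR N) (2 * N)
    rwa [hpow] at this

end Globalisation

/-! ### Pointwise comparison of the multipliers -/

section Comparison

variable {d : ℕ}

/-- A power is monotone in one direction or the other, so the sum of the endpoint values serves for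
either sign of p. -/
theorem rpow_le_rpow_add_rpow {a b x : ℝ} (p : ℝ) (ha : 0 < a) (hax : a ≤ x) (hxb : x ≤ b) :
    x ^ p ≤ a ^ p + b ^ p := by
  have h1 : 0 ≤ a ^ p := by positivity
  have h2 : 0 ≤ b ^ p := Real.rpow_nonneg (by linarith) p
  rcases le_total 0 p with hp | hp
  · linarith [Real.rpow_le_rpow (by linarith) hxb hp]
  · linarith [Real.rpow_le_rpow_of_nonpos ha hax hp]

/-- The multiplier `|ξ|^γ (1 - τ²/|ξ|²)₊^α`. -/
def homogeneousCone (γ α : ℝ) (ζ : SpaceTime d) : ℂ :=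
  if |ζ.snd| < ‖ζ.fst‖ then ((‖ζ.fst‖ ^ γ * (1 - ζ.snd ^ 2 / ‖ζ.fst‖ ^ 2) ^ α : ℝ) : ℂ) else 0

theorem measurableSet_cone : MeasurableSet {ζ : SpaceTime d | |ζ.snd| < ‖ζ.fst‖} :=
  measurableSet_lt measurable_snd_spaceTime.norm measurable_fst_spaceTime.norm

theorem measurable_homogeneousCone (γ α : ℝ) : Measurable (homogeneousCone (d := d) γ α) := by
  have h1 := measurable_fst_spaceTime (d := d)
  have h2 := measurable_snd_spaceTime (d := d)
  refine Measurable.ite measurableSet_cone (Complex.measurable_ofReal.comp ?_) measurable_const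
  fun_prop

theorem measurable_coneMultiplier {φ : ℝ → ℂ} (hφ : Continuous φ) (α : ℝ) :
    Measurable (coneMultiplier (d := d) φ α) := by
  have h1 := measurable_fst_spaceTime (d := d)
  have h2 := measurable_snd_spaceTime (d := d)
  refine Measurable.ite measurableSet_cone (Measurable.mul (Complex.measurable_ofReal.comp ?_)
    (hφ.measurable.comp h1.norm)) measurable_const
  fun_prop

theorem measurable_hyperbolicMultiplier (βp βm : ℝ) :
    Measurable (hyperbolicMultiplier (d := d) βp βm) := by
  have h1 := measurable_fst_spaceTime (d := d)
  have h2 := measurable_snd_spaceTime (d := d)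
  refine Complex.measurable_ofReal.comp ?_
  have h3 : Measurable fun ζ : SpaceTime d => |ζ.snd| := h2.norm
  have h4 : Measurable fun ζ : SpaceTime d => abs (‖ζ.fst‖ - |ζ.snd|) := (h1.norm.sub h3).norm
  exact ((h1.norm.add h3).pow_const _).mul (h4.pow_const _)

theorem homogeneousCone_smul (γ α : ℝ) {c : ℝ} (hc : 0 < c) (ζ : SpaceTime d) :
    homogeneousCone γ α (c • ζ) = (c ^ γ : ℝ) * homogeneousCone γ α ζ := by
  have e1 : ‖(c • ζ).fst‖ = c * ‖ζ.fst‖ := by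
    rw [WithLp.smul_fst, norm_smul, Real.norm_of_nonneg hc.le]
  have e2 : (c • ζ).snd = c * ζ.snd := by rw [WithLp.smul_snd, smul_eq_mul]
  unfold homogeneousCone
  rw [e1, e2, abs_mul, abs_of_pos hc]
  simp_rw [mul_lt_mul_iff_right₀ hc]
  split_ifs with h
  · rw [← Complex.ofReal_mul, Real.mul_rpow hc.le (norm_nonneg _), mul_pow, mul_pow,
      mul_div_mul_left _ _ (by positivity), mul_assoc]
  · simp

/-- With s = |τ|/|ξ| one has 1 - τ²/|ξ|² = (1 + s)(1 - s), and only 1 - s degenerates at the cone.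
The exponents α and γ arise by adding those of √κ, namely (d-3)/4 on 1 - τ²/|ξ|² and -1/2 on |ξ|. -/
theorem hyperbolicMultiplier_mul_sqrt_coneDensity (βp βm : ℝ) (ζ : SpaceTime d)
    (h : |ζ.snd| < ‖ζ.fst‖) :
    hyperbolicMultiplier βp βm ζ * (√(coneDensity d ζ) : ℂ) =
      ((√(d * ballMoment (d - 1)).toReal * (1 + |ζ.snd| / ‖ζ.fst‖) ^ (βp - βm) : ℝ) : ℂ) *
        homogeneousCone (βp + βm - 1 / 2) (βm + ((d : ℝ) - 3) / 4) ζ := by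
  unfold hyperbolicMultiplier coneDensity homogeneousCone
  rw [if_pos h, if_pos h, ← Complex.ofReal_mul, ← Complex.ofReal_mul]
  congr 1
  have hw := one_sub_div_sq_pos h
  set R := ‖ζ.fst‖
  set τ := ζ.snd
  have hR : 0 < R := (abs_nonneg _).trans_lt h
  set s := |τ| / R with hs
  have hs0 : 0 ≤ s := by positivity
  have hs1 : s < 1 := (div_lt_one hR).2 h
  have hτ : |τ| = R * s := by rw [hs]; field_simp
  have hws : 1 - τ ^ 2 / R ^ 2 = (1 + s) * (1 - s) := by
    rw [← sq_abs τ, hτ]; field_simp; ring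
  have e1 : R + |τ| = R * (1 + s) := by rw [hτ]; ring
  have e2 : abs (R - |τ|) = R * (1 - s) := by
    rw [abs_of_pos (by linarith), hτ]; ring
  set w := 1 - τ ^ 2 / R ^ 2 with hwdef
  have h1s : 0 < 1 - s := by linarith
  have h1s' : 0 < 1 + s := by linarith
  have e3 : √((d * ballMoment (d - 1)).toReal * (R⁻¹ * w ^ (((d : ℝ) - 3) / 2))) =
      √(d * ballMoment (d - 1)).toReal * (R ^ (-(1 / 2) : ℝ) * w ^ (((d : ℝ) - 3) / 4)) := by
    rw [Real.sqrt_mul ENNReal.toReal_nonneg, Real.sqrt_mul (by positivity), Real.sqrt_eq_rpow R⁻¹,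
      Real.sqrt_eq_rpow (w ^ _), ← Real.rpow_mul hw.le, Real.inv_rpow hR.le, ← Real.rpow_neg hR.le]
    congr 3
    ring
  rw [e1, e2, e3, Real.mul_rpow hR.le h1s'.le, Real.mul_rpow hR.le h1s.le,
    Real.rpow_add hw, show βp + βm - 1 / 2 = βp + (βm + -(1 / 2)) by ring, Real.rpow_add hR,
    Real.rpow_add hR, Real.rpow_sub h1s']
  have e4 : w ^ βm = (1 + s) ^ βm * (1 - s) ^ βm := by
    rw [hws, Real.mul_rpow h1s'.le h1s.le]
  rw [e4]
  have : (1 + s) ^ βm ≠ 0 := (Real.rpow_pos_of_pos h1s' _).ne'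
  field_simp

theorem coneDensity_const_pos (hd : 2 ≤ d) : 0 < √(d * ballMoment (d - 1)).toReal := by
  refine Real.sqrt_pos.2 (ENNReal.toReal_pos (mul_ne_zero ?_ (ballMoment_ne_zero (by omega))) ?_)
  · exact_mod_cast (by omega : d ≠ 0)
  · exact ENNReal.mul_ne_top (by finiteness) (ballMoment_ne_top _)

theorem norm_homogeneousCone {γ α : ℝ} {ζ : SpaceTime d} (h : |ζ.snd| < ‖ζ.fst‖) :
    ‖homogeneousCone γ α ζ‖ = ‖ζ.fst‖ ^ γ * (1 - ζ.snd ^ 2 / ‖ζ.fst‖ ^ 2) ^ α := by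
  have := one_sub_div_sq_pos h
  rw [homogeneousCone, if_pos h, Complex.norm_real, Real.norm_of_nonneg (by positivity)]

theorem norm_coneMultiplier {φ : ℝ → ℂ} {α : ℝ} {ζ : SpaceTime d} (h : |ζ.snd| < ‖ζ.fst‖) :
    ‖coneMultiplier φ α ζ‖ = (1 - ζ.snd ^ 2 / ‖ζ.fst‖ ^ 2) ^ α * ‖φ ‖ζ.fst‖‖ := by
  have := one_sub_div_sq_pos h
  rw [coneMultiplier, if_pos h, norm_mul, Complex.norm_real, Real.norm_of_nonneg (by positivity)]

/-- The two multipliers dominate each other, because 1 + |τ|/|ξ| lies in [1, 2) on the cone, the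
constant in κ is positive, and both vanish off the cone. -/
theorem smoothingEstimate_iff_homogeneousCone (hd : 2 ≤ d) {q r βp βm : ℝ} :
    SmoothingEstimate d q r βp βm ↔ FourierBounded d q r
      (homogeneousCone (βp + βm - 1 / 2) (βm + ((d : ℝ) - 3) / 4)) := by
  have hm1 : Measurable fun ζ : SpaceTime d =>
      hyperbolicMultiplier βp βm ζ * (√(coneDensity d ζ) : ℂ) :=
    (measurable_hyperbolicMultiplier βp βm).mul
      (Complex.measurable_ofReal.comp measurable_coneDensity.sqrt)
  have hm2 := measurable_homogeneousCone (d := d) (βp + βm - 1 / 2) (βm + ((d : ℝ) - 3) / 4)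
  have hk := coneDensity_const_pos hd
  set k := √(d * ballMoment (d - 1)).toReal with hkdef
  have hs : ∀ {ζ : SpaceTime d} (p : ℝ), |ζ.snd| < ‖ζ.fst‖ →
      (1 + |ζ.snd| / ‖ζ.fst‖) ^ p ≤ 1 + 2 ^ p := by
    intro ζ p h
    have hR : 0 < ‖ζ.fst‖ := (abs_nonneg _).trans_lt h
    have h1 : |ζ.snd| / ‖ζ.fst‖ < 1 := (div_lt_one hR).2 h
    have h0 : 0 ≤ |ζ.snd| / ‖ζ.fst‖ := by positivity
    have := rpow_le_rpow_add_rpow (a := 1) (b := 2) (x := 1 + |ζ.snd| / ‖ζ.fst‖) p one_pos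
      (by linarith) (by linarith)
    rwa [Real.one_rpow] at this
  rw [smoothingEstimate_iff hd]
  constructor
  · intro H
    refine H.mono hm1 hm2 (K := ⟨k⁻¹ * (1 + 2 ^ (-(βp - βm))), by positivity⟩)
      (Filter.Eventually.of_forall fun ζ => ?_)
    change _ ≤ k⁻¹ * (1 + 2 ^ (-(βp - βm))) * _
    by_cases h : |ζ.snd| < ‖ζ.fst‖
    · have h0 : 0 < 1 + |ζ.snd| / ‖ζ.fst‖ := by positivity
      rw [hyperbolicMultiplier_mul_sqrt_coneDensity βp βm ζ h, norm_mul, Complex.norm_real,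
        Real.norm_of_nonneg (by positivity), ← mul_assoc]
      refine le_mul_of_one_le_left (norm_nonneg _) ?_
      calc (1 : ℝ) = (1 + |ζ.snd| / ‖ζ.fst‖) ^ (-(βp - βm)) *
            (1 + |ζ.snd| / ‖ζ.fst‖) ^ (βp - βm) := by
            rw [← Real.rpow_add h0, neg_add_cancel, Real.rpow_zero]
        _ ≤ (1 + 2 ^ (-(βp - βm))) * (1 + |ζ.snd| / ‖ζ.fst‖) ^ (βp - βm) := by
            gcongr
            exact hs _ h
        _ = _ := by rw [← hkdef]; field_simp
    · rw [homogeneousCone, if_neg h, norm_zero]; positivity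
  · intro H
    refine H.mono hm2 hm1 (K := ⟨k * (1 + 2 ^ (βp - βm)), by positivity⟩)
      (Filter.Eventually.of_forall fun ζ => ?_)
    change _ ≤ k * (1 + 2 ^ (βp - βm)) * _
    by_cases h : |ζ.snd| < ‖ζ.fst‖
    · rw [hyperbolicMultiplier_mul_sqrt_coneDensity βp βm ζ h, norm_mul, Complex.norm_real,
        Real.norm_of_nonneg (by positivity)]
      gcongr
      exact hs _ h
    · rw [coneDensity, if_neg h, Real.sqrt_zero, Complex.ofReal_zero, mul_zero, norm_zero]
      positivity

/-- On the support of φ the power |ξ|^γ is bounded below, so φ is dominated by a multiple of it;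
this direction holds for every γ. -/
theorem FourierBounded.coneMultiplier {q r γ α : ℝ} {φ : ℝ → ℂ} (hφ : Continuous φ)
    (hφsupp : tsupport φ ⊆ Set.Icc (1 / 2) 2)
    (h : FourierBounded d q r (homogeneousCone γ α)) :
    FourierBounded d q r (coneMultiplier φ α) := by
  have hcs : HasCompactSupport φ := isCompact_Icc.of_isClosed_subset (isClosed_tsupport φ) hφsupp
  obtain ⟨B, hB⟩ := hφ.bounded_above_of_compact_support hcs
  have hB0 : 0 ≤ B := (norm_nonneg _).trans (hB 0)
  refine h.mono (measurable_homogeneousCone γ α) (measurable_coneMultiplier hφ α)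
    (K := ⟨B * ((1 / 2) ^ (-γ) + 2 ^ (-γ)), by positivity⟩) (Filter.Eventually.of_forall fun ζ => ?_)
  change _ ≤ B * ((1 / 2) ^ (-γ) + 2 ^ (-γ)) * _
  by_cases hc : |ζ.snd| < ‖ζ.fst‖
  · have hw := one_sub_div_sq_pos hc
    rw [norm_coneMultiplier hc, norm_homogeneousCone hc]
    by_cases h0 : φ ‖ζ.fst‖ = 0
    · rw [h0, norm_zero, mul_zero]; positivity
    · obtain ⟨h1, h2⟩ := hφsupp (subset_tsupport φ h0)
      have hR : 0 < ‖ζ.fst‖ := by linarith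
      have h3 := rpow_le_rpow_add_rpow (-γ) (by norm_num) h1 h2
      calc _ = (1 - ζ.snd ^ 2 / ‖ζ.fst‖ ^ 2) ^ α * ‖φ ‖ζ.fst‖‖ *
            (‖ζ.fst‖ ^ (-γ) * ‖ζ.fst‖ ^ γ) := by
            rw [← Real.rpow_add hR, neg_add_cancel, Real.rpow_zero, mul_one]
        _ ≤ (1 - ζ.snd ^ 2 / ‖ζ.fst‖ ^ 2) ^ α * B *
            (((1 / 2) ^ (-γ) + 2 ^ (-γ)) * ‖ζ.fst‖ ^ γ) := by
            gcongr
            exact hB _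
        _ = _ := by ring
  · rw [VelocityAverage.coneMultiplier, if_neg hc, norm_zero]; positivity

/-- The cutoff controls the homogeneous multiplier on one shell where φ does not vanish, and scaling
with Littlewood–Paley extends this to all frequencies. The degree is forced by scale invariance. -/
theorem FourierBounded.homogeneousCone_of_coneMultiplier {q r α : ℝ} (hd : 1 ≤ d) (hq : 2 ≤ q)
    (hr : 2 ≤ r) {φ : ℝ → ℂ} (hφ : Continuous φ) (hφsupp : tsupport φ ⊆ Set.Icc (1 / 2) 2)
    (hφne : φ ≠ 0) (h : FourierBounded d q r (VelocityAverage.coneMultiplier φ α)) :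
    FourierBounded d q r (homogeneousCone ((d : ℝ) / r + 1 / q - (d + 1) / 2) α) := by
  set γ := (d : ℝ) / r + 1 / q - (d + 1) / 2
  obtain ⟨a, ha⟩ := Function.ne_iff.1 hφne
  have ha0 : 0 < a := by
    have := (hφsupp (subset_tsupport φ ha)).1
    linarith
  have hna : 0 < ‖φ a‖ := norm_pos_iff.2 ha
  -- By continuity |φ| exceeds half of |φ(a)| on a ≤ |ξ| < a + η, which is the shell used.
  obtain ⟨η, hη, hball⟩ := Metric.eventually_nhds_iff.1
    (hφ.norm.continuousAt.eventually_const_lt (half_lt_self hna))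
  have hshell := measurableSet_frequencyShell (d := d) a (a + η)
  have hm := measurable_homogeneousCone (d := d) γ α
  refine FourierBounded.of_shell hq hr hd hm (fun ζ hζ => ?_)
    (fun c hc ζ => homogeneousCone_smul γ α hc ζ) ha0 (lt_add_of_pos_right a hη) ?_
  · by_contra hcon
    exact hζ (if_neg hcon)
  refine h.mono (measurable_coneMultiplier hφ α) (hm.indicator hshell)
    (K := ⟨(a ^ γ + (a + η) ^ γ) * (2 / ‖φ a‖), by positivity⟩)
    (Filter.Eventually.of_forall fun ζ => ?_)
  change _ ≤ (a ^ γ + (a + η) ^ γ) * (2 / ‖φ a‖) * _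
  by_cases hζ : ζ ∈ frequencyShell d a (a + η)
  · rw [Set.indicator_of_mem hζ]
    by_cases hc : |ζ.snd| < ‖ζ.fst‖
    · have hw := one_sub_div_sq_pos hc
      rw [norm_coneMultiplier hc, norm_homogeneousCone hc]
      obtain ⟨h1, h2⟩ := hζ
      have h3 := rpow_le_rpow_add_rpow γ ha0 h1 h2.le
      have h4 : ‖φ a‖ / 2 < ‖φ ‖ζ.fst‖‖ := hball (by
        rw [Real.dist_eq, abs_of_nonneg (by linarith)]; linarith)
      calc _ ≤ (a ^ γ + (a + η) ^ γ) * (1 - ζ.snd ^ 2 / ‖ζ.fst‖ ^ 2) ^ α := by gcongr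
        _ = (a ^ γ + (a + η) ^ γ) * (2 / ‖φ a‖) *
            ((1 - ζ.snd ^ 2 / ‖ζ.fst‖ ^ 2) ^ α * (‖φ a‖ / 2)) := by field_simp
        _ ≤ _ := by gcongr
    · rw [homogeneousCone, if_neg hc, norm_zero]; positivity
  · rw [Set.indicator_of_notMem hζ, norm_zero]; positivity

end Comparison

end VelocityAverage

end

theorem theorem1p2 (d : ℕ) (hd : 2 ≤ d) (q r : ℝ) (hq : 2 ≤ q) (hr : 2 ≤ r) (βp βm : ℝ)
    (hscal : βp + βm = (d : ℝ) / r + 1 / q - (d : ℝ) / 2)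
    (φ : ℝ → ℂ) (hφ : ContDiff ℝ ∞ φ) (hφsupp : tsupport φ ⊆ Set.Icc (1 / 2) 2)
    (hφne : φ ≠ 0) :
    VelocityAverage.SmoothingEstimate d q r βp βm ↔
      VelocityAverage.ConeMultiplierBounded d q r φ (βm + ((d : ℝ) - 3) / 4) := by
  rw [VelocityAverage.smoothingEstimate_iff_homogeneousCone hd,
    VelocityAverage.coneMultiplierBounded_iff]
  refine ⟨fun h => h.coneMultiplier hφ.continuous hφsupp, fun h => ?_⟩
  -- The scaling condition enters only here: it makes the degree of the homogeneous multiplier the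
  -- scale invariant one.
  have hγ : βp + βm - 1 / 2 = (d : ℝ) / r + 1 / q - (d + 1) / 2 := by rw [hscal]; ring
  rw [hγ]
  exact h.homogeneousCone_of_coneMultiplier (by omega) hq hr hφ.continuous hφsupp hφne
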